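/- **Conventions.** A (small) double category $\mathcal C$ has a set of objects, two categories $\mathcal M,\mathcal E$ on these objects (m-morphisms $\rightarrowtail$, e-morphisms $\circ\!\!\to$) and a set of squares with m-morphisms $f:A\rightarrowtail B$, $f':C\rightarrowtail D$ on top and bottom and e-morphisms $g:A\circ\!\!\to C$, $g':B\circ\!\!\to D$ on the left and right, with unital, associative horizontal and vertical compositions satisfying interchange. A mixed boundary that is filled by a square is called pseudo-commutative. Let $\mathrm{Ar}_\circlearrowleft\mathcal M$ and $\mathrm{Ar}_\circlearrowleft\mathcal E$ be the categories whose objects are m-morphisms (resp. e-morphisms) and whose morphisms are the squares. $\mathcal C$ has *shared isomorphisms* if the groupoids of isomorphisms of $\mathcal M$ and of $\mathcal E$ are identified (identically on objects), and a boundary having two parallel isomorphisms is filled by a (unique) square if and only if it commutes in $\mathcal M$ (resp. in $\mathcal E$). A *g-CGW category* is a double category with shared isomorphisms together with wide subcategories $\mathrm{Ar}_g\mathcal M$, $\mathrm{Ar}_g\mathcal E$ ("good squares") of the arrow categories of $\mathcal M$ and $\mathcal E$, and equivalences of categories $k:\mathrm{Ar}_\circlearrowleft\mathcal E\to\mathrm{Ar}_g\mathcal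 M$ and $c:\mathrm{Ar}_\circlearrowleft\mathcal M\to\mathrm{Ar}_g\mathcal E$ that do not change the codomains of arrows nor the maps between codomains (write $k(g):\ker g\rightarrowtail B$ for $g:A\circ\!\!\to B$ and $c(f):\mathrm{cok} f=B/A\circ\!\!\to B$ for $f:A\rightarrowtail B$), such that: (Z) there is a chosen object $\varnothing$, initial in both $\mathcal M$ and $\mathcal E$; (M) all m- and e-morphisms are monic in $\mathcal M$, resp. $\mathcal E$; (G) every commutative square $f\to f'$ whose map between domains is an isomorphism is good, and every good square is a pullback; (D) for each square, $k$ sends it to a map that is an isomorphism between domains if and only if $c$ does; such squares are called *distinguished*; (K) for each m-morphism $f:A\rightarrowtail B$ the boundary ($\varnothing\rightarrowtail B/A$, $\varnothing\circ\!\!\to A$, $c(f)$, $f$) is filled by a distinguished square, and for each e-morphism $g:A\circ\!\!\to B$ so is ($\varnothing\rightarrowtail A$, $\varnothing\circ\!\!\to\ker g$, $g$, $k(g)$). It is a *$\star$-CGW category* if moreover, for $\mathcal M$ and dually for $\mathcal E$ (except (PO)): (GS) a commutative square is good if and only if its transpose is; ($\star$) if a span $C\leftarrowtail A\rightarrowtail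 B$ can be completed to a good square, then the category of good squares completing it has an initial object $B\star_AC$, and the induced maps $B/A\to (B\star_AC)/C$ and $C/A\to(B\star_AC)/B$ are isomorphisms; (PO) every span in $\mathcal M$ can be completed to a good square; (PBL) if a horizontal (dually, vertical) composite boundary and its second square are pseudo-commutative, so is its first square; (POL) in a commutative diagram with rows $A\rightarrowtail B\rightarrowtail D$ and $C\rightarrowtail B\star_AC\rightarrowtail E$ whose left square is the $\star$-pushout, if the outer square is good then so is the right square. An *ECGW category* $(\mathcal C,\mathcal W)$ is a $\star$-CGW category with a class $\mathcal W$ of *acyclic* objects that contains all initial objects and such that, for every $A\rightarrowtail B$ and $Q\circ\!\!\to B$ forming together with $\varnothing\rightarrowtail Q$ and $\varnothing\circ\!\!\to A$ the boundary of a distinguished square, if two of $A,B,Q$ are acyclic then so is the third. An m-morphism (e-morphism) is a *weak equivalence* if its cokernel (kernel) object is acyclic. $S_n\mathcal C$ is the following double category. Its objects are the staircases: the functorial diagrams of objects $F_{i,j}$ ($0\le i\le j\le n$), m-morphisms $F_{i,j}\rightarrowtail F_{i,j'}$ ($j\le j'$), e-morphisms $F_{i',j}\circ\!\!\to F_{i,j}$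 ($i\le i'$) and squares, with $F_{i,i}=\varnothing$ and with all squares distinguished. Its m-morphisms are the families $F_{i,j}\rightarrowtail F'_{i,j}$ whose naturality squares on m-morphisms are good and on e-morphisms are pseudo-commutative; dually for e-morphisms; its squares are the pointwise squares. Monotone maps $\theta$ act by $(\theta^*F)_{i,j}=F_{\theta(i),\theta(j)}$. Let $wS_n\mathcal C$ be the restriction of $S_n\mathcal C$ to the m- and e-morphisms that are pointwise weak equivalences. Let $|wS_\bullet\mathcal C|$ be the geometric realization of the diagonal simplicial set $n\mapsto\{n\times n\text{ matrices of composable squares in }wS_n\mathcal C\}$, based at its only vertex, and put $$K_0(\mathcal C,\mathcal W)=\pi_0\,\Omega|wS_\bullet\mathcal C|=\pi_1|wS_\bullet\mathcal C| .$$ **Proposition.** For every ECGW category $(\mathcal C,\mathcal W)$, the group $K_0(\mathcal C,\mathcal W)$ is the free abelian group generated by the classes $[A]$ of the objects of $\mathcal C$, modulo the relations * $[\varnothing]=0$; * $[A]+[D]=[B]+[C]$ for each distinguished square with horizontal sides $A\rightarrowtail B$, $C\rightarrowtail D$ and vertical sides $A\circ\!\!\to C$, $B\circ\!\!\to D$;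 * $[A]=[B]$ for each m-morphism or e-morphism $A\to B$ that is a weak equivalence. More precisely, there is an isomorphism from the group so presented to $K_0(\mathcal C,\mathcal W)$ which sends $[A]$ to the class of the loop in $|wS_\bullet\mathcal C|$ given by $A$, viewed as an object of $S_1\mathcal C$, for every object $A$ of $\mathcal C$. -/

import Mathlib

open CategoryTheory Limits Opposite Simplicial

universe v w u

/-! ### Double categories -/

/-- A (small) double category: a set of objects, two categories on it (the m-morphisms and the
e-morphisms), and a set of squares for every boundary
```
A --f--> B
|g       |g'
C --f'-> D
```
with `f`, `f'` m-morphisms and `g`, `g'` e-morphisms.  Squares compose horizontally and vertically,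
unitally and associatively, and the interchange laws hold. -/
structure DoubleCategory : Type (u + 1) where
  Obj : Type u
  mcat : Category.{u} Obj
  ecat : Category.{u} Obj
  Sq {A B C D : Obj} (f : mcat.Hom A B) (g : ecat.Hom A C) (g' : ecat.Hom B D)
    (f' : mcat.Hom C D) : Type u
  /-- identity square on an e-morphism, for horizontal composition -/
  hId {A C : Obj} (g : ecat.Hom A C) : Sq (mcat.id A) g g (mcat.id C)
  /-- identity square on an m-morphism, for vertical composition -/
  vId {A B : Obj} (f : mcat.Hom A B) : Sq f (ecat.id A) (ecat.id B) f
  hComp {A₁ A₂ A₃ B₁ B₂ B₃ : Obj} {f₁ : mcat.Hom A₁ A₂} {f₂ : mcat.Hom A₂ A₃}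
    {g₁ : ecat.Hom A₁ B₁} {g₂ : ecat.Hom A₂ B₂} {g₃ : ecat.Hom A₃ B₃}
    {f₁' : mcat.Hom B₁ B₂} {f₂' : mcat.Hom B₂ B₃} (α : Sq f₁ g₁ g₂ f₁') (β : Sq f₂ g₂ g₃ f₂') :
    Sq (mcat.comp f₁ f₂) g₁ g₃ (mcat.comp f₁' f₂')
  vComp {A₁ A₂ A₃ B₁ B₂ B₃ : Obj} {g₁ : ecat.Hom A₁ A₂} {g₂ : ecat.Hom A₂ A₃}
    {f₁ : mcat.Hom A₁ B₁} {f₂ : mcat.Hom A₂ B₂} {f₃ : mcat.Hom A₃ B₃}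
    {g₁' : ecat.Hom B₁ B₂} {g₂' : ecat.Hom B₂ B₃} (α : Sq f₁ g₁ g₁' f₂) (β : Sq f₂ g₂ g₂' f₃) :
    Sq f₁ (ecat.comp g₁ g₂) (ecat.comp g₁' g₂') f₃
  hId_hComp {A B C D : Obj} {f : mcat.Hom A B} {g : ecat.Hom A C} {g' : ecat.Hom B D}
    {f' : mcat.Hom C D} (α : Sq f g g' f') : HEq (hComp (hId g) α) α
  hComp_hId {A B C D : Obj} {f : mcat.Hom A B} {g : ecat.Hom A C} {g' : ecat.Hom B D}
    {f' : mcat.Hom C D} (α : Sq f g g' f') : HEq (hComp α (hId g')) α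
  hComp_assoc {A₁ A₂ A₃ A₄ B₁ B₂ B₃ B₄ : Obj} {f₁ : mcat.Hom A₁ A₂} {f₂ : mcat.Hom A₂ A₃}
    {f₃ : mcat.Hom A₃ A₄} {g₁ : ecat.Hom A₁ B₁} {g₂ : ecat.Hom A₂ B₂} {g₃ : ecat.Hom A₃ B₃}
    {g₄ : ecat.Hom A₄ B₄} {f₁' : mcat.Hom B₁ B₂} {f₂' : mcat.Hom B₂ B₃} {f₃' : mcat.Hom B₃ B₄}
    (α : Sq f₁ g₁ g₂ f₁') (β : Sq f₂ g₂ g₃ f₂') (γ : Sq f₃ g₃ g₄ f₃') :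
    HEq (hComp (hComp α β) γ) (hComp α (hComp β γ))
  vId_vComp {A B C D : Obj} {f : mcat.Hom A B} {g : ecat.Hom A C} {g' : ecat.Hom B D}
    {f' : mcat.Hom C D} (α : Sq f g g' f') : HEq (vComp (vId f) α) α
  vComp_vId {A B C D : Obj} {f : mcat.Hom A B} {g : ecat.Hom A C} {g' : ecat.Hom B D}
    {f' : mcat.Hom C D} (α : Sq f g g' f') : HEq (vComp α (vId f')) α
  vComp_assoc {A₁ A₂ A₃ A₄ B₁ B₂ B₃ B₄ : Obj} {g₁ : ecat.Hom A₁ A₂} {g₂ : ecat.Hom A₂ A₃}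
    {g₃ : ecat.Hom A₃ A₄} {f₁ : mcat.Hom A₁ B₁} {f₂ : mcat.Hom A₂ B₂} {f₃ : mcat.Hom A₃ B₃}
    {f₄ : mcat.Hom A₄ B₄} {g₁' : ecat.Hom B₁ B₂} {g₂' : ecat.Hom B₂ B₃} {g₃' : ecat.Hom B₃ B₄}
    (α : Sq f₁ g₁ g₁' f₂) (β : Sq f₂ g₂ g₂' f₃) (γ : Sq f₃ g₃ g₃' f₄) :
    HEq (vComp (vComp α β) γ) (vComp α (vComp β γ))
  hId_id (A : Obj) : hId (ecat.id A) = vId (mcat.id A)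
  hId_comp {A B C : Obj} (g : ecat.Hom A B) (h : ecat.Hom B C) :
    vComp (hId g) (hId h) = hId (ecat.comp g h)
  vId_comp {A B C : Obj} (f : mcat.Hom A B) (h : mcat.Hom B C) :
    hComp (vId f) (vId h) = vId (mcat.comp f h)
  interchange {A₁ A₂ A₃ B₁ B₂ B₃ C₁ C₂ C₃ : Obj}
    {f₁ : mcat.Hom A₁ A₂} {f₂ : mcat.Hom A₂ A₃} {g₁ : ecat.Hom A₁ B₁} {g₂ : ecat.Hom A₂ B₂}
    {g₃ : ecat.Hom A₃ B₃} {f₁' : mcat.Hom B₁ B₂} {f₂' : mcat.Hom B₂ B₃}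
    {h₁ : ecat.Hom B₁ C₁} {h₂ : ecat.Hom B₂ C₂} {h₃ : ecat.Hom B₃ C₃}
    {f₁'' : mcat.Hom C₁ C₂} {f₂'' : mcat.Hom C₂ C₃}
    (α : Sq f₁ g₁ g₂ f₁') (β : Sq f₂ g₂ g₃ f₂') (γ : Sq f₁' h₁ h₂ f₁'') (δ : Sq f₂' h₂ h₃ f₂'') :
    vComp (hComp α β) (hComp γ δ) = hComp (vComp α γ) (vComp β δ)

namespace DoubleCategory

/-- A copy of the type of objects of a category, so that one type may underlie two categories. -/
@[ext]
structure Copy {α : Type u} (cat : Category.{u} α) : Type u where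
  of ::
  as : α

instance {α : Type u} (cat : Category.{u} α) : Category.{u} (Copy cat) where
  Hom X Y := cat.Hom X.as Y.as
  id X := cat.id X.as
  comp f g := cat.comp f g
  id_comp f := cat.id_comp f
  comp_id f := cat.comp_id f
  assoc f g h := cat.assoc f g h

/-- The category of m-morphisms. -/
abbrev M (C : DoubleCategory.{u}) : Type u := Copy C.mcat

/-- The category of e-morphisms. -/
abbrev E (C : DoubleCategory.{u}) : Type u := Copy C.ecat

/-- An object of `C`, as an object of the category of m-morphisms. -/
abbrev toM {C : DoubleCategory.{u}} (A : C.Obj) : C.M := Copy.of A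

/-- An object of `C`, as an object of the category of e-morphisms. -/
abbrev toE {C : DoubleCategory.{u}} (A : C.Obj) : C.E := Copy.of A

/-- m-morphisms from `A` to `B`. -/
abbrev MHom {C : DoubleCategory.{u}} (A B : C.Obj) : Type u := toM A ⟶ toM B

/-- e-morphisms from `A` to `B`. -/
abbrev EHom {C : DoubleCategory.{u}} (A B : C.Obj) : Type u := toE A ⟶ toE B

/-- The double category with the roles of m- and e-morphisms exchanged. -/
abbrev transpose (C : DoubleCategory.{u}) : DoubleCategory.{u} where
  Obj := C.Obj
  mcat := C.ecat
  ecat := C.mcat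
  Sq f g g' f' := C.Sq g f f' g'
  hId g := C.vId g
  vId f := C.hId f
  hComp α β := C.vComp α β
  vComp α β := C.hComp α β
  hId_hComp α := C.vId_vComp α
  hComp_hId α := C.vComp_vId α
  hComp_assoc α β γ := C.vComp_assoc α β γ
  vId_vComp α := C.hId_hComp α
  vComp_vId α := C.hComp_hId α
  vComp_assoc α β γ := C.hComp_assoc α β γ
  hId_id A := (C.hId_id A).symm
  hId_comp g h := C.vId_comp g h
  vId_comp f h := C.hId_comp f h
  interchange α β γ δ := (C.interchange α γ β δ).symm

/-- The full double subcategory on the objects satisfying `P`. -/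
def full (C : DoubleCategory.{u}) (P : C.Obj → Prop) : DoubleCategory.{u} where
  Obj := {A : C.Obj // P A}
  mcat :=
    { Hom := fun A B => C.mcat.Hom A.1 B.1
      id := fun A => C.mcat.id A.1
      comp := fun f g => C.mcat.comp f g
      id_comp := fun f => C.mcat.id_comp f
      comp_id := fun f => C.mcat.comp_id f
      assoc := fun f g h => C.mcat.assoc f g h }
  ecat :=
    { Hom := fun A B => C.ecat.Hom A.1 B.1
      id := fun A => C.ecat.id A.1
      comp := fun f g => C.ecat.comp f g
      id_comp := fun f => C.ecat.id_comp f
      comp_id := fun f => C.ecat.comp_id f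
      assoc := fun f g h => C.ecat.assoc f g h }
  Sq f g g' f' := C.Sq f g g' f'
  hId g := C.hId g
  vId f := C.vId f
  hComp α β := C.hComp α β
  vComp α β := C.vComp α β
  hId_hComp α := C.hId_hComp α
  hComp_hId α := C.hComp_hId α
  hComp_assoc α β γ := C.hComp_assoc α β γ
  vId_vComp α := C.vId_vComp α
  vComp_vId α := C.vComp_vId α
  vComp_assoc α β γ := C.vComp_assoc α β γ
  hId_id A := C.hId_id A.1
  hId_comp g h := C.hId_comp g h
  vId_comp f h := C.vId_comp f h
  interchange α β γ δ := C.interchange α β γ δ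

/-- The category whose objects are the e-morphisms of `C` and whose morphisms `g ⟶ g'` are the
squares of `C` with vertical sides `g` and `g'`.  The analogous category with the m-morphisms as
objects is `SqArr C.transpose`. -/
structure SqArr (C : DoubleCategory.{u}) : Type u where
  {src : C.Obj}
  {tgt : C.Obj}
  hom : EHom src tgt

/-- A morphism of `SqArr C`: a square together with its horizontal sides. -/
structure SqArr.Hom {C : DoubleCategory.{u}} (X Y : SqArr C) : Type u where
  top : MHom X.src Y.src
  bot : MHom X.tgt Y.tgt
  sq : C.Sq top X.hom Y.hom bot

theorem SqArr.Hom.ext' {C : DoubleCategory.{u}} {X Y : SqArr C} {φ ψ : SqArr.Hom X Y}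
    (h₁ : φ.top = ψ.top) (h₂ : φ.bot = ψ.bot) (h₃ : HEq φ.sq ψ.sq) : φ = ψ := by
  cases φ; cases ψ; cases h₁; cases h₂; cases h₃; rfl

instance (C : DoubleCategory.{u}) : Category.{u} (SqArr C) where
  Hom X Y := SqArr.Hom X Y
  id X := ⟨𝟙 _, 𝟙 _, C.hId X.hom⟩
  comp φ ψ := ⟨φ.top ≫ ψ.top, φ.bot ≫ ψ.bot, C.hComp φ.sq ψ.sq⟩
  id_comp φ := SqArr.Hom.ext' (Category.id_comp _) (Category.id_comp _) (C.hId_hComp φ.sq)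
  comp_id φ := SqArr.Hom.ext' (Category.comp_id _) (Category.comp_id _) (C.hComp_hId φ.sq)
  assoc φ ψ χ := SqArr.Hom.ext' (Category.assoc _ _ _) (Category.assoc _ _ _)
    (C.hComp_assoc φ.sq ψ.sq χ.sq)

/-- `C` has shared isomorphisms: the m-isomorphisms and the e-isomorphisms form the same groupoid,
and squares with two parallel isomorphisms are the commutative squares. -/
structure SharedIsos (C : DoubleCategory.{u}) where
  equiv (A B : C.Obj) : (toM A ≅ toM B) ≃ (toE A ≅ toE B)
  equiv_refl (A : C.Obj) : equiv A A (Iso.refl (toM A)) = Iso.refl (toE A)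
  equiv_trans {A B D : C.Obj} (i : toM A ≅ toM B) (j : toM B ≅ toM D) :
    equiv A D (i ≪≫ j) = equiv A B i ≪≫ equiv B D j
  sq_m_iff {A B A' B' : C.Obj} (g : MHom A B) (g' : MHom A' B')
    (i : toM A ≅ toM A') (j : toM B ≅ toM B') :
    Nonempty (C.Sq g (equiv _ _ i).hom (equiv _ _ j).hom g') ↔ g ≫ j.hom = i.hom ≫ g'
  sq_m_unique {A B A' B' : C.Obj} (g : MHom A B) (g' : MHom A' B')
    (i : toM A ≅ toM A') (j : toM B ≅ toM B') :
    Subsingleton (C.Sq g (equiv _ _ i).hom (equiv _ _ j).hom g')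
  sq_e_iff {A B A' B' : C.Obj} (g : EHom A B) (g' : EHom A' B')
    (i : toM A ≅ toM A') (j : toM B ≅ toM B') :
    Nonempty (C.Sq i.hom g g' j.hom) ↔ g ≫ (equiv _ _ j).hom = (equiv _ _ i).hom ≫ g'
  sq_e_unique {A B A' B' : C.Obj} (g : EHom A B) (g' : EHom A' B')
    (i : toM A ≅ toM A') (j : toM B ≅ toM B') :
    Subsingleton (C.Sq i.hom g g' j.hom)

/-- Shared isomorphisms of the transposed double category. -/
def SharedIsos.transpose {C : DoubleCategory.{u}} (S : SharedIsos C) :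
    SharedIsos C.transpose where
  equiv A B := (S.equiv A B).symm
  equiv_refl A := (Equiv.symm_apply_eq _).2 (S.equiv_refl A).symm
  equiv_trans i j := (Equiv.symm_apply_eq _).2 (by
    rw [S.equiv_trans, Equiv.apply_symm_apply, Equiv.apply_symm_apply])
  sq_m_iff g g' i j := by
    have h := S.sq_e_iff g g' ((S.equiv _ _).symm i) ((S.equiv _ _).symm j)
    rwa [Equiv.apply_symm_apply, Equiv.apply_symm_apply] at h
  sq_m_unique g g' i j := S.sq_e_unique g g' ((S.equiv _ _).symm i) ((S.equiv _ _).symm j)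
  sq_e_iff g g' i j := by
    have h := S.sq_m_iff g g' ((S.equiv _ _).symm i) ((S.equiv _ _).symm j)
    rwa [Equiv.apply_symm_apply, Equiv.apply_symm_apply] at h
  sq_e_unique g g' i j := by
    have h := S.sq_m_unique g g' ((S.equiv _ _).symm i) ((S.equiv _ _).symm j)
    rwa [Equiv.apply_symm_apply, Equiv.apply_symm_apply] at h

/-- A class of good squares in the category of m-morphisms (a wide subcategory of its arrow
category), and a functor `k` from `SqArr C` to it, which sends an e-morphism `g : A ⟶ B` to an
m-morphism `ι g : ker g ⟶ B` with the same codomain, and a square to a good square which is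
unchanged between the codomains:
```
A --> A'          ker g -map-> ker g'
|g    |g'          |ι g         |ι g'
B -f'-> B'         B ----f'---> B'
``` -/
structure KernelFunctor (C : DoubleCategory.{u}) where
  good : MorphismProperty (Arrow C.M)
  good_mul : good.IsMultiplicative
  ker {A B : C.Obj} (g : EHom A B) : C.Obj
  ι {A B : C.Obj} (g : EHom A B) : MHom (ker g) B
  map {A B A' B' : C.Obj} {f : MHom A A'} {g : EHom A B} {g' : EHom A' B'} {f' : MHom B B'}
    (α : C.Sq f g g' f') : MHom (ker g) (ker g')
  w {A B A' B' : C.Obj} {f : MHom A A'} {g : EHom A B} {g' : EHom A' B'} {f' : MHom B B'}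
    (α : C.Sq f g g' f') : map α ≫ ι g' = ι g ≫ f'
  map_good {A B A' B' : C.Obj} {f : MHom A A'} {g : EHom A B} {g' : EHom A' B'} {f' : MHom B B'}
    (α : C.Sq f g g' f') :
    good (Arrow.homMk (map α) f' (w α) : Arrow.mk (ι g) ⟶ Arrow.mk (ι g'))
  map_hId {A B : C.Obj} (g : EHom A B) : map (C.hId g) = 𝟙 _
  map_hComp {A₁ A₂ A₃ B₁ B₂ B₃ : C.Obj} {f₁ : MHom A₁ A₂} {f₂ : MHom A₂ A₃}
    {g₁ : EHom A₁ B₁} {g₂ : EHom A₂ B₂} {g₃ : EHom A₃ B₃}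
    {f₁' : MHom B₁ B₂} {f₂' : MHom B₂ B₃} (α : C.Sq f₁ g₁ g₂ f₁') (β : C.Sq f₂ g₂ g₃ f₂') :
    map (C.hComp α β) = map α ≫ map β

attribute [instance] KernelFunctor.good_mul

/-- The data above as a functor into the category of m-morphisms and good squares. -/
def KernelFunctor.functor {C : DoubleCategory.{u}} (k : KernelFunctor C) :
    SqArr C ⥤ WideSubcategory k.good where
  obj X := ⟨Arrow.mk (k.ι X.hom)⟩
  map φ := ⟨Arrow.homMk (k.map φ.sq) φ.bot (k.w φ.sq), k.map_good φ.sq⟩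
  map_id X := by
    apply WideSubcategory.hom_ext
    apply Arrow.hom_ext
    · exact k.map_hId X.hom
    · rfl
  map_comp φ ψ := by
    apply WideSubcategory.hom_ext
    apply Arrow.hom_ext
    · exact k.map_hComp φ.sq ψ.sq
    · rfl

/-- A commutative square of m-morphisms, as a morphism of arrows `f ⟶ f'`, is good. -/
def KernelFunctor.GoodSq {C : DoubleCategory.{u}} (k : KernelFunctor C) {A B A' B' : C.Obj}
    (f : MHom A B) (g : MHom A A') (h : MHom B B') (f' : MHom A' B') : Prop :=
  ∃ comm : g ≫ f' = f ≫ h, k.good (Arrow.homMk g h comm : Arrow.mk f ⟶ Arrow.mk f')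

end DoubleCategory

open DoubleCategory

/-! ### g-CGW categories -/

/-- The structure of a g-CGW category on a double category. The functor `k` sends e-morphisms to
m-morphisms (kernels); the functor `c` sends m-morphisms to e-morphisms (cokernels). -/
structure GCGW (C : DoubleCategory.{u}) where
  shared : SharedIsos C
  /-- good squares of m-morphisms and the functor `k` -/
  k : KernelFunctor C
  /-- good squares of e-morphisms and the functor `c` -/
  c : KernelFunctor C.transpose
  k_equiv : k.functor.IsEquivalence
  c_equiv : c.functor.IsEquivalence
  /-- (Z) -/
  empty : C.Obj
  emptyM : IsInitial (toM empty)
  emptyE : IsInitial (toE empty)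
  /-- (M) -/
  mono_m {A B : C.Obj} (f : MHom A B) : Mono f
  mono_e {A B : C.Obj} (g : EHom A B) : Mono g
  /-- (G) -/
  good_m_of_isIso {f f' : Arrow C.M} (φ : f ⟶ f') : IsIso φ.left → k.good φ
  isPullback_m_of_good {f f' : Arrow C.M} (φ : f ⟶ f') : k.good φ →
    IsPullback f.hom φ.left φ.right f'.hom
  good_e_of_isIso {g g' : Arrow C.E} (φ : g ⟶ g') : IsIso φ.left → c.good φ
  isPullback_e_of_good {g g' : Arrow C.E} (φ : g ⟶ g') : c.good φ →
    IsPullback g.hom φ.left φ.right g'.hom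
  /-- (D) -/
  dist_iff {A B A' B' : C.Obj} {f : MHom A B} {g : EHom A A'} {g' : EHom B B'} {f' : MHom A' B'}
    (α : C.Sq f g g' f') : IsIso (k.map α) ↔ IsIso (c.map (f := g) (f' := g') α)
  /-- (K) -/
  dist_coker {A B : C.Obj} (f : MHom A B) :
    ∃ α : C.Sq (emptyM.to (toM (c.ker (A := A) (B := B) f))) (emptyE.to (toE A)) (c.ι (A := A) (B := B) f) f,
      IsIso (k.map α)
  dist_ker {A B : C.Obj} (g : EHom A B) :
    ∃ α : C.Sq (emptyM.to (toM A)) (emptyE.to (toE (k.ker g))) g (k.ι g), IsIso (k.map α)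

namespace GCGW

variable {C : DoubleCategory.{u}} (G : GCGW C)

/-- The same g-CGW category with m- and e-morphisms exchanged. -/
def transpose : GCGW C.transpose where
  shared := G.shared.transpose
  k := G.c
  c := G.k
  k_equiv := G.c_equiv
  c_equiv := G.k_equiv
  empty := G.empty
  emptyM := G.emptyE
  emptyE := G.emptyM
  mono_m := G.mono_e
  mono_e := G.mono_m
  good_m_of_isIso := G.good_e_of_isIso
  isPullback_m_of_good := G.isPullback_e_of_good
  good_e_of_isIso := G.good_m_of_isIso
  isPullback_e_of_good := G.isPullback_m_of_good
  dist_iff α := (G.dist_iff α).symm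
  dist_coker g := by
    obtain ⟨α, h⟩ := G.dist_ker g
    exact ⟨α, (G.dist_iff α).1 h⟩
  dist_ker f := by
    obtain ⟨α, h⟩ := G.dist_coker f
    exact ⟨α, (G.dist_iff α).1 h⟩

/-- The cokernel object `B/A` of an m-morphism. -/
def cok {A B : C.Obj} (f : MHom A B) : C.Obj := G.c.ker (A := A) (B := B) f

/-- The cokernel `c(f) : B/A ⟶ B` of an m-morphism, an e-morphism. -/
def cokι {A B : C.Obj} (f : MHom A B) : EHom (G.cok f) B := G.c.ι (A := A) (B := B) f

/-- The kernel object `B∖A` of an e-morphism. -/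
def ker {A B : C.Obj} (g : EHom A B) : C.Obj := G.k.ker g

/-- The kernel `k(g) : B∖A ⟶ B` of an e-morphism, an m-morphism. -/
def kerι {A B : C.Obj} (g : EHom A B) : MHom (G.ker g) B := G.k.ι g

/-- The given boundary is filled by a distinguished square. -/
def Distinguished {A B A' B' : C.Obj} (f : MHom A B) (g : EHom A A') (g' : EHom B B')
    (f' : MHom A' B') : Prop :=
  ∃ α : C.Sq f g g' f', IsIso (G.k.map α)

/-- `f : A ⟶ B` (m-morphism) and `g : Q ⟶ B` (e-morphism) are a kernel-cokernel pair. -/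
def KerCok {A B Q : C.Obj} (f : MHom A B) (g : EHom Q B) : Prop :=
  G.Distinguished (G.emptyM.to (toM Q)) (G.emptyE.to (toE A)) g f

/-- A square is determined by its boundary. -/
theorem sq_subsingleton {C : DoubleCategory.{u}} (G : GCGW C) {A B A' B' : C.Obj} (f : MHom A B) (g : EHom A A') (g' : EHom B B')
    (f' : MHom A' B') : Subsingleton (C.Sq f g g' f') := by
  constructor
  intro α β
  have := G.k_equiv
  have := G.mono_m (G.k.ι g')
  have h : G.k.map α = G.k.map β := by
    rw [← cancel_mono (G.k.ι g'), G.k.w α, G.k.w β]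
  let a : SqArr.mk g ⟶ SqArr.mk g' := (⟨f, f', α⟩ : SqArr.Hom _ _)
  let b : SqArr.mk g ⟶ SqArr.mk g' := (⟨f, f', β⟩ : SqArr.Hom _ _)
  have hab : a = b := by
    apply G.k.functor.map_injective
    apply WideSubcategory.hom_ext
    apply Arrow.hom_ext
    · exact h
    · rfl
  injection hab with _ _ h₃

end GCGW

/-! ### ⋆-CGW categories and acyclic objects -/

namespace GCGW

variable {C : DoubleCategory.{u}} (G : GCGW C)

/-- (GS) for m-morphisms: good squares are symmetric. -/
def AxiomGS : Prop :=
  ∀ {A B A' B' : C.Obj} (f : MHom A B) (g : MHom A A') (h : MHom B B') (f' : MHom A' B'),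
    G.k.GoodSq f g h f' ↔ G.k.GoodSq g f f' h

/-- `D`, with `inl : B ⟶ D` and `inr : Q ⟶ D`, is the ⋆-pushout of the span of m-morphisms
`f : A ⟶ B`, `g : A ⟶ Q`: an initial object among the good squares completing the span. -/
structure IsStarPushout {A B Q D : C.Obj} (f : MHom A B) (g : MHom A Q) (inl : MHom B D)
    (inr : MHom Q D) : Prop where
  good : G.k.GoodSq f g inl inr
  exists_unique : ∀ {D' : C.Obj} (inl' : MHom B D') (inr' : MHom Q D'),
    G.k.GoodSq f g inl' inr' → ∃! d : MHom D D', inl ≫ d = inl' ∧ inr ≫ d = inr'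

/-- The map induced by a good square of m-morphisms between the cokernels of `f` and `f'` (the
m-morphism forming a square with the cokernels and `h`) is an isomorphism. -/
def InducesIsoOnCok {A B A' B' : C.Obj} (f : MHom A B) (h : MHom B B') (f' : MHom A' B') : Prop :=
  ∃ v : MHom (G.cok f) (G.cok f'), Nonempty (C.Sq v (G.cokι f) (G.cokι f') h) ∧ IsIso v

/-- (⋆) for m-morphisms. -/
def AxiomStar : Prop :=
  ∀ {A B Q : C.Obj} (f : MHom A B) (g : MHom A Q),
    (∃ (D : C.Obj) (inl : MHom B D) (inr : MHom Q D), G.k.GoodSq f g inl inr) →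
    ∃ (D : C.Obj) (inl : MHom B D) (inr : MHom Q D), G.IsStarPushout f g inl inr ∧
      G.InducesIsoOnCok f inl inr ∧ G.InducesIsoOnCok g inr inl

/-- (PO), only required for m-morphisms. -/
def AxiomPO : Prop :=
  ∀ {A B Q : C.Obj} (f : MHom A B) (g : MHom A Q),
    ∃ (D : C.Obj) (inl : MHom B D) (inr : MHom Q D), G.k.GoodSq f g inl inr

/-- (POL) for m-morphisms: in a commutative diagram
```
A -f-> B -p-> D
|g     |inl   |r
Q -inr> P -q-> X
```
whose left square is a ⋆-pushout, if the outer square is good then so is the right square. -/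
def AxiomPOL : Prop :=
  ∀ {A B Q P D X : C.Obj} (f : MHom A B) (g : MHom A Q) (inl : MHom B P) (inr : MHom Q P)
    (p : MHom B D) (q : MHom P X) (r : MHom D X),
    G.IsStarPushout f g inl inr → p ≫ r = inl ≫ q →
    G.k.GoodSq (f ≫ p) g r (inr ≫ q) → G.k.GoodSq p inl r q

end GCGW

/-- (PBL) in the direction of m-morphisms: if the outer composite and the right square are
pseudo-commutative, then so is the left square. -/
def DoubleCategory.AxiomPBL (C : DoubleCategory.{u}) : Prop :=
  ∀ {A B D A' B' D' : C.Obj} (f : MHom A B) (h : MHom B D) (f' : MHom A' B') (h' : MHom B' D')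
    (a : EHom A A') (b : EHom B B') (d : EHom D D'),
    Nonempty (C.Sq h b d h') → Nonempty (C.Sq (C.mcat.comp f h) a d (C.mcat.comp f' h')) → Nonempty (C.Sq f a b f')

/-- A ⋆-CGW category. -/
structure StarCGW (C : DoubleCategory.{u}) extends GCGW C where
  gs_m : toGCGW.AxiomGS
  gs_e : toGCGW.transpose.AxiomGS
  star_m : toGCGW.AxiomStar
  star_e : toGCGW.transpose.AxiomStar
  po : toGCGW.AxiomPO
  pbl_m : C.AxiomPBL
  pbl_e : C.transpose.AxiomPBL
  pol_m : toGCGW.AxiomPOL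
  pol_e : toGCGW.transpose.AxiomPOL

/-- An ECGW category: a ⋆-CGW category with an acyclicity structure. -/
structure ECGW (C : DoubleCategory.{u}) extends StarCGW C where
  Acyclic : C.Obj → Prop
  /-- (IA) -/
  acyclic_of_isInitial : ∀ A : C.Obj, Nonempty (IsInitial (toM A)) → Acyclic A
  /-- (A23) -/
  acyclic_mid : ∀ {A B Q : C.Obj} (f : MHom A B) (g : EHom Q B), toGCGW.KerCok f g →
    Acyclic A → Acyclic Q → Acyclic B
  acyclic_cok : ∀ {A B Q : C.Obj} (f : MHom A B) (g : EHom Q B), toGCGW.KerCok f g →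
    Acyclic A → Acyclic B → Acyclic Q
  acyclic_ker : ∀ {A B Q : C.Obj} (f : MHom A B) (g : EHom Q B), toGCGW.KerCok f g →
    Acyclic B → Acyclic Q → Acyclic A

namespace ECGW

variable {C : DoubleCategory.{u}} (W : ECGW C)

/-- m-equivalences. -/
def MEquiv {A B : C.Obj} (f : MHom A B) : Prop := W.Acyclic (W.cok f)

/-- e-equivalences. -/
def EEquiv {A B : C.Obj} (g : EHom A B) : Prop := W.Acyclic (W.ker g)

end ECGW

/-! ### Double functors and functor double categories -/

/-- A double functor. -/
structure DoubleFunctor (D : DoubleCategory.{v}) (C : DoubleCategory.{u}) where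
  obj : D.Obj → C.Obj
  mapM {x y : D.Obj} (f : MHom x y) : MHom (obj x) (obj y)
  mapE {x y : D.Obj} (g : EHom x y) : EHom (obj x) (obj y)
  mapSq {x y x' y' : D.Obj} {f : MHom x y} {g : EHom x x'} {g' : EHom y y'} {f' : MHom x' y'}
    (α : D.Sq f g g' f') : C.Sq (mapM f) (mapE g) (mapE g') (mapM f')
  mapM_id (x : D.Obj) : mapM (𝟙 (toM x)) = 𝟙 _
  mapM_comp {x y z : D.Obj} (f : MHom x y) (f' : MHom y z) : mapM (f ≫ f') = mapM f ≫ mapM f'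
  mapE_id (x : D.Obj) : mapE (𝟙 (toE x)) = 𝟙 _
  mapE_comp {x y z : D.Obj} (g : EHom x y) (g' : EHom y z) : mapE (g ≫ g') = mapE g ≫ mapE g'
  mapSq_hId {x y : D.Obj} (g : EHom x y) : HEq (mapSq (D.hId g)) (C.hId (mapE g))
  mapSq_vId {x y : D.Obj} (f : MHom x y) : HEq (mapSq (D.vId f)) (C.vId (mapM f))
  mapSq_hComp {A₁ A₂ A₃ B₁ B₂ B₃ : D.Obj} {f₁ : MHom A₁ A₂} {f₂ : MHom A₂ A₃}
    {g₁ : EHom A₁ B₁} {g₂ : EHom A₂ B₂} {g₃ : EHom A₃ B₃} {f₁' : MHom B₁ B₂} {f₂' : MHom B₂ B₃}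
    (α : D.Sq f₁ g₁ g₂ f₁') (β : D.Sq f₂ g₂ g₃ f₂') :
    HEq (mapSq (D.hComp α β)) (C.hComp (mapSq α) (mapSq β))
  mapSq_vComp {A₁ A₂ A₃ B₁ B₂ B₃ : D.Obj} {g₁ : EHom A₁ A₂} {g₂ : EHom A₂ A₃}
    {f₁ : MHom A₁ B₁} {f₂ : MHom A₂ B₂} {f₃ : MHom A₃ B₃} {g₁' : EHom B₁ B₂} {g₂' : EHom B₂ B₃}
    (α : D.Sq f₁ g₁ g₁' f₂) (β : D.Sq f₂ g₂ g₂' f₃) :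
    HEq (mapSq (D.vComp α β)) (C.vComp (mapSq α) (mapSq β))

namespace DoubleFunctor

theorem mapSq_congr {D : DoubleCategory.{v}} {C : DoubleCategory.{u}} (F : DoubleFunctor D C)
    {x y x' y' : D.Obj} {f₁ f₂ : MHom x y} {g₁ g₂ : EHom x x'} {h₁ h₂ : EHom y y'}
    {k₁ k₂ : MHom x' y'} (ef : f₁ = f₂) (eg : g₁ = g₂) (eh : h₁ = h₂) (ek : k₁ = k₂)
    {α : D.Sq f₁ g₁ h₁ k₁} {β : D.Sq f₂ g₂ h₂ k₂} (e : HEq α β) :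
    HEq (F.mapSq α) (F.mapSq β) := by
  subst ef eg eh ek
  cases e
  rfl

/-- Composition of double functors. -/
def comp {B : DoubleCategory.{w}} {D : DoubleCategory.{v}} {C : DoubleCategory.{u}}
    (H : DoubleFunctor B D) (F : DoubleFunctor D C) : DoubleFunctor B C where
  obj x := F.obj (H.obj x)
  mapM f := F.mapM (H.mapM f)
  mapE g := F.mapE (H.mapE g)
  mapSq α := F.mapSq (H.mapSq α)
  mapM_id x := by rw [H.mapM_id, F.mapM_id]
  mapM_comp f f' := by rw [H.mapM_comp, F.mapM_comp]
  mapE_id x := by rw [H.mapE_id, F.mapE_id]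
  mapE_comp g g' := by rw [H.mapE_comp, F.mapE_comp]
  mapSq_hId g := (F.mapSq_congr (H.mapM_id _) rfl rfl (H.mapM_id _) (H.mapSq_hId g)).trans
    (F.mapSq_hId (H.mapE g))
  mapSq_vId f := (F.mapSq_congr rfl (H.mapE_id _) (H.mapE_id _) rfl (H.mapSq_vId f)).trans
    (F.mapSq_vId (H.mapM f))
  mapSq_hComp α β := (F.mapSq_congr (H.mapM_comp _ _) rfl rfl (H.mapM_comp _ _)
    (H.mapSq_hComp α β)).trans (F.mapSq_hComp (H.mapSq α) (H.mapSq β))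
  mapSq_vComp α β := (F.mapSq_congr rfl (H.mapE_comp _ _) (H.mapE_comp _ _) rfl
    (H.mapSq_vComp α β)).trans (F.mapSq_vComp (H.mapSq α) (H.mapSq β))

/-- The constant double functor. -/
def const (D : DoubleCategory.{v}) (C : DoubleCategory.{u}) (A : C.Obj) : DoubleFunctor D C where
  obj _ := A
  mapM _ := 𝟙 _
  mapE _ := 𝟙 _
  mapSq _ := C.hId (𝟙 (toE A))
  mapM_id _ := rfl
  mapM_comp _ _ := (Category.comp_id _).symm
  mapE_id _ := rfl
  mapE_comp _ _ := (Category.comp_id _).symm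
  mapSq_hId _ := HEq.rfl
  mapSq_vId _ := heq_of_eq (C.hId_id A)
  mapSq_hComp _ _ := (C.hComp_hId _).symm
  mapSq_vComp _ _ := by
    have h := C.vId_vComp (C.hId (C.ecat.id A))
    rw [← C.hId_id A] at h
    exact h.symm

end DoubleFunctor

namespace GCGW

variable {D : DoubleCategory.{v}} {C : DoubleCategory.{u}} (G : GCGW C)

/-- Good m-natural transformations: the naturality squares on m-morphisms are good (in particular
commutative), those on e-morphisms are pseudo-commutative. As squares are determined by their
boundaries, no further compatibility between these squares has to be imposed. -/
@[ext]
structure MTrans (F F' : DoubleFunctor D C) : Type (max u v) where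
  app (x : D.Obj) : MHom (F.obj x) (F'.obj x)
  good {x y : D.Obj} (f : MHom x y) : G.k.GoodSq (F.mapM f) (app x) (app y) (F'.mapM f)
  sq {x y : D.Obj} (g : EHom x y) : Nonempty (C.Sq (app x) (F.mapE g) (F'.mapE g) (app y))

/-- Good e-natural transformations. -/
@[ext]
structure ETrans (F F' : DoubleFunctor D C) : Type (max u v) where
  app (x : D.Obj) : EHom (F.obj x) (F'.obj x)
  good {x y : D.Obj} (g : EHom x y) :
    G.c.GoodSq (A := F.obj x) (B := F.obj y) (A' := F'.obj x) (B' := F'.obj y)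
      (F.mapE g) (app x) (app y) (F'.mapE g)
  sq {x y : D.Obj} (f : MHom x y) : Nonempty (C.Sq (F.mapM f) (app x) (app y) (F'.mapM f))

theorem goodSq_id (k : KernelFunctor C) {A B : C.Obj} (f : MHom A B) :
    k.GoodSq f (𝟙 _) (𝟙 _) f :=
  ⟨by simp, k.good.id_mem (Arrow.mk f)⟩

theorem goodSq_comp (k : KernelFunctor C) {A B A' B' A'' B'' : C.Obj} {f : MHom A B}
    {g : MHom A A'} {h : MHom B B'} {f' : MHom A' B'} {g' : MHom A' A''} {h' : MHom B' B''}
    {f'' : MHom A'' B''} (p : k.GoodSq f g h f') (q : k.GoodSq f' g' h' f'') :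
    k.GoodSq f (g ≫ g') (h ≫ h') f'' := by
  obtain ⟨w, p⟩ := p
  obtain ⟨w', q⟩ := q
  exact ⟨by rw [Category.assoc, w', ← Category.assoc, w, Category.assoc],
    k.good.comp_mem _ _ p q⟩

/-- The double category `C^D`: double functors `D ⟶ C`, good m- and e-natural transformations,
and all modifications (pointwise squares). -/
def functorDouble (D : DoubleCategory.{v}) (G : GCGW C) : DoubleCategory.{max u v} where
  Obj := DoubleFunctor D C
  mcat :=
    { Hom := fun F F' => G.MTrans F F'
      id := fun F => ⟨fun _ => 𝟙 _, fun f => goodSq_id G.k _, fun g => ⟨C.hId _⟩⟩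
      comp := fun μ ν => ⟨fun x => μ.app x ≫ ν.app x,
        fun f => goodSq_comp G.k (μ.good f) (ν.good f),
        fun g => ⟨C.hComp (μ.sq g).some (ν.sq g).some⟩⟩
      id_comp := fun μ => by ext x; exact Category.id_comp (μ.app x)
      comp_id := fun μ => by ext x; exact Category.comp_id (μ.app x)
      assoc := fun μ ν ξ => by ext x; exact Category.assoc (μ.app x) (ν.app x) (ξ.app x) }
  ecat :=
    { Hom := fun F F' => G.ETrans F F'
      id := fun F => ⟨fun _ => 𝟙 _, fun f => goodSq_id G.c _, fun g => ⟨C.vId _⟩⟩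
      comp := fun μ ν => ⟨fun x => μ.app x ≫ ν.app x,
        fun f => goodSq_comp G.c (μ.good f) (ν.good f),
        fun g => ⟨C.vComp (μ.sq g).some (ν.sq g).some⟩⟩
      id_comp := fun μ => by ext x; exact Category.id_comp (μ.app x)
      comp_id := fun μ => by ext x; exact Category.comp_id (μ.app x)
      assoc := fun μ ν ξ => by ext x; exact Category.assoc (μ.app x) (ν.app x) (ξ.app x) }
  Sq {F₁ F₂ F₃ F₄} μ η η' μ' :=
    ∀ x : D.Obj, C.Sq (MTrans.app μ x) (ETrans.app η x) (ETrans.app η' x) (MTrans.app μ' x)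
  hId η := fun x => C.hId (ETrans.app η x)
  vId μ := fun x => C.vId (MTrans.app μ x)
  hComp α β := fun x => C.hComp (α x) (β x)
  vComp α β := fun x => C.vComp (α x) (β x)
  hId_hComp α := Function.hfunext rfl fun x y h => by cases h; exact C.hId_hComp (α x)
  hComp_hId α := Function.hfunext rfl fun x y h => by cases h; exact C.hComp_hId (α x)
  hComp_assoc α β γ := Function.hfunext rfl fun x y h => by
    cases h; exact C.hComp_assoc (α x) (β x) (γ x)
  vId_vComp α := Function.hfunext rfl fun x y h => by cases h; exact C.vId_vComp (α x)
  vComp_vId α := Function.hfunext rfl fun x y h => by cases h; exact C.vComp_vId (α x)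
  vComp_assoc α β γ := Function.hfunext rfl fun x y h => by
    cases h; exact C.vComp_assoc (α x) (β x) (γ x)
  hId_id F := funext fun x => C.hId_id (F.obj x)
  hId_comp η ζ := funext fun x => C.hId_comp (ETrans.app η x) (ETrans.app ζ x)
  vId_comp μ ν := funext fun x => C.vId_comp (MTrans.app μ x) (MTrans.app ν x)
  interchange α β γ δ := funext fun x => C.interchange (α x) (β x) (γ x) (δ x)

end GCGW

/-! ### The shapes: staircases and grids -/

/-- Objects `A_{i,j}`, `i ≤ j`, of the staircase. -/
abbrev StairObj (n : ℕ) : Type := {p : Fin (n + 1) × Fin (n + 1) // p.1 ≤ p.2}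

/-- The double category generated by the staircase
```
A₀₀ → A₀₁ → A₀₂ → ⋯        (→ : m-morphisms)
       ↑     ↑
      A₁₁ → A₁₂ → ⋯        (↑ : e-morphisms)
             ↑
            A₂₂ → ⋯
```
There is one m-morphism `A_{i,j} ⟶ A_{i,j'}` for `j ≤ j'`, one e-morphism `A_{i',j} ⟶ A_{i,j}` for
`i ≤ i'`, and one square for every possible boundary. -/
def Stair (n : ℕ) : DoubleCategory.{0} where
  Obj := StairObj n
  mcat :=
    { Hom := fun p q => PLift (p.1.1 = q.1.1 ∧ p.1.2 ≤ q.1.2)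
      id := fun _ => ⟨rfl, le_rfl⟩
      comp := fun f g => ⟨f.down.1.trans g.down.1, f.down.2.trans g.down.2⟩
      id_comp := fun _ => rfl
      comp_id := fun _ => rfl
      assoc := fun _ _ _ => rfl }
  ecat :=
    { Hom := fun p q => PLift (q.1.1 ≤ p.1.1 ∧ p.1.2 = q.1.2)
      id := fun _ => ⟨le_rfl, rfl⟩
      comp := fun f g => ⟨g.down.1.trans f.down.1, f.down.2.trans g.down.2⟩
      id_comp := fun _ => rfl
      comp_id := fun _ => rfl
      assoc := fun _ _ _ => rfl }
  Sq _ _ _ _ := Unit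
  hId _ := ()
  vId _ := ()
  hComp _ _ := ()
  vComp _ _ := ()
  hId_hComp _ := HEq.rfl
  hComp_hId _ := HEq.rfl
  hComp_assoc _ _ _ := HEq.rfl
  vId_vComp _ := HEq.rfl
  vComp_vId _ := HEq.rfl
  vComp_assoc _ _ _ := HEq.rfl
  hId_id _ := rfl
  hId_comp _ _ := rfl
  vId_comp _ _ := rfl
  interchange _ _ _ _ := rfl

/-- The object `A_{i,j}` of the staircase. -/
def Stair.mk {n : ℕ} (i j : Fin (n + 1)) (h : i ≤ j) : (Stair n).Obj := (⟨(i, j), h⟩ : StairObj n)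

/-- The double functor between staircases induced by a monotone map: `A_{i,j} ↦ A_{θ i,θ j}`. -/
def Stair.map {m n : ℕ} (θ : Fin (m + 1) →o Fin (n + 1)) : DoubleFunctor (Stair m) (Stair n) where
  obj p := (⟨(θ p.1.1, θ p.1.2), θ.monotone p.2⟩ : StairObj n)
  mapM f := ⟨congrArg θ f.down.1, θ.monotone f.down.2⟩
  mapE g := ⟨θ.monotone g.down.1, congrArg θ g.down.2⟩
  mapSq _ := ()
  mapM_id _ := rfl
  mapM_comp _ _ := rfl
  mapE_id _ := rfl
  mapE_comp _ _ := rfl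
  mapSq_hId _ := HEq.rfl
  mapSq_vId _ := HEq.rfl
  mapSq_hComp _ _ := HEq.rfl
  mapSq_vComp _ _ := HEq.rfl

/-- The free double category on a `p × q` grid of squares, so that a double functor from it is a
matrix of composable squares. -/
def Grid (p q : ℕ) : DoubleCategory.{0} where
  Obj := Fin (p + 1) × Fin (q + 1)
  mcat :=
    { Hom := fun x y => PLift (x.1 ≤ y.1 ∧ x.2 = y.2)
      id := fun _ => ⟨le_rfl, rfl⟩
      comp := fun f g => ⟨f.down.1.trans g.down.1, f.down.2.trans g.down.2⟩
      id_comp := fun _ => rfl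
      comp_id := fun _ => rfl
      assoc := fun _ _ _ => rfl }
  ecat :=
    { Hom := fun x y => PLift (x.1 = y.1 ∧ x.2 ≤ y.2)
      id := fun _ => ⟨rfl, le_rfl⟩
      comp := fun f g => ⟨f.down.1.trans g.down.1, f.down.2.trans g.down.2⟩
      id_comp := fun _ => rfl
      comp_id := fun _ => rfl
      assoc := fun _ _ _ => rfl }
  Sq _ _ _ _ := Unit
  hId _ := ()
  vId _ := ()
  hComp _ _ := ()
  vComp _ _ := ()
  hId_hComp _ := HEq.rfl
  hComp_hId _ := HEq.rfl
  hComp_assoc _ _ _ := HEq.rfl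
  vId_vComp _ := HEq.rfl
  vComp_vId _ := HEq.rfl
  vComp_assoc _ _ _ := HEq.rfl
  hId_id _ := rfl
  hId_comp _ _ := rfl
  vId_comp _ _ := rfl
  interchange _ _ _ _ := rfl

/-- The double functor between grids induced by a pair of monotone maps. -/
def Grid.map {p q p' q' : ℕ} (θ : Fin (p + 1) →o Fin (p' + 1)) (η : Fin (q + 1) →o Fin (q' + 1)) :
    DoubleFunctor (Grid p q) (Grid p' q') where
  obj x := (θ x.1, η x.2)
  mapM f := ⟨θ.monotone f.down.1, congrArg η f.down.2⟩
  mapE g := ⟨congrArg θ g.down.1, η.monotone g.down.2⟩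
  mapSq _ := ()
  mapM_id _ := rfl
  mapM_comp _ _ := rfl
  mapE_id _ := rfl
  mapE_comp _ _ := rfl
  mapSq_hId _ := HEq.rfl
  mapSq_vId _ := HEq.rfl
  mapSq_hComp _ _ := HEq.rfl
  mapSq_vComp _ _ := HEq.rfl

/-! ### The S-construction -/

namespace GCGW

variable {C : DoubleCategory.{u}} (G : GCGW C)

/-- The condition on a staircase-shaped diagram to be an object of `S_n C`: the diagonal consists of
the initial object and all squares are distinguished. -/
def IsStaircase {n : ℕ} (F : DoubleFunctor (Stair n) C) : Prop :=
  (∀ i : Fin (n + 1), F.obj (Stair.mk i i le_rfl) = G.empty) ∧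
  ∀ {x y x' y' : (Stair n).Obj} {f : MHom x y} {g : EHom x x'} {g' : EHom y y'} {f' : MHom x' y'}
    (α : (Stair n).Sq f g g' f'), IsIso (G.k.map (F.mapSq α))

/-- `S_n C`, the full double subcategory of `C^{Stair n}` on the staircases. -/
def S (n : ℕ) : DoubleCategory.{u} := (functorDouble (Stair n) G).full G.IsStaircase

/-- The diagram underlying an object of `S_n C`. -/
def S.diagram {n : ℕ} (F : (G.S n).Obj) : DoubleFunctor (Stair n) C := F.1

/-- The m-natural transformation underlying an m-morphism of `S_n C`. -/
def S.mTrans {n : ℕ} {F F' : (G.S n).Obj} (μ : MHom F F') :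
    G.MTrans (S.diagram G F) (S.diagram G F') := μ

/-- The e-natural transformation underlying an e-morphism of `S_n C`. -/
def S.eTrans {n : ℕ} {F F' : (G.S n).Obj} (η : EHom F F') :
    G.ETrans (S.diagram G F) (S.diagram G F') := η

/-- The simplicial operators of `S_• C`: restriction along a monotone map, which sends the
staircase `F` to the staircase `(i, j) ↦ F_{θ i, θ j}`. -/
def S.res {m n : ℕ} (θ : Fin (m + 1) →o Fin (n + 1)) : DoubleFunctor (G.S n) (G.S m) where
  obj F := ⟨(Stair.map θ).comp F.1, fun i => F.2.1 (θ i), fun α => F.2.2 ((Stair.map θ).mapSq α)⟩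
  mapM μ := (⟨fun x => (S.mTrans G μ).app ((Stair.map θ).obj x),
    fun f => (S.mTrans G μ).good ((Stair.map θ).mapM f),
    fun g => (S.mTrans G μ).sq ((Stair.map θ).mapE g)⟩ : G.MTrans _ _)
  mapE η := (⟨fun x => (S.eTrans G η).app ((Stair.map θ).obj x),
    fun g => (S.eTrans G η).good ((Stair.map θ).mapE g),
    fun f => (S.eTrans G η).sq ((Stair.map θ).mapM f)⟩ : G.ETrans _ _)
  mapSq α := fun x => α ((Stair.map θ).obj x)
  mapM_id _ := rfl
  mapM_comp _ _ := rfl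
  mapE_id _ := rfl
  mapE_comp _ _ := rfl
  mapSq_hId _ := HEq.rfl
  mapSq_vId _ := HEq.rfl
  mapSq_hComp _ _ := HEq.rfl
  mapSq_vComp _ _ := HEq.rfl

/-- The cokernel of an invertible m-morphism is initial. -/
theorem isIso_to_cok {C : DoubleCategory.{u}} (G : GCGW C) {A B : C.Obj} (f : MHom A B)
    [IsIso f] : IsIso (G.emptyM.to (toM (G.cok f))) := by
  obtain ⟨α, h⟩ := G.dist_coker f
  have := G.k_equiv
  let a : SqArr.mk (G.emptyE.to (toE A)) ⟶ SqArr.mk (G.cokι f) := (⟨_, _, α⟩ : SqArr.Hom _ _)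
  have hl : IsIso (G.k.functor.map a).hom.left := h
  have hr : IsIso (G.k.functor.map a).hom.right := inferInstanceAs (IsIso f)
  have hi : IsIso (G.k.functor.map a).hom := Arrow.isIso_of_isIso_left_of_isIso_right _
  have hi' : IsIso (G.k.functor.map a) := by
    refine ⟨⟨inv (G.k.functor.map a).hom, G.good_m_of_isIso _ inferInstance⟩, ?_, ?_⟩
    · exact WideSubcategory.hom_ext _ (IsIso.hom_inv_id (G.k.functor.map a).hom)
    · exact WideSubcategory.hom_ext _ (IsIso.inv_hom_id (G.k.functor.map a).hom)
  have ha : IsIso a := isIso_of_reflects_iso a G.k.functor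
  exact ⟨(inv a).top, congrArg SqArr.Hom.top (IsIso.hom_inv_id a),
    congrArg SqArr.Hom.top (IsIso.inv_hom_id a)⟩

theorem isIso_to_cok_id {C : DoubleCategory.{u}} (G : GCGW C) (A : C.Obj) :
    IsIso (G.emptyM.to (toM (G.cok (𝟙 (toM A))))) := G.isIso_to_cok _

theorem isIso_to_ker_id {C : DoubleCategory.{u}} (G : GCGW C) (A : C.Obj) :
    IsIso (G.emptyM.to (toM (G.ker (𝟙 (toE A))))) := by
  have h : IsIso (G.emptyE.to (toE (G.ker (𝟙 (toE A))))) := G.transpose.isIso_to_cok_id A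
  let i := (G.shared.equiv _ _).symm (asIso (G.emptyE.to (toE (G.ker (𝟙 (toE A))))))
  rw [G.emptyM.hom_ext (G.emptyM.to _) i.hom]
  infer_instance

end GCGW

/-! ### K-theory -/

namespace ECGW

variable {C : DoubleCategory.{u}} (W : ECGW C)

/-- An m-morphism of `S_n C` is an m-equivalence when it is so pointwise (acyclic staircases and
cokernels are pointwise). -/
def SMEquiv {n : ℕ} {F F' : (W.S n).Obj} (μ : MHom F F') : Prop :=
  ∀ x, W.MEquiv ((GCGW.S.mTrans W.toGCGW μ).app x)

/-- e-equivalences of `S_n C`. -/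
def SEEquiv {n : ℕ} {F F' : (W.S n).Obj} (η : EHom F F') : Prop :=
  ∀ x, W.EEquiv ((GCGW.S.eTrans W.toGCGW η).app x)

/-- `(p, q)`-simplices of the double nerve of `wS_n C`: `p × q` matrices of composable squares of
`S_n C` all of whose m- and e-morphisms are weak equivalences. -/
def NerveW (n p q : ℕ) : Type u :=
  {H : DoubleFunctor (Grid p q) (W.S n) //
    (∀ {x y : (Grid p q).Obj} (f : MHom x y), W.SMEquiv (H.mapM f)) ∧
    (∀ {x y : (Grid p q).Obj} (g : EHom x y), W.SEEquiv (H.mapE g))}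

/-- The trisimplicial operators on the double nerves of `wS_• C`. -/
def NerveW.map {n p q n' p' q' : ℕ} (θ : Fin (n' + 1) →o Fin (n + 1))
    (η : Fin (p' + 1) →o Fin (p + 1)) (ζ : Fin (q' + 1) →o Fin (q + 1))
    (H : W.NerveW n p q) : W.NerveW n' p' q' :=
  ⟨((Grid.map η ζ).comp H.1).comp (GCGW.S.res W.toGCGW θ),
    fun f x => H.2.1 ((Grid.map η ζ).mapM f) ((Stair.map θ).obj x),
    fun g x => H.2.2 ((Grid.map η ζ).mapE g) ((Stair.map θ).obj x)⟩

/-- The diagonal simplicial set of the double nerves of `wS_• C`. -/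
def diagNerve : SSet.{u} where
  obj n := W.NerveW n.unop.len n.unop.len n.unop.len
  map θ := TypeCat.ofHom (NerveW.map W θ.unop.toOrderHom θ.unop.toOrderHom θ.unop.toOrderHom)
  map_id _ := rfl
  map_comp _ _ := rfl

end ECGW

/-! ### Points and paths in a geometric realization -/

/-- The characteristic map `Δⁿ ⟶ |X|` of an `n`-simplex of `X`. -/
noncomputable def realizeSimplex (X : SSet.{u}) {n : ℕ} (x : X.obj (op ⦋n⦌)) :
    C(stdSimplex ℝ (Fin (n + 1)), SSet.toTop.obj X) :=
  TopCat.toSSetObjEquiv _ (op ⦋n⦌) ((sSetTopAdj.unit.app X).app (op ⦋n⦌) x)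

theorem realizeSimplex_map (X : SSet.{u}) {m n : ℕ} (x : X.obj (op ⦋n⦌))
    (θ : ⦋m⦌ ⟶ ⦋n⦌) (p : stdSimplex ℝ (Fin (m + 1))) :
    realizeSimplex X (X.map θ.op x) p = realizeSimplex X x (stdSimplex.map θ p) := by
  have h := ConcreteCategory.congr_hom ((sSetTopAdj.unit.app X).naturality θ.op) x
  have h' := congrArg (fun t => TopCat.toSSetObjEquiv _ (op ⦋m⦌) t p) h
  exact h'

/-- The point of `|X|` given by a vertex of `X`. -/
noncomputable def realizeVertex (X : SSet.{u}) (x : X.obj (op ⦋0⦌)) : SSet.toTop.obj X :=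
  realizeSimplex X x (stdSimplex.vertex 0)

/-- The path in `|X|` given by an edge of `X`. -/
noncomputable def realizeEdge (X : SSet.{u}) (e : X.obj (op ⦋1⦌)) :
    Path (realizeVertex X (X.map (SimplexCategory.δ 1).op e))
      (realizeVertex X (X.map (SimplexCategory.δ 0).op e)) where
  toFun t := realizeSimplex X e (stdSimplexHomeomorphUnitInterval.symm t)
  continuous_toFun := (realizeSimplex X e).continuous.comp
    stdSimplexHomeomorphUnitInterval.symm.continuous
  source' := by
    rw [realizeVertex, realizeSimplex_map, stdSimplex.map_vertex]
    exact congrArg _ ((Homeomorph.symm_apply_eq _).2 stdSimplexHomeomorphUnitInterval_zero.symm)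
  target' := by
    rw [realizeVertex, realizeSimplex_map, stdSimplex.map_vertex]
    exact congrArg _ ((Homeomorph.symm_apply_eq _).2 stdSimplexHomeomorphUnitInterval_one.symm)

namespace GCGW

variable {C : DoubleCategory.{u}} (G : GCGW C)

theorem S_zero_subsingleton {C : DoubleCategory.{u}} (G : GCGW C) : Subsingleton (G.S 0).Obj := by
  constructor
  rintro ⟨F, hF, hF'⟩ ⟨F', hG, hG'⟩
  apply Subtype.ext
  have hx : ∀ x : (Stair 0).Obj, x = Stair.mk 0 0 le_rfl := fun x =>
    Subtype.ext (Prod.ext (Subsingleton.elim (α := Fin 1) _ _) (Subsingleton.elim (α := Fin 1) _ _))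
  have hm : ∀ (H : DoubleFunctor (Stair 0) C), H.obj = (fun _ => G.empty) →
      H = DoubleFunctor.const _ _ G.empty := by
    intro H h
    have hM : ∀ {x y : (Stair 0).Obj} (f : MHom x y), HEq (H.mapM f) (𝟙 (toM G.empty)) := by
      intro x y f
      obtain rfl := (hx x).trans (hx y).symm
      have : f = 𝟙 _ := rfl
      rw [this, H.mapM_id, h]
    have hE : ∀ {x y : (Stair 0).Obj} (f : EHom x y), HEq (H.mapE f) (𝟙 (toE G.empty)) := by
      intro x y f
      obtain rfl := (hx x).trans (hx y).symm
      have : f = 𝟙 _ := rfl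
      rw [this, H.mapE_id, h]
    cases H with
    | mk obj mapM mapE mapSq a b c d e f g i =>
      cases h
      have eM : @mapM = fun _ _ _ => 𝟙 _ := by
        funext x y f; exact eq_of_heq (hM f)
      have eE : @mapE = fun _ _ _ => 𝟙 _ := by
        funext x y f; exact eq_of_heq (hE f)
      cases eM
      cases eE
      have eS : @mapSq = fun _ _ _ _ _ _ _ _ _ => C.hId (𝟙 (toE G.empty)) := by
        funext x y x' y' f g g' f' α
        exact (G.sq_subsingleton _ _ _ _).elim _ _
      cases eS
      rfl
  have key : ∀ (H : DoubleFunctor (Stair 0) C),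
      (∀ i, H.obj (Stair.mk i i le_rfl) = G.empty) → H.obj = fun _ => G.empty := by
    intro H h
    funext x
    rw [hx x]
    exact h 0
  exact (hm F (key F hF)).trans (hm F' (key F' hG)).symm

/-- The object of `S_0 C`. -/
def stairZero : (G.S 0).Obj :=
  ⟨DoubleFunctor.const _ _ G.empty, fun _ => rfl, fun {x y x' y'} f g g' f' α => by
    have h : G.k.map (C.hId (𝟙 (toE G.empty))) = 𝟙 _ := G.k.map_hId _
    have : IsIso (G.k.map (C.hId (𝟙 (toE G.empty)))) := by rw [h]; infer_instance
    exact this⟩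

theorem distinguished_hId {C : DoubleCategory.{u}} (G : GCGW C) {A B : C.Obj} (g : EHom A B) :
    G.Distinguished (𝟙 (toM A)) g g (𝟙 (toM B)) :=
  ⟨C.hId g, by rw [G.k.map_hId]; infer_instance⟩

theorem distinguished_vId {C : DoubleCategory.{u}} (G : GCGW C) {A B : C.Obj} (f : MHom A B) :
    G.Distinguished f (𝟙 (toE A)) (𝟙 (toE B)) f := by
  obtain ⟨α, h⟩ := G.transpose.distinguished_hId (A := A) (B := B) f
  exact ⟨α, (G.dist_iff α).2 h⟩

/-- The objects of the staircase of length one on `A`: `A` at `(0,1)`, the initial object on the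
diagonal. -/
noncomputable def stairOneObj (A : C.Obj) (x : StairObj 1) : C.Obj :=
  open Classical in if x.1.1 < x.1.2 then A else G.empty

theorem stairOneObj_eq {C : DoubleCategory.{u}} (G : GCGW C) (A : C.Obj) {x y : StairObj 1}
    (hx : x.1.1 < x.1.2) (hy : y.1.1 < y.1.2) : G.stairOneObj A x = G.stairOneObj A y := by
  rw [stairOneObj, stairOneObj, if_pos hx, if_pos hy]

theorem stairOneObj_empty {C : DoubleCategory.{u}} (G : GCGW C) (A : C.Obj) {x : StairObj 1}
    (hx : ¬ x.1.1 < x.1.2) : G.stairOneObj A x = G.empty := by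
  rw [stairOneObj, if_neg hx]

/-- The m-morphisms `∅ ⟶ ∅`, `∅ ⟶ A`, `A ⟶ A` of the staircase of length one on `A`. -/
noncomputable def stairOneM (A : C.Obj) {x y : StairObj 1} (h : x.1.1 < x.1.2 → y.1.1 < y.1.2) :
    MHom (G.stairOneObj A x) (G.stairOneObj A y) :=
  open Classical in
  if hx : x.1.1 < x.1.2 then eqToHom (congrArg toM (G.stairOneObj_eq A hx (h hx)))
  else eqToHom (congrArg toM (G.stairOneObj_empty A hx)) ≫ G.emptyM.to _

/-- The e-morphisms `∅ ⟶ ∅`, `∅ ⟶ A`, `A ⟶ A` of the staircase of length one on `A`. -/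
noncomputable def stairOneE (A : C.Obj) {x y : StairObj 1} (h : x.1.1 < x.1.2 → y.1.1 < y.1.2) :
    EHom (G.stairOneObj A x) (G.stairOneObj A y) :=
  open Classical in
  if hx : x.1.1 < x.1.2 then eqToHom (congrArg toE (G.stairOneObj_eq A hx (h hx)))
  else eqToHom (congrArg toE (G.stairOneObj_empty A hx)) ≫ G.emptyE.to _

theorem stairOneM_ext {C : DoubleCategory.{u}} (G : GCGW C) (A : C.Obj) {x : StairObj 1}
    (hx : ¬ x.1.1 < x.1.2) {X : C.M} (f g : toM (G.stairOneObj A x) ⟶ X) : f = g := by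
  have e := congrArg toM (G.stairOneObj_empty A hx)
  rw [← cancel_epi (eqToHom e.symm)]
  exact G.emptyM.hom_ext _ _

theorem stairOneE_ext {C : DoubleCategory.{u}} (G : GCGW C) (A : C.Obj) {x : StairObj 1}
    (hx : ¬ x.1.1 < x.1.2) {X : C.E} (f g : toE (G.stairOneObj A x) ⟶ X) : f = g := by
  have e := congrArg toE (G.stairOneObj_empty A hx)
  rw [← cancel_epi (eqToHom e.symm)]
  exact G.emptyE.hom_ext _ _

theorem stairOneM_id {C : DoubleCategory.{u}} (G : GCGW C) (A : C.Obj) (x : StairObj 1)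
    (h : x.1.1 < x.1.2 → x.1.1 < x.1.2) : G.stairOneM A h = 𝟙 (toM (G.stairOneObj A x)) := by
  by_cases hx : x.1.1 < x.1.2
  · rw [stairOneM, dif_pos hx]; rfl
  · exact G.stairOneM_ext A hx _ _

theorem stairOneE_id {C : DoubleCategory.{u}} (G : GCGW C) (A : C.Obj) (x : StairObj 1)
    (h : x.1.1 < x.1.2 → x.1.1 < x.1.2) : G.stairOneE A h = 𝟙 (toE (G.stairOneObj A x)) := by
  by_cases hx : x.1.1 < x.1.2
  · rw [stairOneE, dif_pos hx]; rfl
  · exact G.stairOneE_ext A hx _ _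

theorem stairOneM_comp {C : DoubleCategory.{u}} (G : GCGW C) (A : C.Obj) {x y z : StairObj 1}
    (h : x.1.1 < x.1.2 → y.1.1 < y.1.2) (h' : y.1.1 < y.1.2 → z.1.1 < z.1.2) :
    G.stairOneM A (fun t => h' (h t)) = G.stairOneM A h ≫ G.stairOneM A h' := by
  by_cases hx : x.1.1 < x.1.2
  · rw [stairOneM, dif_pos hx, stairOneM, dif_pos hx, stairOneM, dif_pos (h hx), eqToHom_trans]
  · exact G.stairOneM_ext A hx _ _

theorem stairOneE_comp {C : DoubleCategory.{u}} (G : GCGW C) (A : C.Obj) {x y z : StairObj 1}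
    (h : x.1.1 < x.1.2 → y.1.1 < y.1.2) (h' : y.1.1 < y.1.2 → z.1.1 < z.1.2) :
    G.stairOneE A (fun t => h' (h t)) = G.stairOneE A h ≫ G.stairOneE A h' := by
  by_cases hx : x.1.1 < x.1.2
  · rw [stairOneE, dif_pos hx, stairOneE, dif_pos hx, stairOneE, dif_pos (h hx), eqToHom_trans]
  · exact G.stairOneE_ext A hx _ _

theorem stair_lt_of_m {n : ℕ} {x y : StairObj n} (f : MHom (C := Stair n) x y)
    (h : x.1.1 < x.1.2) : y.1.1 < y.1.2 := by
  have h₁ := f.down.1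
  have h₂ := f.down.2
  exact h₁ ▸ h.trans_le h₂

theorem stair_lt_of_e {n : ℕ} {x y : StairObj n} (g : EHom (C := Stair n) x y)
    (h : x.1.1 < x.1.2) : y.1.1 < y.1.2 := by
  have h₁ := g.down.1
  have h₂ := g.down.2
  exact h₂ ▸ h₁.trans_lt h

theorem stairOne_distinguished {C : DoubleCategory.{u}} (G : GCGW C) (A : C.Obj)
    {x y x' y' : StairObj 1} (f : MHom (C := Stair 1) x y) (g : EHom (C := Stair 1) x x')
    (g' : EHom (C := Stair 1) y y') (f' : MHom (C := Stair 1) x' y') :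
    G.Distinguished (G.stairOneM A (stair_lt_of_m f)) (G.stairOneE A (stair_lt_of_e g))
      (G.stairOneE A (stair_lt_of_e g')) (G.stairOneM A (stair_lt_of_m f')) := by
  have hf := f.down
  have hg := g.down
  have hg' := g'.down
  have hf' := f'.down
  have hx := x.2
  by_cases hj : x.1.2 = y.1.2
  · obtain rfl : x = y := Subtype.ext (Prod.ext hf.1 hj)
    obtain rfl : x' = y' := Subtype.ext (Prod.ext hf'.1 (by rw [← hg.2, hg'.2]))
    rw [stairOneM_id, stairOneM_id]
    exact G.distinguished_hId _
  · have hi : x.1.1 = x'.1.1 := by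
      have h₁ := x.1.2.2
      have h₂ := y.1.2.2
      rcases hf with ⟨_, h₃⟩
      rcases hg with ⟨h₄, _⟩
      have h₅ : x.1.2 < y.1.2 := lt_of_le_of_ne h₃ hj
      apply Fin.ext
      simp only [Fin.le_def, Fin.lt_def] at *
      omega
    obtain rfl : x = x' := Subtype.ext (Prod.ext hi hg.2)
    obtain rfl : y = y' := Subtype.ext (Prod.ext (by rw [← hf.1, hf'.1]) hg'.2)
    rw [stairOneE_id, stairOneE_id]
    exact G.distinguished_vId _

/-- The object of `S_1 C` given by an object `A` of `C`. -/
noncomputable def stairOne (A : C.Obj) : (G.S 1).Obj :=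
  ⟨{  obj := G.stairOneObj A
      mapM := fun f => G.stairOneM A (stair_lt_of_m f)
      mapE := fun g => G.stairOneE A (stair_lt_of_e g)
      mapSq := fun {_ _ _ _ f g g' f'} _ => (G.stairOne_distinguished A f g g' f').choose
      mapM_id := fun x => G.stairOneM_id A x _
      mapM_comp := fun f f' => G.stairOneM_comp A (stair_lt_of_m f) (stair_lt_of_m f')
      mapE_id := fun x => G.stairOneE_id A x _
      mapE_comp := fun g g' => G.stairOneE_comp A (stair_lt_of_e g) (stair_lt_of_e g')
      mapSq_hId := fun {x y} g => by
        have h : ∀ {f : MHom (G.stairOneObj A x) (G.stairOneObj A x)}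
            {f' : MHom (G.stairOneObj A y) (G.stairOneObj A y)}
            (_ : f = 𝟙 _) (_ : f' = 𝟙 _) {e : EHom (G.stairOneObj A x) (G.stairOneObj A y)}
            (α : C.Sq f e e f'), HEq α (C.hId e) := by
          intro f f' h₁ h₂ e α
          cases h₁; cases h₂
          exact heq_of_eq ((G.sq_subsingleton _ _ _ _).elim _ _)
        exact h (G.stairOneM_id A x _) (G.stairOneM_id A y _) _
      mapSq_vId := fun {x y} g => by
        have h : ∀ {f : EHom (G.stairOneObj A x) (G.stairOneObj A x)}
            {f' : EHom (G.stairOneObj A y) (G.stairOneObj A y)}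
            (_ : f = 𝟙 _) (_ : f' = 𝟙 _) {e : MHom (G.stairOneObj A x) (G.stairOneObj A y)}
            (α : C.Sq e f f' e), HEq α (C.vId e) := by
          intro f f' h₁ h₂ e α
          cases h₁; cases h₂
          exact heq_of_eq ((G.sq_subsingleton _ _ _ _).elim _ _)
        exact h (G.stairOneE_id A x _) (G.stairOneE_id A y _) _
      mapSq_hComp := fun {A₁ A₂ A₃ B₁ B₂ B₃ f₁ f₂ g₁ g₂ g₃ f₁' f₂'} α β => by
        have h : ∀ {f f₀ : MHom (G.stairOneObj A A₁) (G.stairOneObj A A₃)}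
            {f' f₀' : MHom (G.stairOneObj A B₁) (G.stairOneObj A B₃)}
            (_ : f = f₀) (_ : f' = f₀') {e : EHom (G.stairOneObj A A₁) (G.stairOneObj A B₁)}
            {e' : EHom (G.stairOneObj A A₃) (G.stairOneObj A B₃)}
            (α : C.Sq f e e' f') (β : C.Sq f₀ e e' f₀'), HEq α β := by
          intro f f₀ f' f₀' h₁ h₂ e e' α β
          cases h₁; cases h₂
          exact heq_of_eq ((G.sq_subsingleton _ _ _ _).elim _ _)
        exact h (G.stairOneM_comp A (stair_lt_of_m f₁) (stair_lt_of_m f₂))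
          (G.stairOneM_comp A (stair_lt_of_m f₁') (stair_lt_of_m f₂')) _ _
      mapSq_vComp := fun {A₁ A₂ A₃ B₁ B₂ B₃ g₁ g₂ f₁ f₂ f₃ g₁' g₂'} α β => by
        have h : ∀ {f f₀ : EHom (G.stairOneObj A A₁) (G.stairOneObj A A₃)}
            {f' f₀' : EHom (G.stairOneObj A B₁) (G.stairOneObj A B₃)}
            (_ : f = f₀) (_ : f' = f₀') {e : MHom (G.stairOneObj A A₁) (G.stairOneObj A B₁)}
            {e' : MHom (G.stairOneObj A A₃) (G.stairOneObj A B₃)}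
            (α : C.Sq e f f' e') (β : C.Sq e f₀ f₀' e'), HEq α β := by
          intro f f₀ f' f₀' h₁ h₂ e e' α β
          cases h₁; cases h₂
          exact heq_of_eq ((G.sq_subsingleton _ _ _ _).elim _ _)
        exact h (G.stairOneE_comp A (stair_lt_of_e g₁) (stair_lt_of_e g₂))
          (G.stairOneE_comp A (stair_lt_of_e g₁') (stair_lt_of_e g₂')) _ _ },
    fun _ => G.stairOneObj_empty A (lt_irrefl _),
    fun {_ _ _ _ f g g' f'} _ => (G.stairOne_distinguished A f g g' f').choose_spec⟩

theorem stairOne_obj {C : DoubleCategory.{u}} (G : GCGW C) (A : C.Obj) :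
    (S.diagram G (G.stairOne A)).obj (Stair.mk 0 1 (Fin.zero_le _)) = A := by
    change G.stairOneObj A ⟨((0 : Fin 2), (1 : Fin 2)), Fin.zero_le _⟩ = A
    rw [stairOneObj]
    exact if_pos (show (0 : Fin 2) < 1 from Fin.zero_lt_one)

end GCGW

namespace ECGW

variable {C : DoubleCategory.{u}} (W : ECGW C)

theorem mEquiv_id {C : DoubleCategory.{u}} (W : ECGW C) (A : C.Obj) : W.MEquiv (𝟙 (toM A)) := by
  have := W.isIso_to_cok_id A
  exact W.acyclic_of_isInitial _ ⟨W.emptyM.ofIso (asIso (W.emptyM.to _))⟩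

theorem eEquiv_id {C : DoubleCategory.{u}} (W : ECGW C) (A : C.Obj) : W.EEquiv (𝟙 (toE A)) := by
  have := W.isIso_to_ker_id A
  exact W.acyclic_of_isInitial _ ⟨W.emptyM.ofIso (asIso (W.emptyM.to _))⟩

/-- An object of `S_n C`, as a vertex of the double nerve of `wS_n C`, seen as a totally degenerate
`(p, q)`-simplex. -/
def constNerve {n : ℕ} (F : (W.S n).Obj) (p q : ℕ) : W.NerveW n p q :=
  ⟨DoubleFunctor.const _ _ F, fun _ _ => W.mEquiv_id _, fun _ _ => W.eEquiv_id _⟩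

/-- The vertex of the diagonal simplicial set given by the object of `S_0 C` (its only vertex). -/
def vertex : W.diagNerve.obj (op ⦋0⦌) := W.constNerve W.stairZero 0 0

/-- The edge of the diagonal simplicial set given by an object of `S_1 C`. -/
def edge (F : (W.S 1).Obj) : W.diagNerve.obj (op ⦋1⦌) := W.constNerve F 1 1

theorem map_edge {C : DoubleCategory.{u}} (W : ECGW C) (F : (W.S 1).Obj) (θ : ⦋0⦌ ⟶ ⦋1⦌) :
    W.diagNerve.map θ.op (W.edge F) = W.vertex := by
  have h := W.S_zero_subsingleton
  have e : W.diagNerve.map θ.op (W.edge F) =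
      W.constNerve ((GCGW.S.res W.toGCGW θ.toOrderHom).obj F) 0 0 := rfl
  rw [e, Subsingleton.elim ((GCGW.S.res W.toGCGW θ.toOrderHom).obj F) W.stairZero]
  rfl

/-- The space `|wS_• C|`. -/
noncomputable def space : TopCat.{u} := SSet.toTop.obj W.diagNerve

/-- The base point of `|wS_• C|`. -/
noncomputable def basePoint : W.space := realizeVertex W.diagNerve W.vertex

/-- `K_0(C, W) = π_0 Ω|wS_• C| = π_1 |wS_• C|`. -/
abbrev K₀ : Type u := FundamentalGroup W.space W.basePoint

/-- The loop in `|wS_• C|` traced out by an object of `S_1 C`. -/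
noncomputable def loop (F : (W.S 1).Obj) : Path W.basePoint W.basePoint :=
  (realizeEdge W.diagNerve (W.edge F)).cast
    (congrArg (realizeVertex W.diagNerve) (W.map_edge F _).symm)
    (congrArg (realizeVertex W.diagNerve) (W.map_edge F _).symm)

/-- The class in `K_0(C, W)` of an object `A` of `C`: the homotopy class of the loop of the
corresponding object of `S_1 C`. -/
noncomputable def loopClass (A : C.Obj) : W.K₀ :=
  FundamentalGroup.fromPath (Path.Homotopic.Quotient.mk (W.loop (W.stairOne A)))

/-! ### The presentation -/

/-- The relations `[∅] = 0`, `[A] + [D] = [B] + [Q]` for each distinguished square with corners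
`A`, `B`, `Q`, `D`, and `[A] = [B]` for each m- or e-equivalence `A ⟶ B`. -/
def relations : Set (FreeAbelianGroup C.Obj) :=
  {FreeAbelianGroup.of W.empty} ∪
  {r | ∃ (A B Q D : C.Obj) (f : MHom A B) (g : EHom A Q) (g' : EHom B D) (f' : MHom Q D),
    W.Distinguished f g g' f' ∧
    r = (FreeAbelianGroup.of A + FreeAbelianGroup.of D) -
      (FreeAbelianGroup.of B + FreeAbelianGroup.of Q)} ∪
  {r | ∃ (A B : C.Obj) (f : MHom A B), W.MEquiv f ∧
    r = FreeAbelianGroup.of A - FreeAbelianGroup.of B} ∪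
  {r | ∃ (A B : C.Obj) (g : EHom A B), W.EEquiv g ∧
    r = FreeAbelianGroup.of A - FreeAbelianGroup.of B}

/-- The free abelian group on the objects of `C` modulo these relations. -/
abbrev Presented : Type u := FreeAbelianGroup C.Obj ⧸ AddSubgroup.closure W.relations

/-- The class `[A]` of an object in the presented group. -/
def cls (A : C.Obj) : W.Presented := QuotientAddGroup.mk (FreeAbelianGroup.of A)

end ECGW

/-! The diagonal simplicial set has a single vertex, because `S_0` is trivial, so the fundamental
group of its realization is generated by the edges (`mem_of_edgeClass_mem`). An edge is a square of
weak equivalences between objects of `S_1`, and such objects are just the objects of the double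
category (`eq_stairOne`). The staircase direction and the nerve directions can be degenerated
independently; the resulting 2-simplices show that an edge has the class of the constant edge on its
first, and also on its last, corner (`nerveClass_eq_first`, `nerveClass_eq_last`). Hence the loop
classes of objects generate K₀.

The relations hold for the following reasons. A kernel-cokernel pair A → B ← Q is an object of
`S_2`, and its triangle says [B] = [Q][A] (`loopClass_of_kerCok`). If A is acyclic, the map ∅ → A is
a weak equivalence of staircases, so A has trivial class; cokernels and kernels then show that weak
equivalences identify classes. The ⋆-pushout of two objects over ∅ decomposes in two orders, so
classes commute (`loopClass_comm`). The vertical sides of a distinguished square have isomorphic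
kernels, which gives the remaining relation. This defines a surjection φ from the presented group P
to K₀.

Injectivity of φ needs a homomorphism back. To a simplex with first-corner staircase F one attaches
the function i ↦ [F_{0,i}] with values in P; additivity in F says that a simplicial operator changes
this function only by a translation. Barycentric coordinates turn it into a step function [0,1) → P,
so the realization maps to the quotient of a metric space of functions by the translations of P. The
quotient map is a covering, and its monodromy is the required homomorphism, taking the loop of A to
[A] (`exists_hom_of_cocycle`, `exists_K₀Hom`).

The topological input to generation is that every path in a realization is homotopic to a
concatenation of paths in simplices (`simplicialPath`). A path lies in a finite skeleton by
compactness, and its pieces either stay in one open top cell or can be pushed off the barycenters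
into a lower skeleton. This rests on the unique representation of a point by an interior point of a
nondegenerate simplex (`exists_normalForm`). -/

/-! ### Maps out of a geometric realization -/

section Realization

variable {X : SSet.{u}}

/-- A family of maps from the simplices of `X` to a space `Y`, compatible with the simplicial
operators. -/
structure RealizationCocone (X : SSet.{u}) (Y : Type u) [TopologicalSpace Y] where
  app {n : ℕ} (x : X.obj (op ⦋n⦌)) : C(stdSimplex ℝ (Fin (n + 1)), Y)
  comp {m n : ℕ} (x : X.obj (op ⦋n⦌)) (θ : ⦋m⦌ ⟶ ⦋n⦌) (p : stdSimplex ℝ (Fin (m + 1))) :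
    app (X.map θ.op x) p = app x (stdSimplex.map θ p)

variable {Y : Type u} [TopologicalSpace Y]

/-- The morphism to the singular simplicial set corresponding to a cocone. -/
noncomputable def RealizationCocone.toSing (c : RealizationCocone X Y) :
    X ⟶ TopCat.toSSet.obj (TopCat.of Y) where
  app n := TypeCat.ofHom fun x => (TopCat.toSSetObjEquiv (TopCat.of Y) n).symm
    (c.app (n := n.unop.len) x)
  naturality n m θ := by
    ext x
    apply (TopCat.toSSetObjEquiv (TopCat.of Y) m).injective
    ext p
    exact (c.comp (n := n.unop.len) (m := m.unop.len) x θ.unop p)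

/-- The map out of the realization glued from a cocone. -/
noncomputable def RealizationCocone.desc (c : RealizationCocone X Y) :
    C(SSet.toTop.obj X, Y) :=
  ((sSetTopAdj.homEquiv X (TopCat.of Y)).symm c.toSing).hom

theorem toSSetObjEquiv_homEquiv_app {Z : TopCat.{u}} (f : SSet.toTop.obj X ⟶ Z) {n : ℕ}
    (x : X.obj (op ⦋n⦌)) (p : stdSimplex ℝ (Fin (n + 1))) :
    TopCat.toSSetObjEquiv Z (op ⦋n⦌) ((sSetTopAdj.homEquiv X Z f).app (op ⦋n⦌) x) p =
      f (realizeSimplex X x p) := by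
  rw [Adjunction.homEquiv_unit]
  rfl

theorem RealizationCocone.desc_realizeSimplex (c : RealizationCocone X Y) {n : ℕ}
    (x : X.obj (op ⦋n⦌)) (p : stdSimplex ℝ (Fin (n + 1))) :
    c.desc (realizeSimplex X x p) = c.app x p := by
  have h := toSSetObjEquiv_homEquiv_app
    ((sSetTopAdj.homEquiv X (TopCat.of Y)).symm c.toSing) x p
  rw [Equiv.apply_symm_apply] at h
  exact h.symm

theorem realization_hom_ext {f g : C(SSet.toTop.obj X, Y)}
    (h : ∀ {n : ℕ} (x : X.obj (op ⦋n⦌)) (p : stdSimplex ℝ (Fin (n + 1))),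
      f (realizeSimplex X x p) = g (realizeSimplex X x p)) : f = g := by
  have : TopCat.ofHom f = TopCat.ofHom g := by
    apply (sSetTopAdj.homEquiv X (TopCat.of Y)).injective
    ext n x
    apply (TopCat.toSSetObjEquiv (TopCat.of Y) n).injective
    ext p
    induction n using Opposite.rec with | _ n
    induction n using SimplexCategory.rec with | _ n
    exact (toSSetObjEquiv_homEquiv_app _ _ _).trans
      ((h x p).trans (toSSetObjEquiv_homEquiv_app _ _ _).symm)
  exact congrArg TopCat.Hom.hom this

/-- A compatible family of functions on the simplices is induced by a function on the
realization. -/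
theorem exists_realization_function {S : Type u}
    (c : ∀ {n : ℕ}, X.obj (op ⦋n⦌) → stdSimplex ℝ (Fin (n + 1)) → S)
    (hc : ∀ {m n : ℕ} (x : X.obj (op ⦋n⦌)) (θ : ⦋m⦌ ⟶ ⦋n⦌) (p : stdSimplex ℝ (Fin (m + 1))),
      c (X.map θ.op x) p = c x (stdSimplex.map θ p)) :
    ∃ f : SSet.toTop.obj X → S, ∀ {n : ℕ} (x : X.obj (op ⦋n⦌)) (p : stdSimplex ℝ (Fin (n + 1))),
      f (realizeSimplex X x p) = c x p := by
  -- The indiscrete topology makes every function continuous, so the gluing principle applies to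
  -- bare functions.
  let _ : TopologicalSpace S := ⊤
  let d : RealizationCocone X S :=
    { app := fun x => ⟨c x, continuous_top⟩
      comp := fun x θ p => hc x θ p }
  exact ⟨d.desc, fun x p => d.desc_realizeSimplex x p⟩

/-- The characteristic function of the union of the simplices and the constant function `True` agree
on every simplex, hence everywhere. -/
theorem exists_realizeSimplex (z : SSet.toTop.obj X) :
    ∃ (n : ℕ) (x : X.obj (op ⦋n⦌)) (p : stdSimplex ℝ (Fin (n + 1))), realizeSimplex X x p = z := by
  let _ : TopologicalSpace (ULift.{u} Prop) := ⊤
  let f : C(SSet.toTop.obj X, ULift.{u} Prop) := ⟨fun z => ⟨∃ (n : ℕ) (x : X.obj (op ⦋n⦌))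
    (p : stdSimplex ℝ (Fin (n + 1))), realizeSimplex X x p = z⟩, continuous_top⟩
  let g : C(SSet.toTop.obj X, ULift.{u} Prop) := ⟨fun _ => ⟨True⟩, continuous_top⟩
  have h : f = g := realization_hom_ext fun {n} x p =>
    congrArg ULift.up (eq_true ⟨n, x, p, rfl⟩)
  exact of_eq_true (congrArg ULift.down (DFunLike.congr_fun h z))

/-- Open sets correspond to continuous maps to the Sierpiński space `Prop`, and such a map can be
glued from its restrictions to the simplices. -/
theorem isOpen_realization_iff {U : Set (SSet.toTop.obj X)} :
    IsOpen U ↔ ∀ (n : ℕ) (x : X.obj (op ⦋n⦌)), IsOpen (realizeSimplex X x ⁻¹' U) := by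
  refine ⟨fun h n x => h.preimage (realizeSimplex X x).continuous, fun h => ?_⟩
  let c : RealizationCocone X (ULift.{u} Prop) :=
    { app := fun {n} x => ⟨fun p => ⟨realizeSimplex X x p ∈ U⟩,
        continuous_uliftUp.comp (continuous_Prop.2 (h n x))⟩
      comp := fun x θ p => congrArg ULift.up (by rw [realizeSimplex_map]) }
  have hU : U = {z | (c.desc z).down} := by
    ext z
    obtain ⟨n, x, p, rfl⟩ := exists_realizeSimplex z
    exact (iff_of_eq (congrArg ULift.down (c.desc_realizeSimplex x p))).symm
  rw [hU]
  exact continuous_Prop.1 (continuous_uliftDown.comp c.desc.continuous)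

theorem isClosed_realization_iff {U : Set (SSet.toTop.obj X)} :
    IsClosed U ↔ ∀ (n : ℕ) (x : X.obj (op ⦋n⦌)), IsClosed (realizeSimplex X x ⁻¹' U) := by
  simp only [← isOpen_compl_iff, isOpen_realization_iff, Set.preimage_compl]

end Realization

/-! ### Normal forms of points of a geometric realization -/

section SimplexMaps

theorem stdSimplex.map_apply_sum {m n : ℕ} (f : Fin m → Fin n) (p : stdSimplex ℝ (Fin m))
    (j : Fin n) : stdSimplex.map f p j = ∑ i with f i = j, p i := by
  rw [stdSimplex.map_coe, FunOnFinite.linearMap_apply_apply]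

theorem stdSimplex.map_simplexComp {k m n : ℕ} (θ : ⦋k⦌ ⟶ ⦋m⦌) (η : ⦋m⦌ ⟶ ⦋n⦌)
    (p : stdSimplex ℝ (Fin (k + 1))) :
    stdSimplex.map (θ ≫ η) p = stdSimplex.map η (stdSimplex.map θ p) := by
  rw [stdSimplex.map_comp_apply]
  rfl

theorem stdSimplex.map_apply_of_injective {m n : ℕ} {f : Fin m → Fin n} (hf : Function.Injective f)
    (p : stdSimplex ℝ (Fin m)) (i : Fin m) : stdSimplex.map f p (f i) = p i := by
  rw [stdSimplex.map_apply_sum, Finset.sum_eq_single i]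
  · intro j hj hji
    exact absurd (hf (Finset.mem_filter.1 hj).2) hji
  · intro h
    simp at h

/-- All barycentric coordinates are positive. -/
def IsInteriorPoint {n : ℕ} (p : stdSimplex ℝ (Fin n)) : Prop := ∀ i, 0 < p i

theorem stdSimplex.map_pos_iff {m n : ℕ} (f : Fin m → Fin n) {p : stdSimplex ℝ (Fin m)}
    (hp : IsInteriorPoint p) (j : Fin n) : 0 < stdSimplex.map f p j ↔ j ∈ Set.range f := by
  rw [stdSimplex.map_apply_sum]
  constructor
  · intro h
    by_contra hj
    rw [Finset.sum_eq_zero] at h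
    · exact lt_irrefl _ h
    · intro i hi
      exact absurd ⟨i, (Finset.mem_filter.1 hi).2⟩ hj
  · rintro ⟨i, rfl⟩
    exact Finset.sum_pos (fun i _ => hp i) ⟨i, by simp⟩

theorem IsInteriorPoint.map {m n : ℕ} {f : Fin m → Fin n} (hf : Function.Surjective f)
    {p : stdSimplex ℝ (Fin m)} (hp : IsInteriorPoint p) : IsInteriorPoint (stdSimplex.map f p) :=
  fun j => (stdSimplex.map_pos_iff f hp j).2 (hf j)

theorem simplex_exists_epi_mono {m n : ℕ} (θ : ⦋m⦌ ⟶ ⦋n⦌) :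
    ∃ (k : ℕ) (e : ⦋m⦌ ⟶ ⦋k⦌) (i : ⦋k⦌ ⟶ ⦋n⦌), Epi e ∧ Mono i ∧ e ≫ i = θ := by
  have h : ∀ (I : SimplexCategory) (e : ⦋m⦌ ⟶ I) (i : I ⟶ ⦋n⦌), Epi e → Mono i → e ≫ i = θ →
      ∃ (k : ℕ) (e : ⦋m⦌ ⟶ ⦋k⦌) (i : ⦋k⦌ ⟶ ⦋n⦌), Epi e ∧ Mono i ∧ e ≫ i = θ := by
    intro I
    induction I using SimplexCategory.rec with | _ k
    exact fun e i he hi h => ⟨k, e, i, he, hi, h⟩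
  exact h _ (factorThruImage θ) (image.ι θ) inferInstance inferInstance (image.fac θ)

/-- Every point of a simplex is an interior point of a face. -/
theorem exists_face_interior {n : ℕ} (p : stdSimplex ℝ (Fin (n + 1))) :
    ∃ (k : ℕ) (ι : ⦋k⦌ ⟶ ⦋n⦌) (r : stdSimplex ℝ (Fin (k + 1))), Mono ι ∧ IsInteriorPoint r ∧
      stdSimplex.map ι r = p := by
  classical
  let s : Finset (Fin (n + 1)) := Finset.univ.filter fun i => 0 < p i
  have hs : s.Nonempty := by
    by_contra h
    rw [Finset.not_nonempty_iff_eq_empty] at h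
    have h1 := stdSimplex.sum_eq_one p
    rw [Finset.sum_eq_zero] at h1
    · exact zero_ne_one h1
    · intro i _
      have : i ∉ s := by rw [h]; simp
      have : ¬ 0 < p i := fun hi => this (by simp [s, hi])
      exact le_antisymm (not_lt.1 this) (stdSimplex.zero_le p i)
  obtain ⟨k, hk⟩ : ∃ k, s.card = k + 1 := ⟨s.card - 1, (Nat.succ_pred hs.card_pos.ne').symm⟩
  let e := s.orderEmbOfFin hk
  let ι : ⦋k⦌ ⟶ ⦋n⦌ := SimplexCategory.mkHom e.toOrderHom
  have hinj : Function.Injective ι := e.injective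
  have hmem : ∀ i, e i ∈ s := fun i => s.orderEmbOfFin_mem hk i
  have hrange : ∀ j, 0 < p j → j ∈ Set.range e := by
    intro j hj
    rw [s.range_orderEmbOfFin hk]
    simp [s, hj]
  have hsum : ∑ i, p (e i) = 1 := by
    rw [← stdSimplex.sum_eq_one p]
    refine Finset.sum_of_injOn e e.injective.injOn (by simp) ?_ (fun _ _ => rfl)
    intro j _ hj
    by_contra h
    exact hj (by simpa using hrange j (lt_of_le_of_ne (stdSimplex.zero_le p j) (Ne.symm h)))
  let r : stdSimplex ℝ (Fin (k + 1)) := ⟨fun i => p (e i), fun i => stdSimplex.zero_le p _, hsum⟩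
  have hr : ∀ i, r i = p (e i) := fun _ => rfl
  refine ⟨k, ι, r, SimplexCategory.mono_iff_injective.2 hinj, fun i => ?_, ?_⟩
  · have := hmem i
    rw [hr]
    simpa [s] using this
  · ext j
    by_cases hj : 0 < p j
    · obtain ⟨i, rfl⟩ := hrange j hj
      exact stdSimplex.map_apply_of_injective hinj r i
    · have h0 : p j = 0 := le_antisymm (not_lt.1 hj) (stdSimplex.zero_le p j)
      rw [h0, stdSimplex.map_apply_sum, Finset.sum_eq_zero]
      intro i hi
      have h1 : e i = j := (Finset.mem_filter.1 hi).2
      rw [hr, h1, h0]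

/-- A face is determined by its set of vertices, which here is the set of positive coordinates of
the common image point. -/
theorem face_interior_unique {n k k' : ℕ} (ι : ⦋k⦌ ⟶ ⦋n⦌) (ι' : ⦋k'⦌ ⟶ ⦋n⦌) [Mono ι] [Mono ι']
    {r : stdSimplex ℝ (Fin (k + 1))} {r' : stdSimplex ℝ (Fin (k' + 1))} (hr : IsInteriorPoint r)
    (hr' : IsInteriorPoint r') (h : stdSimplex.map ι r = stdSimplex.map ι' r') :
    ∃ e : k' = k, (e ▸ ι' : ⦋k⦌ ⟶ ⦋n⦌) = ι ∧ (e ▸ r' : stdSimplex ℝ (Fin (k + 1))) = r := by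
  have hi : Function.Injective ι := SimplexCategory.mono_iff_injective.1 ‹Mono ι›
  have hi' : Function.Injective ι' := SimplexCategory.mono_iff_injective.1 ‹Mono ι'›
  have hrange : Set.range ι = Set.range ι' := by
    ext j
    rw [← stdSimplex.map_pos_iff _ hr, ← stdSimplex.map_pos_iff _ hr', h]
  have hk : k' = k := by
    have h1 := Set.card_range_of_injective hi
    have h2 := Set.card_range_of_injective hi'
    rw [Fintype.card_congr (Equiv.setCongr hrange)] at h1
    rw [h1] at h2
    simpa using h2.symm
  subst hk
  refine ⟨rfl, ?_, ?_⟩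
  · have h3 : (ι' : Fin (k' + 1) → Fin (n + 1)) = ι :=
      (StrictMono.range_inj (ι'.toOrderHom.monotone.strictMono_of_injective hi')
        (ι.toOrderHom.monotone.strictMono_of_injective hi)).1 hrange.symm
    ext i : 3
    exact congrFun h3 i
  · have h3 : (ι' : Fin (k' + 1) → Fin (n + 1)) = ι :=
      (StrictMono.range_inj (ι'.toOrderHom.monotone.strictMono_of_injective hi')
        (ι.toOrderHom.monotone.strictMono_of_injective hi)).1 hrange.symm
    ext i
    change r' i = r i
    have h4 := stdSimplex.map_apply_of_injective hi r i
    have h5 := stdSimplex.map_apply_of_injective hi' r' i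
    rw [← h, h3] at h5
    exact h5.symm.trans h4

end SimplexMaps

section NormalForm

variable {X : SSet.{u}}

/-- The point `p` of the simplex `x` reduces to the interior point `q` of the nondegenerate
simplex `y`. -/
def ReducesTo {n : ℕ} (x : X.obj (op ⦋n⦌)) (p : stdSimplex ℝ (Fin (n + 1))) {m : ℕ}
    (y : X.obj (op ⦋m⦌)) (q : stdSimplex ℝ (Fin (m + 1))) : Prop :=
  y ∈ X.nonDegenerate m ∧ ∃ (k : ℕ) (ι : ⦋k⦌ ⟶ ⦋n⦌) (η : ⦋k⦌ ⟶ ⦋m⦌)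
    (r : stdSimplex ℝ (Fin (k + 1))), Mono ι ∧ Epi η ∧ IsInteriorPoint r ∧ stdSimplex.map ι r = p ∧
      stdSimplex.map η r = q ∧ X.map ι.op x = X.map η.op y

theorem ReducesTo.realize_eq {n : ℕ} {x : X.obj (op ⦋n⦌)} {p : stdSimplex ℝ (Fin (n + 1))} {m : ℕ}
    {y : X.obj (op ⦋m⦌)} {q : stdSimplex ℝ (Fin (m + 1))} (h : ReducesTo x p y q) :
    realizeSimplex X x p = realizeSimplex X y q := by
  obtain ⟨_, k, ι, η, r, _, _, _, rfl, rfl, h⟩ := h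
  rw [← realizeSimplex_map, h, realizeSimplex_map]

theorem exists_reducesTo {n : ℕ} (x : X.obj (op ⦋n⦌)) (p : stdSimplex ℝ (Fin (n + 1))) :
    ∃ (m : ℕ) (y : X.obj (op ⦋m⦌)) (q : stdSimplex ℝ (Fin (m + 1))), m ≤ n ∧ ReducesTo x p y q := by
  obtain ⟨k, ι, r, hι, hr, rfl⟩ := exists_face_interior p
  obtain ⟨m, η, hη, y, hy⟩ := X.exists_nonDegenerate (X.map ι.op x)
  exact ⟨m, y, stdSimplex.map η r,
    (SimplexCategory.len_le_of_epi η).trans (SimplexCategory.len_le_of_mono ι),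
    y.2, k, ι, η, r, hι, hη, hr, rfl, rfl, hy⟩

/-- The face having `p` in its interior is unique, and by the Eilenberg–Zilber lemma its restriction
of `x` is a degeneracy of a unique nondegenerate simplex in a unique way. -/
theorem ReducesTo.unique {n : ℕ} {x : X.obj (op ⦋n⦌)} {p : stdSimplex ℝ (Fin (n + 1))} {m m' : ℕ}
    {y : X.obj (op ⦋m⦌)} {q : stdSimplex ℝ (Fin (m + 1))} {y' : X.obj (op ⦋m'⦌)}
    {q' : stdSimplex ℝ (Fin (m' + 1))} (h : ReducesTo x p y q) (h' : ReducesTo x p y' q') :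
    (⟨m, y, q⟩ : Σ m : ℕ, X.obj (op ⦋m⦌) × stdSimplex ℝ (Fin (m + 1))) = ⟨m', y', q'⟩ := by
  obtain ⟨hy, k, ι, η, r, _, _, hr, h1, rfl, h2⟩ := h
  obtain ⟨hy', k', ι', η', r', _, _, hr', h1', rfl, h2'⟩ := h'
  obtain ⟨rfl, h3, h4⟩ := face_interior_unique ι ι' hr hr' (h1.trans h1'.symm)
  dsimp only at h3 h4
  subst h3 h4
  obtain rfl := X.unique_nonDegenerate_dim _ η ⟨y, hy⟩ h2 η' ⟨y', hy'⟩ h2'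
  obtain rfl : y = y' :=
    congrArg Subtype.val (X.unique_nonDegenerate_simplex _ η ⟨y, hy⟩ h2 η' ⟨y', hy'⟩ h2')
  obtain rfl := X.unique_nonDegenerate_map _ η ⟨y, hy⟩ h2 η' ⟨y, hy'⟩ h2'
  rfl

/-- Factor `ι ≫ θ` as an epimorphism `e` followed by a face `i`. Reducing the face of `x` along `i`
and precomposing with `e` gives a second degenerate presentation of the simplex reduced in the
hypothesis, so Eilenberg–Zilber uniqueness identifies the two reductions. -/
theorem ReducesTo.of_map {m n : ℕ} {x : X.obj (op ⦋n⦌)} {θ : ⦋m⦌ ⟶ ⦋n⦌}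
    {p : stdSimplex ℝ (Fin (m + 1))} {l : ℕ} {y : X.obj (op ⦋l⦌)} {q : stdSimplex ℝ (Fin (l + 1))}
    (h : ReducesTo (X.map θ.op x) p y q) : ReducesTo x (stdSimplex.map θ p) y q := by
  obtain ⟨hy, k, ι, η, r, _, _, hr, rfl, rfl, h⟩ := h
  obtain ⟨j, e, i, _, _, hei⟩ := simplex_exists_epi_mono (ι ≫ θ)
  obtain ⟨l', η', _, y', hy'⟩ := X.exists_nonDegenerate (X.map i.op x)
  have h2 : X.map (e ≫ η').op (y' : X.obj (op ⦋l'⦌)) = X.map η.op y := by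
    rw [← h, op_comp, Functor.map_comp, comp_apply, ← hy', ← comp_apply, ← Functor.map_comp,
      ← op_comp, hei, op_comp, Functor.map_comp, comp_apply]
  obtain rfl := X.unique_nonDegenerate_dim _ η ⟨y, hy⟩ h2 (e ≫ η') y' rfl
  obtain rfl := X.unique_nonDegenerate_simplex _ η ⟨y, hy⟩ h2 (e ≫ η') y' rfl
  obtain rfl := X.unique_nonDegenerate_map _ η ⟨y, hy⟩ h2 (e ≫ η') ⟨y, hy⟩ rfl
  refine ⟨hy, j, i, η', stdSimplex.map e r, ‹_›, ‹_›,
    hr.map (SimplexCategory.epi_iff_surjective.1 inferInstance), ?_, ?_, hy'⟩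
  · rw [← stdSimplex.map_simplexComp, ← stdSimplex.map_simplexComp, hei]
  · rw [stdSimplex.map_simplexComp]

/-- A chosen reduction is compatible with the simplicial operators by `ReducesTo.of_map` and
`ReducesTo.unique`, hence descends to the realization. -/
theorem exists_normalForm (X : SSet.{u}) :
    ∃ f : SSet.toTop.obj X → Σ m : ℕ, X.obj (op ⦋m⦌) × stdSimplex ℝ (Fin (m + 1)),
      ∀ {n : ℕ} (x : X.obj (op ⦋n⦌)) (p : stdSimplex ℝ (Fin (n + 1))),
        ReducesTo x p (f (realizeSimplex X x p)).2.1 (f (realizeSimplex X x p)).2.2 := by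
  choose m y q _ h using fun (n : ℕ) (x : X.obj (op ⦋n⦌)) (p : stdSimplex ℝ (Fin (n + 1))) =>
    exists_reducesTo x p
  obtain ⟨f, hf⟩ := exists_realization_function (X := X)
    (S := ULift.{u} (Σ m : ℕ, X.obj (op ⦋m⦌) × stdSimplex ℝ (Fin (m + 1))))
    (fun {n} x p => ⟨m n x p, y n x p, q n x p⟩) (fun {k n} x θ p =>
      congrArg ULift.up ((h k (X.map θ.op x) p).of_map.unique (h n x (stdSimplex.map θ p))))
  refine ⟨fun z => (f z).down, fun {n} x p => ?_⟩
  -- Stating the goal as a predicate of the whole dependent triple lets `rw` replace all its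
  -- components at once.
  let Q : (Σ m : ℕ, X.obj (op ⦋m⦌) × stdSimplex ℝ (Fin (m + 1))) → Prop :=
    fun w => ReducesTo x p w.2.1 w.2.2
  suffices hQ : Q (f (realizeSimplex X x p)).down from hQ
  rw [hf]
  exact h n x p

/-- The unique nondegenerate simplex and interior point of it representing a point of `|X|`. -/
noncomputable def normalForm (z : SSet.toTop.obj X) :
    Σ m : ℕ, X.obj (op ⦋m⦌) × stdSimplex ℝ (Fin (m + 1)) := (exists_normalForm X).choose z

theorem reducesTo_normalForm {n : ℕ} (x : X.obj (op ⦋n⦌)) (p : stdSimplex ℝ (Fin (n + 1))) :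
    ReducesTo x p (normalForm (realizeSimplex X x p)).2.1
      (normalForm (realizeSimplex X x p)).2.2 :=
  (exists_normalForm X).choose_spec x p

theorem ReducesTo.normalForm_eq {n : ℕ} {x : X.obj (op ⦋n⦌)} {p : stdSimplex ℝ (Fin (n + 1))}
    {m : ℕ} {y : X.obj (op ⦋m⦌)} {q : stdSimplex ℝ (Fin (m + 1))} (h : ReducesTo x p y q) :
    normalForm (realizeSimplex X x p) = ⟨m, y, q⟩ :=
  (reducesTo_normalForm x p).unique h

theorem realizeSimplex_normalForm (z : SSet.toTop.obj X) :
    realizeSimplex X (normalForm z).2.1 (normalForm z).2.2 = z := by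
  obtain ⟨n, x, p, rfl⟩ := exists_realizeSimplex z
  exact (reducesTo_normalForm x p).realize_eq.symm

theorem normalForm_dim_le {n : ℕ} (x : X.obj (op ⦋n⦌)) (p : stdSimplex ℝ (Fin (n + 1))) :
    (normalForm (realizeSimplex X x p)).1 ≤ n := by
  obtain ⟨m, y, q, hm, h⟩ := exists_reducesTo x p
  rw [h.normalForm_eq]
  exact hm

theorem normalForm_interior {n : ℕ} {x : X.obj (op ⦋n⦌)} (hx : x ∈ X.nonDegenerate n)
    {p : stdSimplex ℝ (Fin (n + 1))} (hp : IsInteriorPoint p) :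
    normalForm (realizeSimplex X x p) = ⟨n, x, p⟩ :=
  ReducesTo.normalForm_eq ⟨hx, n, 𝟙 _, 𝟙 _, p, inferInstance, inferInstance, hp,
    stdSimplex.map_id_apply p, stdSimplex.map_id_apply p, rfl⟩

/-- A point of top-dimensional normal form in an `n`-simplex is an interior point of a
nondegenerate simplex. -/
theorem normalForm_of_dim_eq {n : ℕ} {x : X.obj (op ⦋n⦌)} {p : stdSimplex ℝ (Fin (n + 1))}
    (h : (normalForm (realizeSimplex X x p)).1 = n) :
    x ∈ X.nonDegenerate n ∧ IsInteriorPoint p := by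
  obtain ⟨m, y, q, hm, h'⟩ := exists_reducesTo x p
  rw [h'.normalForm_eq] at h
  dsimp only at h
  subst h
  obtain ⟨hy, k, ι, η, r, _, _, hr, rfl, rfl, h⟩ := h'
  have h1 := SimplexCategory.len_le_of_epi η
  have h2 := SimplexCategory.len_le_of_mono ι
  obtain rfl : k = m := le_antisymm h2 h1
  obtain rfl := SimplexCategory.eq_id_of_mono ι
  obtain rfl := SimplexCategory.eq_id_of_epi η
  have h3 : x = y := by simpa using h
  subst h3
  exact ⟨hy, hr.map (fun i => ⟨i, rfl⟩)⟩

end NormalForm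

/-! ### The skeletal filtration of a geometric realization -/

section Skeleta

variable {X : SSet.{u}}

/-- Every point of a simplex is interior to a face, and every face degenerates from a nondegenerate
simplex. The preimage of `A` in a simplex is therefore a finite union of compact sets, namely images
under face maps of preimages of the sets `B`. -/
theorem realization_isClosed_of_nonDegenerate {A : Set (SSet.toTop.obj X)}
    (h : ∀ (m : ℕ), ∀ y ∈ X.nonDegenerate m, ∃ B : Set (stdSimplex ℝ (Fin (m + 1))), IsClosed B ∧
      (∀ q ∈ B, realizeSimplex X y q ∈ A) ∧
      ∀ q, IsInteriorPoint q → realizeSimplex X y q ∈ A → q ∈ B) : IsClosed A := by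
  rw [isClosed_realization_iff]
  intro n x
  have key : ∀ i : (Σ k : Fin (n + 1), (⦋(k : ℕ)⦌ ⟶ ⦋n⦌)),
      ∃ C : Set (stdSimplex ℝ (Fin (n + 1))), IsClosed C ∧ C ⊆ realizeSimplex X x ⁻¹' A ∧
        (Mono i.2 → ∀ r, IsInteriorPoint r → realizeSimplex X x (stdSimplex.map i.2 r) ∈ A →
          stdSimplex.map i.2 r ∈ C) := by
    rintro ⟨k, ι⟩
    obtain ⟨m, η, hη, y, hy⟩ := X.exists_nonDegenerate (X.map ι.op x)
    obtain ⟨B, hB, hB1, hB2⟩ := h m y y.2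
    have hιη : ∀ r, realizeSimplex X x (stdSimplex.map ι r) =
        realizeSimplex X y (stdSimplex.map η r) := by
      intro r
      rw [← realizeSimplex_map, hy, realizeSimplex_map]
    refine ⟨stdSimplex.map ι '' (stdSimplex.map η ⁻¹' B), ?_, ?_, ?_⟩
    · exact ((hB.preimage (stdSimplex.continuous_map _)).isCompact.image
        (stdSimplex.continuous_map _)).isClosed
    · rintro _ ⟨r, hr, rfl⟩
      change realizeSimplex X x _ ∈ A
      rw [hιη]
      exact hB1 _ hr
    · intro _ r hr hrA
      refine ⟨r, ?_, rfl⟩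
      rw [hιη] at hrA
      exact hB2 _ (hr.map (SimplexCategory.epi_iff_surjective.1 hη)) hrA
  choose C hC hC1 hC2 using key
  have hU : realizeSimplex X x ⁻¹' A = ⋃ i, C i := by
    apply subset_antisymm
    · intro p hp
      obtain ⟨k, ι, r, hι, hr, rfl⟩ := exists_face_interior p
      have hk : k < n + 1 := Nat.lt_succ_of_le (SimplexCategory.len_le_of_mono ι)
      exact Set.mem_iUnion.2 ⟨⟨⟨k, hk⟩, ι⟩, hC2 ⟨⟨k, hk⟩, ι⟩ hι r hr hp⟩
    · exact Set.iUnion_subset hC1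
  rw [hU]
  exact isClosed_iUnion_of_finite hC

/-- The points of `|X|` lying on a simplex of dimension less than `m`. -/
def realizationSkeleton (X : SSet.{u}) (m : ℕ) : Set (SSet.toTop.obj X) :=
  {z | (normalForm z).1 < m}

/-- The open cell of a nondegenerate simplex embeds by uniqueness of normal forms, so it contains
only finitely many points of `A`. -/
theorem realization_isClosed_of_finite {A : Set (SSet.toTop.obj X)}
    (hA : ∀ m, (A ∩ realizationSkeleton X m).Finite) : IsClosed A := by
  refine realization_isClosed_of_nonDegenerate fun m y hy =>
    ⟨{q | IsInteriorPoint q ∧ realizeSimplex X y q ∈ A}, Set.Finite.isClosed ?_, fun q hq => hq.2,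
      fun q h1 h2 => ⟨h1, h2⟩⟩
  refine Set.Finite.of_finite_image ((hA (m + 1)).subset ?_) (f := realizeSimplex X y) ?_
  · rintro _ ⟨q, hq, rfl⟩
    exact ⟨hq.2, Nat.lt_succ_of_le (normalForm_dim_le y q)⟩
  · intro q hq q' hq' h
    have h1 := normalForm_interior hy hq.1
    have h2 := normalForm_interior hy hq'.1
    rw [h, h2] at h1
    simpa using h1.symm

/-- Otherwise there are parameters `t m` whose images have dimension at least `m`. Every tail of
this sequence of images is closed, since it meets each skeleton in finitely many points. The
complements of the preimages of the tails form an increasing open cover of `K`, no member of which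
is all of `K`. -/
theorem exists_realizationSkeleton_of_compact {K : Type*} [TopologicalSpace K] [CompactSpace K]
    (f : C(K, SSet.toTop.obj X)) : ∃ m, ∀ t, f t ∈ realizationSkeleton X m := by
  by_contra! h
  choose t ht using h
  have ht' : ∀ m, m ≤ (normalForm (f (t m))).1 := fun m => not_lt.1 (ht m)
  let U : ℕ → Set K := fun m => (f ⁻¹' ((fun j => f (t j)) '' Set.Ici m))ᶜ
  have hclosed : ∀ m, IsClosed ((fun j => f (t j)) '' Set.Ici m) := by
    intro m
    refine realization_isClosed_of_finite fun k => ?_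
    refine ((Set.finite_Iio k).image (fun j => f (t j))).subset ?_
    rintro _ ⟨⟨j, _, rfl⟩, hj⟩
    exact ⟨j, (ht' j).trans_lt hj, rfl⟩
  have hU : ∀ m, IsOpen (U m) := fun m => ((hclosed m).preimage f.continuous).isOpen_compl
  have hcover : Set.univ ⊆ ⋃ m, U m := by
    intro s _
    refine Set.mem_iUnion.2 ⟨(normalForm (f s)).1 + 1, ?_⟩
    rintro ⟨j, hj, hjs⟩
    have h1 := ht' j
    dsimp only at hjs
    rw [hjs] at h1
    exact absurd (h1.trans_lt (Nat.lt_succ_self _)) (not_lt.2 hj)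
  have hmono : Monotone U := fun m m' hm => Set.compl_subset_compl.2
    (Set.preimage_mono (Set.image_mono (Set.Ici_subset_Ici.2 hm)))
  obtain ⟨m, hm⟩ := isCompact_univ.elim_directed_cover U hU hcover hmono.directed_le
  exact hm (Set.mem_univ (t m)) ⟨m, Set.mem_Ici.2 le_rfl, rfl⟩

theorem mem_realizationSkeleton {m n : ℕ} (y : X.obj (op ⦋m⦌)) (h : m < n)
    (q : stdSimplex ℝ (Fin (m + 1))) : realizeSimplex X y q ∈ realizationSkeleton X n :=
  (normalForm_dim_le y q).trans_lt h

theorem continuous_realizationSkeleton_iff {n : ℕ} {Y : Type*} [TopologicalSpace Y]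
    {f : realizationSkeleton X n → Y} : Continuous f ↔
      ∀ (m : ℕ) (hm : m < n), ∀ y ∈ X.nonDegenerate m,
        Continuous fun q => f ⟨realizeSimplex X y q, mem_realizationSkeleton y hm q⟩ := by
  refine ⟨fun h m hm y _ => h.comp ((realizeSimplex X y).continuous.subtype_mk _), fun h => ?_⟩
  rw [continuous_iff_isClosed]
  intro C hC
  have hA : IsClosed (Subtype.val '' (f ⁻¹' C)) := by
    refine realization_isClosed_of_nonDegenerate fun m y hy => ?_
    by_cases hm : m < n
    · refine ⟨_, hC.preimage (h m hm y hy), fun q hq => ⟨_, hq, rfl⟩, ?_⟩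
      rintro q - ⟨z, hz, hzq⟩
      obtain rfl : z = ⟨realizeSimplex X y q, mem_realizationSkeleton y hm q⟩ := Subtype.ext hzq
      exact hz
    -- An interior point of a nondegenerate simplex of dimension at least `n` lies outside the
    -- skeleton, so there is nothing to test.
    · refine ⟨∅, isClosed_empty, by simp, ?_⟩
      rintro q hq ⟨z, hz, hzq⟩
      have h1 := z.2
      rw [hzq, realizationSkeleton, Set.mem_ofPred_eq, normalForm_interior hy hq] at h1
      exact absurd h1 hm
  rw [show f ⁻¹' C = Subtype.val ⁻¹' (Subtype.val '' (f ⁻¹' C)) by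
    rw [Set.preimage_image_eq _ Subtype.val_injective]]
  exact hA.preimage continuous_subtype_val

/-- Extend maps on the open `n`-cells by a map on the lower skeleton. -/
noncomputable def cellGlue {Y : Type*} (n : ℕ)
    (g : X.obj (op ⦋n⦌) → stdSimplex ℝ (Fin (n + 1)) → Y) (g₀ : SSet.toTop.obj X → Y)
    (z : SSet.toTop.obj X) : Y :=
  open Classical in
  if h : ∃ w : X.obj (op ⦋n⦌) × stdSimplex ℝ (Fin (n + 1)), normalForm z = ⟨n, w⟩ then
    g h.choose.1 h.choose.2 else g₀ z

theorem cellGlue_cell {Y : Type*} {n : ℕ}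
    {g : X.obj (op ⦋n⦌) → stdSimplex ℝ (Fin (n + 1)) → Y} {g₀ : SSet.toTop.obj X → Y}
    {z : SSet.toTop.obj X} {y : X.obj (op ⦋n⦌)} {q : stdSimplex ℝ (Fin (n + 1))}
    (h : normalForm z = ⟨n, y, q⟩) : cellGlue n g g₀ z = g y q := by
  have hw : ∃ w : X.obj (op ⦋n⦌) × stdSimplex ℝ (Fin (n + 1)), normalForm z = ⟨n, w⟩ := ⟨_, h⟩
  have h1 := h.symm.trans hw.choose_spec
  have h2 : (y, q) = hw.choose := eq_of_heq (Sigma.mk.inj h1).2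
  rw [cellGlue, dif_pos hw, ← h2]

theorem cellGlue_of_dim_ne {Y : Type*} {n : ℕ}
    {g : X.obj (op ⦋n⦌) → stdSimplex ℝ (Fin (n + 1)) → Y} {g₀ : SSet.toTop.obj X → Y}
    {z : SSet.toTop.obj X} (h : (normalForm z).1 ≠ n) : cellGlue n g g₀ z = g₀ z := by
  rw [cellGlue, dif_neg]
  rintro ⟨w, hw⟩
  exact h (by rw [hw])

theorem cellGlue_realizeSimplex {Y : Type*} {n : ℕ}
    {g : X.obj (op ⦋n⦌) → stdSimplex ℝ (Fin (n + 1)) → Y} {g₀ : SSet.toTop.obj X → Y}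
    (hg : ∀ y q, ¬ IsInteriorPoint q → g y q = g₀ (realizeSimplex X y q))
    {y : X.obj (op ⦋n⦌)} (hy : y ∈ X.nonDegenerate n) (q : stdSimplex ℝ (Fin (n + 1))) :
    cellGlue n g g₀ (realizeSimplex X y q) = g y q := by
  by_cases hq : IsInteriorPoint q
  · exact cellGlue_cell (normalForm_interior hy hq)
  · rw [cellGlue_of_dim_ne fun h => hq (normalForm_of_dim_eq h).2, hg y q hq]

theorem continuous_cellGlue {Y : Type*} [TopologicalSpace Y] {n : ℕ}
    {g : X.obj (op ⦋n⦌) → stdSimplex ℝ (Fin (n + 1)) → Y} {g₀ : SSet.toTop.obj X → Y}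
    (hg : ∀ y q, ¬ IsInteriorPoint q → g y q = g₀ (realizeSimplex X y q))
    (hgc : ∀ y, Continuous (g y)) (hg₀ : Continuous g₀) :
    Continuous fun z : realizationSkeleton X (n + 1) => cellGlue n g g₀ z := by
  refine continuous_realizationSkeleton_iff.2 fun m hm y hy => ?_
  rcases (Nat.lt_succ_iff.1 hm).lt_or_eq with h | rfl
  · refine (hg₀.comp (realizeSimplex X y).continuous).congr fun q => ?_
    exact (cellGlue_of_dim_ne ((normalForm_dim_le y q).trans_lt h).ne).symm
  · exact (hgc y).congr fun q => (cellGlue_realizeSimplex hg hy q).symm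

theorem exists_cell {n : ℕ} {z : SSet.toTop.obj X} (h : (normalForm z).1 = n) :
    ∃ (y : X.obj (op ⦋n⦌)) (q : stdSimplex ℝ (Fin (n + 1))), normalForm z = ⟨n, y, q⟩ ∧
      y ∈ X.nonDegenerate n ∧ IsInteriorPoint q ∧ realizeSimplex X y q = z := by
  have h1 := realizeSimplex_normalForm z
  generalize hw : normalForm z = w at h h1
  obtain ⟨m, y, q⟩ := w
  dsimp only at h
  subst h
  have h2 : (normalForm (realizeSimplex X y q)).1 = m := by rw [h1, hw]
  exact ⟨y, q, rfl, (normalForm_of_dim_eq h2).1, (normalForm_of_dim_eq h2).2, h1⟩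

end Skeleta

/-! ### Pushing a simplex away from its barycenter -/

section Push

variable {n : ℕ}

/-- The smallest barycentric coordinate, normalized to be `1` at the barycenter. -/
noncomputable def depth (q : stdSimplex ℝ (Fin (n + 1))) : ℝ :=
  (n + 1) * Finset.univ.inf' Finset.univ_nonempty fun i => q i

theorem continuous_stdSimplex_coord (i : Fin (n + 1)) :
    Continuous fun q : stdSimplex ℝ (Fin (n + 1)) => q i :=
  (continuous_apply i).comp continuous_subtype_val

theorem continuous_depth : Continuous (depth (n := n)) :=
  continuous_const.mul (Continuous.finset_inf'_apply _ fun i _ => continuous_stdSimplex_coord i)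

theorem depth_le_coord (q : stdSimplex ℝ (Fin (n + 1))) (i : Fin (n + 1)) :
    depth q ≤ (n + 1) * q i :=
  mul_le_mul_of_nonneg_left (Finset.inf'_le _ (Finset.mem_univ i)) (by positivity)

theorem exists_depth_eq (q : stdSimplex ℝ (Fin (n + 1))) : ∃ i, depth q = (n + 1) * q i := by
  obtain ⟨i, _, hi⟩ := Finset.exists_mem_eq_inf' (Finset.univ_nonempty (α := Fin (n + 1)))
    fun i => q i
  exact ⟨i, by rw [depth, hi]⟩

theorem depth_nonneg (q : stdSimplex ℝ (Fin (n + 1))) : 0 ≤ depth q := by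
  obtain ⟨i, hi⟩ := exists_depth_eq q
  rw [hi]
  have := stdSimplex.zero_le q i
  positivity

theorem depth_pos {q : stdSimplex ℝ (Fin (n + 1))} (hq : IsInteriorPoint q) : 0 < depth q := by
  obtain ⟨i, hi⟩ := exists_depth_eq q
  rw [hi]
  have := hq i
  positivity

theorem depth_eq_zero {q : stdSimplex ℝ (Fin (n + 1))} (hq : ¬ IsInteriorPoint q) :
    depth q = 0 := by
  simp only [IsInteriorPoint, not_forall, not_lt] at hq
  obtain ⟨i, hi⟩ := hq
  have h1 := depth_le_coord q i
  have h2 : q i = 0 := le_antisymm hi (stdSimplex.zero_le q i)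
  rw [h2, mul_zero] at h1
  exact le_antisymm h1 (depth_nonneg q)

/-- The dilation factor at time `u`. -/
noncomputable def pushFactor (q : stdSimplex ℝ (Fin (n + 1))) (u : unitInterval) : ℝ :=
  1 + u * ((max (1 / 2) (1 - depth q))⁻¹ - 1)

/-- Dilation by a factor `c` about the barycenter turns the depth `d` into `1 - c * (1 - d)`, so
this is exactly the condition for remaining in the simplex. The truncation at `1 / 2` in the factor
avoids dividing by zero at the barycenter, where the depth is `1`. -/
theorem pushFactor_mul_le (q : stdSimplex ℝ (Fin (n + 1))) (u : unitInterval) :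
    pushFactor q u * (1 - depth q) ≤ 1 := by
  have h0 := depth_nonneg q
  have hu := u.2.1
  have hu' := u.2.2
  have hm : 0 < max (1 / 2) (1 - depth q) := lt_max_of_lt_left (by norm_num)
  have hc : (max (1 / 2) (1 - depth q))⁻¹ * (1 - depth q) ≤ 1 := by
    rw [inv_mul_le_iff₀ hm, mul_one]
    exact le_max_right _ _
  have : pushFactor q u * (1 - depth q) = (1 - (u : ℝ)) * (1 - depth q) +
      u * ((max (1 / 2) (1 - depth q))⁻¹ * (1 - depth q)) := by
    rw [pushFactor]; ring
  rw [this]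
  nlinarith

theorem pushFactor_nonneg (q : stdSimplex ℝ (Fin (n + 1))) (u : unitInterval) :
    0 ≤ pushFactor q u := by
  have hu := u.2.1
  have hu' := u.2.2
  have hm : 0 < max (1 / 2) (1 - depth q) := lt_max_of_lt_left (by norm_num)
  have : pushFactor q u = (1 - (u : ℝ)) + u * (max (1 / 2) (1 - depth q))⁻¹ := by
    rw [pushFactor]; ring
  rw [this]
  have := inv_pos.2 hm
  nlinarith

/-- The dilation of a simplex away from its barycenter. -/
noncomputable def push (q : stdSimplex ℝ (Fin (n + 1))) (u : unitInterval) :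
    stdSimplex ℝ (Fin (n + 1)) :=
  ⟨fun i => (n + 1 : ℝ)⁻¹ + pushFactor q u * (q i - (n + 1 : ℝ)⁻¹), by
    have hn : (0 : ℝ) < n + 1 := by positivity
    refine ⟨fun i => ?_, ?_⟩
    · have h1 := depth_le_coord q i
      have h2 := pushFactor_mul_le q u
      have h3 := mul_le_mul_of_nonneg_left h1 (pushFactor_nonneg q u)
      have h4 : (n + 1 : ℝ)⁻¹ + pushFactor q u * (q i - (n + 1 : ℝ)⁻¹) =
          (n + 1 : ℝ)⁻¹ * (1 + (pushFactor q u * ((n + 1) * q i) - pushFactor q u)) := by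
        field_simp
      change 0 ≤ (n + 1 : ℝ)⁻¹ + pushFactor q u * (q i - (n + 1 : ℝ)⁻¹)
      rw [h4]
      refine mul_nonneg (by positivity) ?_
      linarith
    · have h1 : ∑ i, q i = 1 := stdSimplex.sum_eq_one q
      rw [Finset.sum_add_distrib, ← Finset.mul_sum, Finset.sum_sub_distrib, h1]
      simp only [Finset.sum_const, Finset.card_univ, Fintype.card_fin, nsmul_eq_mul]
      push_cast
      field_simp
      ring⟩

theorem push_apply (q : stdSimplex ℝ (Fin (n + 1))) (u : unitInterval) (i : Fin (n + 1)) :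
    push q u i = (n + 1 : ℝ)⁻¹ + pushFactor q u * (q i - (n + 1 : ℝ)⁻¹) := rfl

theorem continuous_push :
    Continuous fun w : stdSimplex ℝ (Fin (n + 1)) × unitInterval => push w.1 w.2 := by
  refine Continuous.subtype_mk (continuous_pi fun i => ?_) _
  have h1 : Continuous fun w : stdSimplex ℝ (Fin (n + 1)) × unitInterval => depth w.1 :=
    continuous_depth.comp continuous_fst
  have h2 : Continuous fun w : stdSimplex ℝ (Fin (n + 1)) × unitInterval =>
      (max (1 / 2) (1 - depth w.1))⁻¹ := by
    refine Continuous.inv₀ (by fun_prop) fun w => ?_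
    exact (lt_max_of_lt_left (by norm_num)).ne'
  have h3 : Continuous fun w : stdSimplex ℝ (Fin (n + 1)) × unitInterval => w.1 i :=
    (continuous_stdSimplex_coord i).comp continuous_fst
  simp only [pushFactor]
  fun_prop

theorem push_zero (q : stdSimplex ℝ (Fin (n + 1))) : push q 0 = q := by
  ext i
  rw [push_apply, pushFactor]
  simp

theorem push_of_not_interior {q : stdSimplex ℝ (Fin (n + 1))} (hq : ¬ IsInteriorPoint q)
    (u : unitInterval) : push q u = q := by
  ext i
  rw [push_apply, pushFactor, depth_eq_zero hq]
  norm_num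

/-- Below depth `1 / 2` the truncation is inactive: the final factor is the inverse of `1 - depth
q`, which makes the smallest coordinate vanish. -/
theorem push_one_not_interior {q : stdSimplex ℝ (Fin (n + 1))} (hq : depth q < 1 / 2) :
    ¬ IsInteriorPoint (push q 1) := by
  intro h
  obtain ⟨i, hi⟩ := exists_depth_eq q
  have h1 := h i
  have hn : (0 : ℝ) < n + 1 := by positivity
  have hm : max (1 / 2) (1 - depth q) = 1 - depth q := max_eq_right (by linarith)
  have h2 : q i = (n + 1 : ℝ)⁻¹ * depth q := by rw [hi]; field_simp
  have h3 : (1 - depth q) ≠ 0 := by linarith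
  rw [push_apply, pushFactor, hm, h2] at h1
  have h4 : (n + 1 : ℝ)⁻¹ + (1 + ((1 : unitInterval) : ℝ) * ((1 - depth q)⁻¹ - 1)) *
      ((n + 1 : ℝ)⁻¹ * depth q - (n + 1 : ℝ)⁻¹) = 0 := by
    rw [Set.Icc.coe_one]
    field_simp
    ring
  rw [h4] at h1
  exact lt_irrefl _ h1

end Push

/-! ### Paths in a geometric realization are homotopic to simplicial paths -/

theorem stdSimplex_contractible (n : ℕ) : ContractibleSpace (stdSimplex ℝ (Fin (n + 1))) :=
  (convex_stdSimplex ℝ (Fin (n + 1))).contractibleSpace ⟨_, (Classical.arbitrary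
    (stdSimplex ℝ (Fin (n + 1)))).2⟩

instance (n : ℕ) : SimplyConnectedSpace (stdSimplex ℝ (Fin (n + 1))) :=
  have := stdSimplex_contractible n
  inferInstance

instance : SimplyConnectedSpace (unitInterval × unitInterval) :=
  have : ContractibleSpace unitInterval := (convex_Icc (0 : ℝ) 1).contractibleSpace ⟨0, by simp⟩
  inferInstance

/-- The two ways around the boundary are homotopic in the square itself, which is simply connected;
`H` transports the homotopy. -/
theorem Path.homotopic_of_square {Z : Type*} [TopologicalSpace Z] (H : C(unitInterval × unitInterval, Z))
    {x y x' y' : Z} (b : Path x y) (l : Path x x') (r : Path y y') (t : Path x' y')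
    (hb : ∀ s, b s = H (s, 0)) (hl : ∀ s, l s = H (0, s)) (hr : ∀ s, r s = H (1, s))
    (ht : ∀ s, t s = H (s, 1)) : b.Homotopic (l.trans (t.trans r.symm)) := by
  obtain rfl : H (0, 0) = x := by rw [← hb 0, b.source]
  obtain rfl : H (1, 0) = y := by rw [← hb 1, b.target]
  obtain rfl : H (0, 1) = x' := by rw [← hl 1, l.target]
  obtain rfl : H (1, 1) = y' := by rw [← hr 1, r.target]
  let b₀ : Path ((0, 0) : unitInterval × unitInterval) (1, 0) := ⟨⟨fun s => (s, 0), by fun_prop⟩, rfl, rfl⟩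
  let l₀ : Path ((0, 0) : unitInterval × unitInterval) (0, 1) := ⟨⟨fun s => (0, s), by fun_prop⟩, rfl, rfl⟩
  let r₀ : Path ((1, 0) : unitInterval × unitInterval) (1, 1) := ⟨⟨fun s => (1, s), by fun_prop⟩, rfl, rfl⟩
  let t₀ : Path ((0, 1) : unitInterval × unitInterval) (1, 1) := ⟨⟨fun s => (s, 1), by fun_prop⟩, rfl, rfl⟩
  have h : b₀.Homotopic (l₀.trans (t₀.trans r₀.symm)) := SimplyConnectedSpace.paths_homotopic _ _
  have hb' : b₀.map H.continuous = b := by ext s; exact (hb s).symm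
  have hl' : l₀.map H.continuous = l := by ext s; exact (hl s).symm
  have hr' : r₀.map H.continuous = r := by ext s; exact (hr s).symm
  have ht' : t₀.map H.continuous = t := by ext s; exact (ht s).symm
  have h1 := h.map H
  rwa [Path.map_trans, Path.map_trans, ← Path.map_symm, hb', hl', hr', ht'] at h1

section SimplicialPath

variable {X : SSet.{u}}

/-- A class of paths which contains the paths in simplices and is closed under concatenation and
homotopy. -/
structure IsSimplicialClass (X : SSet.{u})
    (R : ∀ x y : SSet.toTop.obj X, Path x y → Prop) : Prop where
  simplex {n : ℕ} (σ : X.obj (op ⦋n⦌)) (δ : C(unitInterval, stdSimplex ℝ (Fin (n + 1))))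
    {x y : SSet.toTop.obj X} (γ : Path x y) (h : ∀ t, γ t = realizeSimplex X σ (δ t)) : R x y γ
  trans {x y z : SSet.toTop.obj X} {γ : Path x y} {γ' : Path y z} (h : R x y γ)
    (h' : R y z γ') : R x z (γ.trans γ')
  homotopic {x y : SSet.toTop.obj X} {γ γ' : Path x y} (h : R x y γ) (h' : γ.Homotopic γ') :
    R x y γ'

/-- Paths which are homotopic to a concatenation of paths each of which lies in a simplex. -/
def SimplicialPath (X : SSet.{u}) {x y : SSet.toTop.obj X} (γ : Path x y) : Prop :=
  ∀ R, IsSimplicialClass X R → R x y γ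

theorem SimplicialPath.simplex {n : ℕ} (σ : X.obj (op ⦋n⦌))
    (δ : C(unitInterval, stdSimplex ℝ (Fin (n + 1)))) {x y : SSet.toTop.obj X} (γ : Path x y)
    (h : ∀ t, γ t = realizeSimplex X σ (δ t)) : SimplicialPath X γ :=
  fun _ hR => hR.simplex σ δ γ h

theorem SimplicialPath.trans {x y z : SSet.toTop.obj X} {γ : Path x y} {γ' : Path y z}
    (h : SimplicialPath X γ) (h' : SimplicialPath X γ') : SimplicialPath X (γ.trans γ') :=
  fun R hR => hR.trans (h R hR) (h' R hR)

theorem SimplicialPath.homotopic {x y : SSet.toTop.obj X} {γ γ' : Path x y}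
    (h : SimplicialPath X γ) (h' : γ.Homotopic γ') : SimplicialPath X γ' :=
  fun R hR => hR.homotopic (h R hR) h'

theorem SimplicialPath.symm {x y : SSet.toTop.obj X} {γ : Path x y} (h : SimplicialPath X γ) :
    SimplicialPath X γ.symm := by
  -- `SimplicialPath` is the smallest simplicial class, so instantiating its quantified class is an
  -- induction principle.
  refine h (fun x y γ => SimplicialPath X γ.symm) ⟨fun σ δ x y γ h => ?_, fun ih ih' => ?_,
    fun ih h' => ?_⟩
  · exact .simplex σ (δ.comp ⟨unitInterval.symm, unitInterval.continuous_symm⟩) _ fun t => h _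
  · rw [Path.trans_symm]
    exact .trans ih' ih
  · exact .homotopic ih h'.symm₂

theorem SimplicialPath.refl (x : SSet.toTop.obj X) : SimplicialPath X (Path.refl x) := by
  obtain ⟨n, σ, p, h⟩ := exists_realizeSimplex x
  exact .simplex σ (.const _ p) _ fun _ => h.symm

theorem SimplicialPath.of_cast {x y x' y' : SSet.toTop.obj X} {γ : Path x y} (hx : x' = x)
    (hy : y' = y) (h : SimplicialPath X (γ.cast hx hy)) : SimplicialPath X γ := by
  subst hx hy
  exact h

/-- A Lebesgue subdivision of the interval cuts the path into finitely many pieces, each inside one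
member of the cover; these are concatenated inductively. -/
theorem SimplicialPath.of_cover {x y : SSet.toTop.obj X} (γ : Path x y) {ι : Type*}
    {c : ι → Set unitInterval} (hc : ∀ i, IsOpen (c i)) (hc' : Set.univ ⊆ ⋃ i, c i)
    (h : ∀ i s t, s ≤ t → Set.Icc s t ⊆ c i → SimplicialPath X (γ.subpath s t)) :
    SimplicialPath X γ := by
  obtain ⟨t, ht0, hmono, ⟨N, hN⟩, ht⟩ := exists_monotone_Icc_subset_open_cover_unitInterval hc hc'
  have key : ∀ n, SimplicialPath X (γ.subpath 0 (t n)) := by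
    intro n
    induction n with
    | zero =>
      rw [ht0, Path.subpath_self]
      exact .refl _
    | succ n ih =>
      obtain ⟨i, hi⟩ := ht n
      exact (ih.trans (h i _ _ (hmono n.le_succ) hi)).homotopic
        ⟨Path.Homotopy.subpathTransSubpath γ 0 (t n) (t (n + 1))⟩
  have h1 := key N
  rw [hN N le_rfl, Path.subpath_zero_one] at h1
  exact h1.of_cast

/-- A homotopy whose tracks each lie in a simplex replaces its initial path by its final one,
preceded and followed by the tracks of the endpoints. -/
theorem SimplicialPath.of_square (H : C(unitInterval × unitInterval, SSet.toTop.obj X))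
    {x y : SSet.toTop.obj X} (γ : Path x y) (hγ : ∀ s, γ s = H (s, 0))
    (hH : ∀ s, ∃ (n : ℕ) (σ : X.obj (op ⦋n⦌)) (δ : C(unitInterval, stdSimplex ℝ (Fin (n + 1)))),
      ∀ u, H (s, u) = realizeSimplex X σ (δ u))
    (ht : ∀ (t : Path (H (0, 1)) (H (1, 1))), (∀ s, t s = H (s, 1)) → SimplicialPath X t) :
    SimplicialPath X γ := by
  let t : Path (H (0, 1)) (H (1, 1)) := ⟨⟨fun s => H (s, 1), by fun_prop⟩, rfl, rfl⟩
  let l : Path x (H (0, 1)) := ⟨⟨fun s => H (0, s), by fun_prop⟩, by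
    change H (0, 0) = x
    rw [← hγ, γ.source], rfl⟩
  let r : Path y (H (1, 1)) := ⟨⟨fun s => H (1, s), by fun_prop⟩, by
    change H (1, 0) = y
    rw [← hγ, γ.target], rfl⟩
  have hl : SimplicialPath X l := by
    obtain ⟨n, σ, δ, h⟩ := hH 0
    exact .simplex σ δ l h
  have hr : SimplicialPath X r := by
    obtain ⟨n, σ, δ, h⟩ := hH 1
    exact .simplex σ δ r h
  exact (hl.trans ((ht t fun _ => rfl).trans hr.symm)).homotopic
    (Path.homotopic_of_square H γ l r t hγ (fun _ => rfl) (fun _ => rfl) (fun _ => rfl)).symm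

/-- The depth of a point in its `n`-cell, zero off the open `n`-cells. -/
noncomputable def cellDepth (X : SSet.{u}) (n : ℕ) : SSet.toTop.obj X → ℝ :=
  cellGlue n (fun _ => depth) fun _ => 0

theorem continuous_cellDepth (n : ℕ) :
    Continuous fun z : realizationSkeleton X (n + 1) => cellDepth X n z :=
  continuous_cellGlue (fun _ _ hq => depth_eq_zero hq) (fun _ => continuous_depth) continuous_const

/-- The coordinates on the open cell of a simplex `y`, scaled by the depth so that they
extend by zero. -/
noncomputable def cellCoord {n : ℕ} (y : X.obj (op ⦋n⦌)) : SSet.toTop.obj X → Fin (n + 1) → ℝ :=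
  open Classical in
  cellGlue n (fun y' q => if y' = y then fun i => depth q * q i else 0) fun _ => 0

theorem continuous_cellCoord {n : ℕ} (y : X.obj (op ⦋n⦌)) :
    Continuous fun z : realizationSkeleton X (n + 1) => cellCoord y z := by
  refine continuous_cellGlue (fun y' q hq => ?_) (fun y' => ?_) continuous_const
  · split_ifs
    · funext i
      rw [depth_eq_zero hq, zero_mul]
      rfl
    · rfl
  · split_ifs
    · exact continuous_pi fun i => continuous_depth.mul (continuous_stdSimplex_coord i)
    · exact continuous_const

/-- The homotopy of the `n`-skeleton pushing away from the barycenters of the `n`-cells. -/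
noncomputable def cellPush (X : SSet.{u}) (n : ℕ) :
    SSet.toTop.obj X → C(unitInterval, SSet.toTop.obj X) :=
  cellGlue n (fun y q => (realizeSimplex X y).comp
    ⟨fun u => push q u, continuous_push.comp (Continuous.prodMk_right q)⟩)
    fun z => ContinuousMap.const _ z

theorem continuous_cellPush (n : ℕ) :
    Continuous fun z : realizationSkeleton X (n + 1) => cellPush X n z := by
  refine continuous_cellGlue (fun y q hq => ?_) (fun y => ?_) ContinuousMap.continuous_const'
  · ext u
    exact congrArg (realizeSimplex X y) (push_of_not_interior hq u)
  · exact (ContinuousMap.curry ((realizeSimplex X y).comp ⟨_, continuous_push (n := n)⟩)).continuous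

theorem cellPush_simplex {n : ℕ} (z : SSet.toTop.obj X) :
    ∃ (m : ℕ) (σ : X.obj (op ⦋m⦌)) (δ : C(unitInterval, stdSimplex ℝ (Fin (m + 1)))),
      ∀ u, cellPush X n z u = realizeSimplex X σ (δ u) := by
  by_cases hz : (normalForm z).1 = n
  · obtain ⟨y, q, h, _, _, _⟩ := exists_cell hz
    rw [cellPush, cellGlue_cell h]
    exact ⟨n, y, _, fun u => rfl⟩
  · rw [cellPush, cellGlue_of_dim_ne hz]
    obtain ⟨m, σ, p, h⟩ := exists_realizeSimplex z
    exact ⟨m, σ, .const _ p, fun u => h.symm⟩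

theorem cellPush_zero {n : ℕ} (z : SSet.toTop.obj X) : cellPush X n z 0 = z := by
  by_cases hz : (normalForm z).1 = n
  · obtain ⟨y, q, h, _, _, h1⟩ := exists_cell hz
    rw [cellPush, cellGlue_cell h]
    exact (congrArg (realizeSimplex X y) (push_zero q)).trans h1
  · rw [cellPush, cellGlue_of_dim_ne hz]
    rfl

/-- At small depth the push ends on the boundary of the simplex, where the normal form has smaller
dimension; points outside the open `n`-cells do not move. -/
theorem cellPush_one_mem {n : ℕ} {z : SSet.toTop.obj X} (hz : z ∈ realizationSkeleton X (n + 1))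
    (hd : cellDepth X n z < 1 / 2) : cellPush X n z 1 ∈ realizationSkeleton X n := by
  by_cases hn : (normalForm z).1 = n
  · obtain ⟨y, q, h, _, _, _⟩ := exists_cell hn
    rw [cellDepth, cellGlue_cell h] at hd
    rw [cellPush, cellGlue_cell h]
    refine lt_of_le_of_ne (normalForm_dim_le y (push q 1)) fun h1 => ?_
    exact push_one_not_interior hd (normalForm_of_dim_eq h1).2
  · rw [cellPush, cellGlue_of_dim_ne hn]
    exact lt_of_le_of_ne (Nat.lt_succ_iff.1 hz) hn

theorem exists_cellCoord_ne_zero {n : ℕ} {z : SSet.toTop.obj X} (hd : cellDepth X n z ≠ 0) :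
    ∃ y : X.obj (op ⦋n⦌), cellCoord y z ≠ 0 := by
  have hz : (normalForm z).1 = n := by
    by_contra hz
    exact hd (cellGlue_of_dim_ne hz)
  obtain ⟨y, q, h, _, hq, _⟩ := exists_cell hz
  refine ⟨y, fun h0 => ?_⟩
  rw [cellCoord, cellGlue_cell h, if_pos rfl] at h0
  exact (mul_pos (depth_pos hq) (hq 0)).ne' (congrFun h0 0)

-- The scaled coordinates sum to the depth, since barycentric coordinates sum to `1`. Dividing by
-- the sum recovers the point of the cell, by a formula that is visibly continuous.
open Classical in
theorem cellCoord_inverse {n : ℕ} {y : X.obj (op ⦋n⦌)} {z : SSet.toTop.obj X}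
    (hz : cellCoord y z ≠ 0) : (0 < ∑ i, cellCoord y z i) ∧
      ∃ q : stdSimplex ℝ (Fin (n + 1)), realizeSimplex X y q = z ∧
        ∀ i, q i = cellCoord y z i / ∑ i, cellCoord y z i := by
  have hn : (normalForm z).1 = n := by
    by_contra hn
    exact hz (cellGlue_of_dim_ne hn)
  obtain ⟨y', q, h, _, hq, h1⟩ := exists_cell hn
  have h2 : cellCoord y z = if y' = y then fun i => depth q * q i else 0 := cellGlue_cell h
  have hy : y' = y := by
    by_contra hy
    rw [if_neg hy] at h2
    exact hz h2
  rw [if_pos hy] at h2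
  subst hy
  have h3 : ∑ i, cellCoord y' z i = depth q := by
    rw [h2, ← Finset.mul_sum, stdSimplex.sum_eq_one q, mul_one]
  have h4 := depth_pos hq
  refine ⟨h3 ▸ h4, q, h1, fun i => ?_⟩
  rw [h3, h2]
  exact (mul_div_cancel_left₀ _ h4.ne').symm

theorem SimplicialPath.of_cell {n : ℕ} (y : X.obj (op ⦋n⦌)) {a b : SSet.toTop.obj X}
    (γ : Path a b) (hγ : ∀ t, γ t ∈ realizationSkeleton X (n + 1))
    (hy : ∀ t, cellCoord y (γ t) ≠ 0) : SimplicialPath X γ := by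
  have hc : Continuous fun t => cellCoord y (γ t) :=
    (continuous_cellCoord y).comp (γ.continuous.subtype_mk hγ)
  choose hpos q hq hqi using fun t => cellCoord_inverse (hy t)
  have hqc : Continuous q := by
    refine continuous_induced_rng.2 (continuous_pi fun i => ?_)
    refine Continuous.congr ?_ fun t => (hqi t i).symm
    exact ((continuous_apply i).comp hc).div
      (continuous_finsetSum _ fun j _ => (continuous_apply j).comp hc) fun t => (hpos t).ne'
  exact .simplex y ⟨q, hqc⟩ γ fun t => (hq t).symm

/-- The parameter interval is covered by the open set of depth less than `1 / 2` and one open set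
for each top-dimensional cell. Pieces of the second kind lie in one simplex; pieces of the first
kind are pushed into the lower skeleton along tracks inside simplices, where induction applies. -/
theorem simplicialPath_of_skeleton (n : ℕ) {a b : SSet.toTop.obj X} (γ : Path a b)
    (hγ : ∀ t, γ t ∈ realizationSkeleton X n) : SimplicialPath X γ := by
  induction n generalizing a b γ with
  -- The skeleton with index `0` is empty, because the index bounds dimensions strictly.
  | zero => exact absurd (hγ 0) (Nat.not_lt_zero _)
  | succ n ih =>
    have hγc : Continuous fun t => (⟨γ t, hγ t⟩ : realizationSkeleton X (n + 1)) :=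
      γ.continuous.subtype_mk hγ
    have hmem : ∀ s t r, γ.subpath s t r ∈ realizationSkeleton X (n + 1) := fun s t r => hγ _
    have hval : ∀ s t r, s ≤ t → ∃ r' ∈ Set.Icc s t, γ.subpath s t r = γ r' := by
      intro s t r hst
      have : γ.subpath s t r ∈ γ '' Set.Icc s t := by
        rw [← Path.range_subpath_of_le γ s t hst]
        exact ⟨r, rfl⟩
      obtain ⟨r', hr', h⟩ := this
      exact ⟨r', hr', h.symm⟩
    refine SimplicialPath.of_cover γ (ι := Option (X.obj (op ⦋n⦌)))
      (c := fun o => o.elim {t | cellDepth X n (γ t) < 1 / 2} fun y => {t | cellCoord y (γ t) ≠ 0})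
      ?_ ?_ ?_
    · rintro (_ | y)
      · exact isOpen_lt ((continuous_cellDepth n).comp hγc) continuous_const
      · exact isOpen_ne_fun ((continuous_cellCoord y).comp hγc) continuous_const
    · intro t _
      by_cases ht : cellDepth X n (γ t) < 1 / 2
      · exact Set.mem_iUnion.2 ⟨none, ht⟩
      · have h1 : cellDepth X n (γ t) ≠ 0 := by
          intro h0
          rw [h0] at ht
          norm_num at ht
        obtain ⟨y, hy⟩ := exists_cellCoord_ne_zero h1
        exact Set.mem_iUnion.2 ⟨some y, hy⟩
    · rintro (_ | y) s t hst hsub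
      · have hδc : Continuous fun r =>
            (⟨γ.subpath s t r, hmem s t r⟩ : realizationSkeleton X (n + 1)) :=
          (γ.subpath s t).continuous.subtype_mk _
        let H : C(unitInterval × unitInterval, SSet.toTop.obj X) :=
          ContinuousMap.uncurry ⟨_, (continuous_cellPush n).comp hδc⟩
        have hH : ∀ r u, H (r, u) = cellPush X n (γ.subpath s t r) u := fun _ _ => rfl
        refine SimplicialPath.of_square H _ (fun r => ?_) (fun r => ?_) (fun τ hτ => ?_)
        · rw [hH, cellPush_zero]
        · exact cellPush_simplex (n := n) (γ.subpath s t r)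
        · refine ih τ fun r => ?_
          rw [hτ, hH]
          refine cellPush_one_mem (hmem s t r) ?_
          obtain ⟨r', hr', h⟩ := hval s t r hst
          rw [h]
          exact hsub hr'
      · refine SimplicialPath.of_cell y _ (hmem s t) fun r => ?_
        obtain ⟨r', hr', h⟩ := hval s t r hst
        rw [h]
        exact hsub hr'

/-- Every path in a geometric realization is homotopic to a concatenation of paths in simplices. -/
theorem simplicialPath {a b : SSet.toTop.obj X} (γ : Path a b) : SimplicialPath X γ := by
  obtain ⟨n, hn⟩ := exists_realizationSkeleton_of_compact γ.toContinuousMap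
  exact simplicialPath_of_skeleton n γ hn

end SimplicialPath

/-! ### Loops in the realization of a reduced simplicial set -/

section Reduced

variable {X : SSet.{u}} [Subsingleton (X.obj (op ⦋0⦌))] (v : X.obj (op ⦋0⦌))

theorem realizeSimplex_vertex {n : ℕ} (σ : X.obj (op ⦋n⦌)) (i : Fin (n + 1)) :
    realizeSimplex X σ (stdSimplex.vertex i) = realizeVertex X v := by
  let θ : ⦋0⦌ ⟶ ⦋n⦌ := SimplexCategory.const ⦋0⦌ ⦋n⦌ i
  rw [realizeVertex, Subsingleton.elim v (X.map θ.op σ), realizeSimplex_map, stdSimplex.map_vertex]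
  rfl

/-- The loop traced out by an edge of a reduced simplicial set. -/
noncomputable def edgeLoop (e : X.obj (op ⦋1⦌)) : Path (realizeVertex X v) (realizeVertex X v) :=
  (realizeEdge X e).cast (congrArg _ (Subsingleton.elim _ _)) (congrArg _ (Subsingleton.elim _ _))

theorem edgeLoop_apply (e : X.obj (op ⦋1⦌)) (t : unitInterval) :
    edgeLoop v e t = realizeSimplex X e (stdSimplexHomeomorphUnitInterval.symm t) := rfl

/-- The homotopy class of the loop traced out by an edge. -/
noncomputable def edgeClass (e : X.obj (op ⦋1⦌)) :
    FundamentalGroup (SSet.toTop.obj X) (realizeVertex X v) :=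
  FundamentalGroup.fromPath (Path.Homotopic.Quotient.mk (edgeLoop v e))

/-- The standard path from the first to the second vertex of the one-simplex. -/
noncomputable def stdEdge :
    Path (stdSimplex.vertex 0 : stdSimplex ℝ (Fin 2)) (stdSimplex.vertex 1) where
  toFun := stdSimplexHomeomorphUnitInterval.symm
  continuous_toFun := stdSimplexHomeomorphUnitInterval.symm.continuous
  source' := (Homeomorph.symm_apply_eq _).2 stdSimplexHomeomorphUnitInterval_zero.symm
  target' := (Homeomorph.symm_apply_eq _).2 stdSimplexHomeomorphUnitInterval_one.symm

/-- The image of a path from vertex to vertex in a simplex. -/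
noncomputable def vertexLoop {n : ℕ} (σ : X.obj (op ⦋n⦌)) {i j : Fin (n + 1)}
    (δ : Path (stdSimplex.vertex i : stdSimplex ℝ (Fin (n + 1))) (stdSimplex.vertex j)) :
    Path (realizeVertex X v) (realizeVertex X v) :=
  (δ.map (realizeSimplex X σ).continuous).cast (realizeSimplex_vertex v σ i).symm
    (realizeSimplex_vertex v σ j).symm

theorem vertexLoop_homotopic {n : ℕ} (σ : X.obj (op ⦋n⦌)) {i j : Fin (n + 1)}
    (δ δ' : Path (stdSimplex.vertex i : stdSimplex ℝ (Fin (n + 1))) (stdSimplex.vertex j)) :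
    (vertexLoop v σ δ).Homotopic (vertexLoop v σ δ') :=
  Path.Homotopic.pathCast ((SimplyConnectedSpace.paths_homotopic δ δ').map (realizeSimplex X σ))
    _ _

theorem vertexLoop_trans {n : ℕ} (σ : X.obj (op ⦋n⦌)) {i j k : Fin (n + 1)}
    (δ : Path (stdSimplex.vertex i : stdSimplex ℝ (Fin (n + 1))) (stdSimplex.vertex j))
    (δ' : Path (stdSimplex.vertex j : stdSimplex ℝ (Fin (n + 1))) (stdSimplex.vertex k)) :
    vertexLoop v σ (δ.trans δ') = (vertexLoop v σ δ).trans (vertexLoop v σ δ') := by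
  rw [vertexLoop, Path.map_trans]
  rfl

/-- The standard path along an edge of a simplex. -/
noncomputable def simplexEdge {n : ℕ} (θ : ⦋1⦌ ⟶ ⦋n⦌) :
    Path (stdSimplex.vertex (θ 0) : stdSimplex ℝ (Fin (n + 1))) (stdSimplex.vertex (θ 1)) :=
  (stdEdge.map (stdSimplex.continuous_map θ)).cast (stdSimplex.map_vertex _ _).symm
    (stdSimplex.map_vertex _ _).symm

theorem edgeLoop_map {n : ℕ} (σ : X.obj (op ⦋n⦌)) (θ : ⦋1⦌ ⟶ ⦋n⦌) :
    edgeLoop v (X.map θ.op σ) = vertexLoop v σ (simplexEdge θ) := by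
  ext t
  rw [edgeLoop_apply, realizeSimplex_map]
  rfl

/-- The boundary of a two-simplex gives a relation between loops. -/
theorem edgeClass_triangle (σ : X.obj (op ⦋2⦌)) :
    edgeClass v (X.map (SimplexCategory.δ 1).op σ) =
      edgeClass v (X.map (SimplexCategory.δ 0).op σ) *
        edgeClass v (X.map (SimplexCategory.δ 2).op σ) := by
  refine Quotient.sound ?_
  change (edgeLoop v _).Homotopic ((edgeLoop v _).trans (edgeLoop v _))
  rw [edgeLoop_map, edgeLoop_map, edgeLoop_map]
  let a : Path (stdSimplex.vertex 0 : stdSimplex ℝ (Fin 3)) (stdSimplex.vertex 1) :=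
    simplexEdge (SimplexCategory.δ (n := 1) 2)
  let b : Path (stdSimplex.vertex 1 : stdSimplex ℝ (Fin 3)) (stdSimplex.vertex 2) :=
    simplexEdge (SimplexCategory.δ (n := 1) 0)
  let c : Path (stdSimplex.vertex 0 : stdSimplex ℝ (Fin 3)) (stdSimplex.vertex 2) :=
    simplexEdge (SimplexCategory.δ (n := 1) 1)
  change (vertexLoop v σ c).Homotopic ((vertexLoop v σ a).trans (vertexLoop v σ b))
  rw [← vertexLoop_trans]
  exact vertexLoop_homotopic v σ _ _

theorem edgeClass_degenerate (w : X.obj (op ⦋0⦌)) (θ : ⦋1⦌ ⟶ ⦋0⦌) :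
    edgeClass v (X.map θ.op w) = 1 := by
  have h : edgeLoop v (X.map θ.op w) = Path.refl _ := by
    ext t
    rw [edgeLoop_apply, realizeSimplex_map, Subsingleton.elim (stdSimplex.map _ _)
      (stdSimplex.vertex 0), realizeSimplex_vertex v]
    rfl
  rw [edgeClass, h]
  rfl

/-- The classes of paths from the base point to a point `p` of a simplex which differ from a path
in the simplex by an element of `H`. -/
def simplexPathClasses (H : Subgroup (FundamentalGroup (SSet.toTop.obj X) (realizeVertex X v)))
    {n : ℕ} (σ : X.obj (op ⦋n⦌)) (p : stdSimplex ℝ (Fin (n + 1))) :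
    Set (Σ x : SSet.toTop.obj X, Path.Homotopic.Quotient (realizeVertex X v) x) :=
  {a | ∃ l ∈ H, ∃ (γ : Path (realizeVertex X v) a.1) (δ : Path (stdSimplex.vertex 0) p),
    (∀ t, γ t = realizeSimplex X σ (δ t)) ∧
      a.2 = (FundamentalGroup.toPath l).trans (Path.Homotopic.Quotient.mk γ)}

/-- A path starting at vertex `0` of the smaller simplex and one starting at vertex `0` of `σ`
differ, up to homotopy in `σ`, by the edge from `0` to `θ 0`. Its class lies in `H`, so it is
absorbed into the factor from `H`. -/
theorem simplexPathClasses_map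
    {H : Subgroup (FundamentalGroup (SSet.toTop.obj X) (realizeVertex X v))}
    (hH : ∀ e, edgeClass v e ∈ H) {m n : ℕ} (σ : X.obj (op ⦋n⦌)) (θ : ⦋m⦌ ⟶ ⦋n⦌)
    (p : stdSimplex ℝ (Fin (m + 1))) :
    simplexPathClasses v H (X.map θ.op σ) p = simplexPathClasses v H σ (stdSimplex.map θ p) := by
  let ε : ⦋1⦌ ⟶ ⦋n⦌ := SimplexCategory.mkOfLe 0 (θ 0) (Fin.zero_le _)
  let a : Path (stdSimplex.vertex 0 : stdSimplex ℝ (Fin (n + 1))) (stdSimplex.vertex (θ 0)) :=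
    simplexEdge ε
  have ha : Path.Homotopic.Quotient.mk (vertexLoop v σ a) = edgeClass v (X.map ε.op σ) :=
    congrArg Path.Homotopic.Quotient.mk (edgeLoop_map v σ ε).symm
  have haH : (Path.Homotopic.Quotient.mk (vertexLoop v σ a) :
      FundamentalGroup _ (realizeVertex X v)) ∈ H := by rw [ha]; exact hH _
  have key : ∀ {x : SSet.toTop.obj X} (γ γ' : Path (realizeVertex X v) x)
      (δ : Path (stdSimplex.vertex 0) p) (δ' : Path (stdSimplex.vertex 0) (stdSimplex.map θ p)),
      (∀ t, γ t = realizeSimplex X (X.map θ.op σ) (δ t)) →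
      (∀ t, γ' t = realizeSimplex X σ (δ' t)) →
      Path.Homotopic.Quotient.mk γ' = (Path.Homotopic.Quotient.mk (vertexLoop v σ a)).trans
        (Path.Homotopic.Quotient.mk γ) := by
    intro x γ γ' δ δ' hγ hγ'
    have hx : x = realizeSimplex X σ (stdSimplex.map θ p) := by
      rw [← γ'.target, hγ', δ'.target]
    let d : Path (stdSimplex.vertex (θ 0) : stdSimplex ℝ (Fin (n + 1))) (stdSimplex.map θ p) :=
      (δ.map (stdSimplex.continuous_map θ)).cast (stdSimplex.map_vertex _ _).symm rfl
    have h1 := Path.Homotopic.pathCast ((SimplyConnectedSpace.paths_homotopic δ' (a.trans d)).map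
      (realizeSimplex X σ)) (realizeSimplex_vertex v σ 0).symm hx
    have h2 : (δ'.map (realizeSimplex X σ).continuous).cast (realizeSimplex_vertex v σ 0).symm hx =
        γ' := by
      ext t; exact (hγ' t).symm
    have h3 : ((a.trans d).map (realizeSimplex X σ).continuous).cast
        (realizeSimplex_vertex v σ 0).symm hx = (vertexLoop v σ a).trans γ := by
      have h4 : γ = (d.map (realizeSimplex X σ).continuous).cast
          (realizeSimplex_vertex v σ (θ 0)).symm hx := by
        ext t
        rw [hγ, realizeSimplex_map]
        rfl
      rw [h4, Path.map_trans]
      rfl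
    rw [h2, h3] at h1
    exact Path.Homotopic.Quotient.eq.2 h1
  ext ⟨x, q⟩
  constructor
  · rintro ⟨l, hl, γ, δ, hγ, hq⟩
    dsimp only at γ hγ hq
    have hx : x = realizeSimplex X σ (stdSimplex.map θ p) := by
      rw [← realizeSimplex_map, ← δ.target, ← hγ, γ.target]
    let δ' : Path (stdSimplex.vertex 0) (stdSimplex.map θ p) := PathConnectedSpace.somePath _ _
    let γ' : Path (realizeVertex X v) x := (δ'.map (realizeSimplex X σ).continuous).cast
      (realizeSimplex_vertex v σ 0).symm hx
    -- The right factor of a product in the fundamental group is traversed before the left one, so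
    -- this element is `l` followed by the inverse of the loop of `a`.
    refine ⟨_, H.mul_mem (H.inv_mem haH) hl, γ', δ', fun _ => rfl, ?_⟩
    dsimp only
    rw [hq, key γ γ' δ δ' hγ fun _ => rfl, FundamentalGroup.mul_def, FundamentalGroup.inv_def]
    simp [FundamentalGroup.toPath, ← Path.Homotopic.Quotient.trans_assoc]
    simp [Path.Homotopic.Quotient.trans_assoc]
  · rintro ⟨l, hl, γ', δ', hγ', hq⟩
    dsimp only at γ' hγ' hq
    have hx : x = realizeSimplex X (X.map θ.op σ) p := by
      rw [realizeSimplex_map, ← δ'.target, ← hγ', γ'.target]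
    let δ : Path (stdSimplex.vertex 0) p := PathConnectedSpace.somePath _ _
    let γ : Path (realizeVertex X v) x := (δ.map (realizeSimplex X _).continuous).cast
      (realizeSimplex_vertex v _ 0).symm hx
    refine ⟨_, H.mul_mem haH hl, γ, δ, fun _ => rfl, ?_⟩
    dsimp only
    rw [hq, key γ γ' δ δ' (fun _ => rfl) hγ', FundamentalGroup.mul_def]
    exact (Path.Homotopic.Quotient.trans_assoc _ _ _).symm

/-- The fundamental group of the realization of a reduced simplicial set is generated by the
edges. -/
theorem mem_of_edgeClass_mem
    {H : Subgroup (FundamentalGroup (SSet.toTop.obj X) (realizeVertex X v))}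
    (hH : ∀ e, edgeClass v e ∈ H) (g : FundamentalGroup (SSet.toTop.obj X) (realizeVertex X v)) :
    g ∈ H := by
  -- The function `f` attaches to each point the classes of paths reaching it that come from `H`.
  -- Moving along a path in a simplex preserves these sets, hence so does moving along any path.
  -- Starting with the constant path, a loop ends in the set at the base point, which is `H` itself.
  obtain ⟨f, hf⟩ := exists_realization_function (X := X)
    (fun {n} σ p => simplexPathClasses v H σ p)
    (fun σ θ p => simplexPathClasses_map v hH σ θ p)
  induction g using Path.Homotopic.Quotient.ind with | _ γ
  have h₀ : f (realizeVertex X v) = simplexPathClasses v H v (stdSimplex.vertex 0) := hf v _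
  have hb : (⟨realizeVertex X v, .refl _⟩ :
      Σ x : SSet.toTop.obj X, Path.Homotopic.Quotient (realizeVertex X v) x) ∈
      f (realizeVertex X v) := by
    rw [h₀]
    refine ⟨1, H.one_mem, Path.refl _, Path.refl _, fun t => rfl, ?_⟩
    exact (Path.Homotopic.Quotient.trans_refl _).symm
  have hγ := simplicialPath γ (fun x y γ => ∀ l : Path.Homotopic.Quotient (realizeVertex X v) x,
    ⟨x, l⟩ ∈ f x → ⟨y, l.trans (Path.Homotopic.Quotient.mk γ)⟩ ∈ f y) ⟨?_, ?_, ?_⟩ _ hb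
  · rw [h₀] at hγ
    obtain ⟨l, hl, γ₀, δ₀, h₁, h⟩ := hγ
    dsimp only at γ₀ h₁ h
    have h1 : γ₀ = Path.refl _ := by
      ext t
      rw [h₁, Subsingleton.elim (δ₀ t) (stdSimplex.vertex 0)]
      rfl
    rw [h1] at h
    have h2 : Path.Homotopic.Quotient.mk γ = l :=
      (Path.Homotopic.Quotient.refl_trans _).symm.trans (h.trans (Path.Homotopic.Quotient.trans_refl _))
    change (Path.Homotopic.Quotient.mk γ : FundamentalGroup _ _) ∈ H
    rw [h2]
    exact hl
  · intro n σ δ x y γ hγ l hl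
    have hx : x = realizeSimplex X σ (δ 0) := by rw [← hγ, γ.source]
    have hy : y = realizeSimplex X σ (δ 1) := by rw [← hγ, γ.target]
    have hfx : f x = simplexPathClasses v H σ (δ 0) := by rw [hx, hf]
    have hfy : f y = simplexPathClasses v H σ (δ 1) := by rw [hy, hf]
    rw [hfx] at hl
    rw [hfy]
    obtain ⟨l₀, hl₀, γ₀, δ₀, h₁, hq⟩ := hl
    dsimp only at γ₀ h₁ hq
    let δ' : Path (δ 0) (δ 1) := ⟨δ, rfl, rfl⟩
    refine ⟨l₀, hl₀, γ₀.trans γ, δ₀.trans δ', fun t => ?_, ?_⟩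
    · rw [Path.trans_apply, Path.trans_apply]
      split_ifs
      · exact h₁ _
      · exact hγ _
    · dsimp only
      rw [hq, Path.Homotopic.Quotient.mk_trans, Path.Homotopic.Quotient.trans_assoc]
  · intro x y z γ γ' h h' l hl
    rw [Path.Homotopic.Quotient.mk_trans, ← Path.Homotopic.Quotient.trans_assoc]
    exact h' _ (h _ hl)
  · intro x y γ γ' h h' l hl
    rw [← Path.Homotopic.Quotient.eq.2 h']
    exact h _ hl

end Reduced

/-! ### Step functions with values in a group -/

section StepFunctions

open MeasureTheory Topology

/-- Functions on the half-open unit interval, with the pseudo-distance which measures the set on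
which two functions differ. -/
def StepFun (P : Type u) : Type u := Set.Ico (0 : ℝ) 1 → P

namespace StepFun

variable {P : Type u}

/-- The set on which two functions differ. -/
def diffSet (f g : StepFun P) : Set ℝ := Subtype.val '' {x | f x ≠ g x}

noncomputable instance : PseudoEMetricSpace (StepFun P) where
  edist f g := volume (diffSet f g)
  edist_self f := by simp [diffSet]
  edist_comm f g := by simp only [diffSet, ne_comm]
  -- Outer measure is subadditive on all sets, so no measurability of the functions is required.
  edist_triangle f g h := by
    refine (measure_mono ?_).trans (measure_union_le _ _)
    rintro _ ⟨x, hx, rfl⟩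
    by_cases hfg : f x = g x
    · exact Or.inr ⟨x, fun hgh => hx (hfg.trans hgh), rfl⟩
    · exact Or.inl ⟨x, hfg, rfl⟩

theorem edist_def (f g : StepFun P) : edist f g = volume (diffSet f g) := rfl

variable [Group P]

instance : MulAction P (StepFun P) where
  smul g f := fun x => g * f x
  one_smul _ := funext fun _ => one_mul _
  mul_smul _ _ _ := funext fun _ => mul_assoc _ _ _

theorem smul_apply (g : P) (f : StepFun P) (x : Set.Ico (0 : ℝ) 1) : (g • f) x = g * f x := rfl

instance : IsIsometricSMul P (StepFun P) where
  isometry_smul g f f' := by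
    simp only [edist_def, diffSet, smul_apply, ne_eq, mul_right_inj]

/-- A nontrivial translation changes the value at every point, so the two functions differ on an
interval of length `1`. -/
theorem edist_smul_self {g : P} (hg : g ≠ 1) (f : StepFun P) : edist (g • f) f = 1 := by
  have h : diffSet (g • f) f = Set.Ico (0 : ℝ) 1 := by
    simp [diffSet, smul_apply, hg]
    rfl
  rw [edist_def, h, Real.volume_Ico]
  simp

/-- The orbits of the translations. -/
abbrev Orbits (P : Type u) [Group P] : Type u := MulAction.orbitRel.Quotient P (StepFun P)

/-- The class of a function. -/
def toOrbits (f : StepFun P) : Orbits P := Quotient.mk'' f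

theorem toOrbits_smul (g : P) (f : StepFun P) : toOrbits (g • f) = toOrbits f :=
  Quotient.sound ⟨g, rfl⟩

/-- The action is isometric and nontrivial elements move every function by distance `1`; balls of
radius `1 / 2` are therefore disjoint from their nontrivial translates. -/
theorem isQuotientCoveringMap_toOrbits :
    IsQuotientCoveringMap (toOrbits : StepFun P → Orbits P) P where
  toIsQuotientMap := isQuotientMap_quotient_mk'
  continuous_const_smul g := (isometry_smul (StepFun P) g).continuous
  apply_eq_iff_mem_orbit := by
    intro f f'
    exact Quotient.eq''.trans MulAction.orbitRel_apply
  disjoint f := by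
    refine ⟨Metric.eball f (1 / 2), Metric.eball_mem_nhds f (by simp), ?_⟩
    rintro g ⟨_, ⟨h, hh, rfl⟩, hgh⟩
    by_contra hg
    have h1 := edist_smul_self hg h
    have h2 : edist (g • h) h < 1 / 2 + 1 / 2 :=
      (edist_triangle_right _ _ f).trans_lt (ENNReal.add_lt_add hgh hh)
    rw [h1, ENNReal.add_halves] at h2
    exact lt_irrefl _ h2

end StepFun

/-! ### The step function of a point of a simplex -/

section StepIndex

open Finset

/-- The index of the interval of length `t i` which contains `x`. -/
noncomputable def stepIndex {n : ℕ} (t : stdSimplex ℝ (Fin (n + 1))) (x : ℝ) : Fin (n + 1) :=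
  sInf {k | x < ∑ i ∈ Iic k, t i}

theorem sum_Iic_mono {n : ℕ} (t : stdSimplex ℝ (Fin (n + 1))) :
    Monotone fun k : Fin (n + 1) => ∑ i ∈ Iic k, t i := fun _ _ h =>
  sum_le_sum_of_subset_of_nonneg (Iic_subset_Iic.2 h) fun i _ _ => t.2.1 i

theorem stepIndex_le_iff {n : ℕ} (t : stdSimplex ℝ (Fin (n + 1))) {x : ℝ} (hx : x < 1)
    (k : Fin (n + 1)) : stepIndex t x ≤ k ↔ x < ∑ i ∈ Iic k, t i := by
  constructor
  · intro h
    have hne : {k | x < ∑ i ∈ Iic k, t i}.Nonempty := by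
      refine ⟨⊤, ?_⟩
      rw [Set.mem_ofPred_eq, Iic_top]
      exact hx.trans_eq t.2.2.symm
    have := hne.csInf_mem (Set.toFinite _)
    exact lt_of_lt_of_le this (sum_Iic_mono t h)
  · intro h
    exact sInf_le h

theorem sum_Iio_stepIndex_le {n : ℕ} (t : stdSimplex ℝ (Fin (n + 1))) {x : ℝ} (hx₀ : 0 ≤ x)
    (hx : x < 1) : ∑ i ∈ Iio (stepIndex t x), t i ≤ x := by
  rcases Fin.eq_zero_or_eq_succ (stepIndex t x) with h | ⟨k, h⟩
  · rw [h, show Iio (0 : Fin (n + 1)) = ∅ from Iio_bot, sum_empty]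
    exact hx₀
  · have h1 : ¬ stepIndex t x ≤ k.castSucc := by
      rw [h, not_le]; exact Fin.castSucc_lt_succ
    rw [stepIndex_le_iff t hx, not_lt] at h1
    have h2 : Iio (stepIndex t x) = Iic k.castSucc := by
      ext i
      simp only [mem_Iio, mem_Iic, h, Fin.lt_def, Fin.le_def, Fin.val_succ, Fin.val_castSucc]
      omega
    rw [h2]
    exact h1

/-- A partial sum of the pushed-forward weights is the sum of `t j` over `θ j ≤ k`. As `θ` is
monotone, this is a sum over an initial segment, and it exceeds `x` exactly when the segment
contains the index of `x`. -/
theorem stepIndex_map {m n : ℕ} (θ : Fin (m + 1) →o Fin (n + 1)) (t : stdSimplex ℝ (Fin (m + 1)))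
    {x : ℝ} (hx₀ : 0 ≤ x) (hx : x < 1) :
    stepIndex (stdSimplex.map θ t) x = θ (stepIndex t x) := by
  refine eq_of_forall_ge_iff fun k => ?_
  have hs : ∑ i ∈ Iic k, stdSimplex.map θ t i = ∑ j with θ j ≤ k, t j := by
    simp only [stdSimplex.map_apply_sum]
    rw [← sum_biUnion]
    · congr 1
      ext j
      simp
    · intro a _ b _ hab
      exact disjoint_filter.2 fun j _ h h' => hab (h.symm.trans h')
  rw [stepIndex_le_iff _ hx, hs]
  constructor
  · intro h
    by_contra! hk
    refine (lt_irrefl x) (h.trans_le (le_trans ?_ (sum_Iio_stepIndex_le t hx₀ hx)))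
    refine sum_le_sum_of_subset_of_nonneg (fun j hj => ?_) fun i _ _ => t.2.1 i
    rw [mem_filter] at hj
    exact mem_Iio.2 (θ.monotone.reflect_lt (hj.2.trans_lt hk))
  · intro h
    refine lt_of_lt_of_le ((stepIndex_le_iff t hx _).1 le_rfl) ?_
    refine sum_le_sum_of_subset_of_nonneg (fun j hj => ?_) fun i _ _ => t.2.1 i
    exact mem_filter.2 ⟨mem_univ _, (θ.monotone (mem_Iic.1 hj)).trans h⟩

theorem stepIndex_vertex {n : ℕ} (i : Fin (n + 1)) {x : ℝ} (hx₀ : 0 ≤ x) (hx : x < 1) :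
    stepIndex (stdSimplex.vertex i : stdSimplex ℝ (Fin (n + 1))) x = i := by
  refine eq_of_forall_ge_iff fun k => ?_
  rw [stepIndex_le_iff _ hx]
  have : ∑ j ∈ Iic k, (stdSimplex.vertex i : stdSimplex ℝ (Fin (n + 1))) j =
      if i ≤ k then 1 else 0 := by
    simp [stdSimplex.vertex, Pi.single_apply]
  rw [this]
  split_ifs with h
  · simp [hx, h]
  · simp [hx₀, h]

variable {P : Type u}

/-- The step function with the values `q i` on intervals of lengths `t i`. -/
noncomputable def stepFun {n : ℕ} (q : Fin (n + 1) → P) (t : stdSimplex ℝ (Fin (n + 1))) :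
    StepFun P := fun x => q (stepIndex t x)

/-- Where the step functions differ, the indices for `s` and `t` differ, so some breakpoint, a
partial sum, has passed across the point. -/
theorem edist_stepFun_le {n : ℕ} (q : Fin (n + 1) → P) (s t : stdSimplex ℝ (Fin (n + 1))) :
    edist (stepFun q s) (stepFun q t) ≤
      ∑ k, ENNReal.ofReal |(∑ i ∈ Iic k, t i) - ∑ i ∈ Iic k, s i| := by
  rw [StepFun.edist_def]
  have : StepFun.diffSet (stepFun q s) (stepFun q t) ⊆
      ⋃ k ∈ (univ : Finset (Fin (n + 1))), Set.uIcc (∑ i ∈ Iic k, s i) (∑ i ∈ Iic k, t i) := by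
    rintro _ ⟨⟨x, hx₀, hx⟩, hne, rfl⟩
    have hst : stepIndex s x ≠ stepIndex t x := fun h => hne (congrArg q h)
    simp only [Set.mem_iUnion, mem_univ, exists_const]
    rcases lt_or_gt_of_ne hst with h | h
    · refine ⟨stepIndex s x, Set.mem_uIcc.2 (Or.inr ⟨?_, ?_⟩)⟩
      · rw [← not_le, stepIndex_le_iff t hx, not_lt] at h; exact h
      · exact ((stepIndex_le_iff s hx _).1 le_rfl).le
    · refine ⟨stepIndex t x, Set.mem_uIcc.2 (Or.inl ⟨?_, ?_⟩)⟩
      · have h := not_le.2 h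
        rw [stepIndex_le_iff s hx, not_lt] at h; exact h
      · exact ((stepIndex_le_iff t hx _).1 le_rfl).le
  refine (measure_mono this).trans ((measure_biUnion_finset_le _ _).trans_eq ?_)
  simp only [Real.volume_interval]

theorem continuous_stepFun {n : ℕ} (q : Fin (n + 1) → P) : Continuous (stepFun q) := by
  refine continuous_iff_continuousAt.2 fun s => tendsto_iff_edist_tendsto_0.2 ?_
  have hc : Continuous fun t : stdSimplex ℝ (Fin (n + 1)) =>
      ∑ k : Fin (n + 1), ENNReal.ofReal |(∑ i ∈ Iic k, s i) - ∑ i ∈ Iic k, t i| := by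
    refine continuous_finsetSum _ fun k _ => ENNReal.continuous_ofReal.comp
      (continuous_const.sub (continuous_finsetSum _ fun i _ => ?_)).abs
    exact (continuous_apply i).comp continuous_subtype_val
  have h0 := hc.tendsto s
  simp only [sub_self, abs_zero, ENNReal.ofReal_zero, sum_const_zero] at h0
  exact tendsto_of_tendsto_of_tendsto_of_le_of_le tendsto_const_nhds h0 (fun _ => zero_le)
    fun t => edist_stepFun_le q t s

end StepIndex

/-! ### Homomorphisms defined by cocycles -/

section Cocycle

variable {X : SSet.{u}} [Subsingleton (X.obj (op ⦋0⦌))] (v : X.obj (op ⦋0⦌))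

/-- A family of functions on the vertices of the simplices of a reduced simplicial set, compatible
up to translations, defines a homomorphism on the fundamental group of the realization. -/
theorem exists_hom_of_cocycle {P : Type u} [CommGroup P]
    (q : ∀ {n : ℕ}, X.obj (op ⦋n⦌) → Fin (n + 1) → P)
    (hq : ∀ {m n : ℕ} (σ : X.obj (op ⦋n⦌)) (θ : ⦋m⦌ ⟶ ⦋n⦌),
      ∃ g : P, ∀ i, q (X.map θ.op σ) i = g * q σ (θ i)) :
    ∃ ψ : FundamentalGroup (SSet.toTop.obj X) (realizeVertex X v) →* P,
      ∀ e, ψ (edgeClass v e) = (q e 0)⁻¹ * q e 1 := by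
  let c : RealizationCocone X (StepFun.Orbits P) :=
    { app := fun {n} σ => ⟨fun t => StepFun.toOrbits (stepFun (q σ) t),
        StepFun.isQuotientCoveringMap_toOrbits.continuous.comp (continuous_stepFun _)⟩
      comp := fun {m n} σ θ t => by
        obtain ⟨g, hg⟩ := hq σ θ
        have h : stepFun (q (X.map θ.op σ)) t = g • stepFun (q σ) (stdSimplex.map θ t) := by
          funext ⟨x, hx₀, hx⟩
          have h1 := stepIndex_map θ.toOrderHom t hx₀ hx
          exact (hg _).trans (congrArg (fun i => g * q σ i) h1.symm)
        change StepFun.toOrbits _ = StepFun.toOrbits _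
        rw [h, StepFun.toOrbits_smul] }
  have hc : ∀ {n : ℕ} (σ : X.obj (op ⦋n⦌)) t, c.desc (realizeSimplex X σ t) =
      StepFun.toOrbits (stepFun (q σ) t) := fun σ t => c.desc_realizeSimplex σ t
  have hvertex : ∀ {n : ℕ} (σ : X.obj (op ⦋n⦌)) i (g : P),
      StepFun.toOrbits (g • stepFun (q σ) (stdSimplex.vertex i)) =
        c.desc (realizeVertex X v) := by
    intro n σ i g
    rw [StepFun.toOrbits_smul, ← hc, realizeSimplex_vertex v]
  let hp := StepFun.isQuotientCoveringMap_toOrbits (P := P)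
  let e₀ : (StepFun.toOrbits : StepFun P → StepFun.Orbits P) ⁻¹' {c.desc (realizeVertex X v)} :=
    ⟨(1 : P) • stepFun (q v) (stdSimplex.vertex 0), hvertex v 0 1⟩
  -- Monodromy takes values in the opposite group, which is identified with `P` by commutativity.
  refine ⟨((MulOpposite.opMulEquiv (M := P)).symm.toMonoidHom.comp
    (hp.fundamentalGroupToMulOpposite e₀)).comp (FundamentalGroup.map c.desc _), fun e => ?_⟩
  -- This translation makes the lift along `e` start at the chosen point `e₀` of the fibre, the
  -- constant function `q v 0`. The lift ends at the constant function `g * q e 1`, the translate of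
  -- `e₀` by `(q e 0)⁻¹ * q e 1`.
  let g : P := q v 0 * (q e 0)⁻¹
  let e₁ : (StepFun.toOrbits : StepFun P → StepFun.Orbits P) ⁻¹' {c.desc (realizeVertex X v)} :=
    ⟨g • stepFun (q e) (stdSimplex.vertex 1), hvertex e 1 g⟩
  let Γ : Path e₀.1 e₁.1 :=
    { toFun := fun t => g • stepFun (q e) (stdEdge t)
      continuous_toFun := (hp.continuous_const_smul g).comp
        ((continuous_stepFun _).comp stdEdge.continuous)
      source' := by
        rw [stdEdge.source]
        funext ⟨x, hx₀, hx⟩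
        simp only [e₀, StepFun.smul_apply, stepFun, stepIndex_vertex _ hx₀ hx, g]
        simp
      target' := by rw [stdEdge.target] }
  have hΓ : hp.isCoveringMap.monodromy
      (FundamentalGroup.map c.desc _ (edgeClass v e)) e₀ = e₁ := by
    refine hp.isCoveringMap.monodromy_eq_of_map_eq (Path.Homotopic.Quotient.mk Γ) ?_
    refine congrArg Path.Homotopic.Quotient.mk (Path.ext (funext fun t => ?_))
    exact (StepFun.toOrbits_smul g _).trans (hc e (stdEdge t)).symm
  have h := (hp.fundamentalGroupToMulOpposite_apply_eq_Iff (e := e₀)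
    (γ := FundamentalGroup.map c.desc _ (edgeClass v e))
    (g := MulOpposite.op ((q e 0)⁻¹ * q e 1))).2 (by
      rw [hΓ]
      funext ⟨x, hx₀, hx⟩
      simp only [e₀, e₁, MulOpposite.unop_op, StepFun.smul_apply, stepFun,
        stepIndex_vertex _ hx₀ hx, g]
      rw [one_mul, mul_comm, mul_assoc])
  exact congrArg MulOpposite.unop h

end Cocycle

end StepFunctions

/-! ### Double functors into thin double categories -/

namespace DoubleCategory

/-- A double category in which squares are determined by their boundaries. -/
def Thin (C : DoubleCategory.{u}) : Prop :=
  ∀ {A B A' B' : C.Obj} (f : MHom A B) (g : EHom A A') (g' : EHom B B') (f' : MHom A' B'),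
    Subsingleton (C.Sq f g g' f')

theorem Thin.heq {C : DoubleCategory.{u}} (hC : C.Thin) {A B A' B' : C.Obj}
    {f₁ f₂ : MHom A B} {g₁ g₂ : EHom A A'} {h₁ h₂ : EHom B B'} {k₁ k₂ : MHom A' B'}
    (ef : f₁ = f₂) (eg : g₁ = g₂) (eh : h₁ = h₂) (ek : k₁ = k₂) (α : C.Sq f₁ g₁ h₁ k₁)
    (β : C.Sq f₂ g₂ h₂ k₂) : HEq α β := by
  subst ef eg eh ek
  exact heq_of_eq ((hC _ _ _ _).elim _ _)

end DoubleCategory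

namespace DoubleFunctor

variable {D : DoubleCategory.{v}} {C : DoubleCategory.{u}}

theorem ext_of_thin (hC : C.Thin) {F F' : DoubleFunctor D C} (hobj : ∀ x, F.obj x = F'.obj x)
    (hM : ∀ {x y : D.Obj} (f : MHom x y), HEq (F.mapM f) (F'.mapM f))
    (hE : ∀ {x y : D.Obj} (g : EHom x y), HEq (F.mapE g) (F'.mapE g)) : F = F' := by
  cases F with
  | mk obj mapM mapE mapSq =>
    cases F' with
    | mk obj' mapM' mapE' mapSq' =>
      obtain rfl : obj = obj' := funext hobj
      obtain rfl : @mapM = @mapM' := by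
        funext x y f; exact eq_of_heq (hM f)
      obtain rfl : @mapE = @mapE' := by
        funext x y f; exact eq_of_heq (hE f)
      obtain rfl : @mapSq = @mapSq' := by
        funext x y x' y' f g g' f' α
        exact (hC _ _ _ _).elim _ _
      rfl

/-- A double functor into a thin double category. -/
noncomputable def ofThin (hC : C.Thin) (obj : D.Obj → C.Obj)
    (mapM : ∀ {x y : D.Obj}, MHom x y → MHom (obj x) (obj y))
    (mapE : ∀ {x y : D.Obj}, EHom x y → EHom (obj x) (obj y))
    (mapM_id : ∀ x : D.Obj, mapM (𝟙 (toM x)) = 𝟙 _)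
    (mapM_comp : ∀ {x y z : D.Obj} (f : MHom x y) (f' : MHom y z),
      mapM (f ≫ f') = mapM f ≫ mapM f')
    (mapE_id : ∀ x : D.Obj, mapE (𝟙 (toE x)) = 𝟙 _)
    (mapE_comp : ∀ {x y z : D.Obj} (g : EHom x y) (g' : EHom y z),
      mapE (g ≫ g') = mapE g ≫ mapE g')
    (sq : ∀ {x y x' y' : D.Obj} {f : MHom x y} {g : EHom x x'} {g' : EHom y y'} {f' : MHom x' y'},
      D.Sq f g g' f' → Nonempty (C.Sq (mapM f) (mapE g) (mapE g') (mapM f'))) :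
    DoubleFunctor D C where
  obj := obj
  mapM := mapM
  mapE := mapE
  mapSq α := (sq α).some
  mapM_id := mapM_id
  mapM_comp := mapM_comp
  mapE_id := mapE_id
  mapE_comp := mapE_comp
  mapSq_hId _ := hC.heq (mapM_id _) rfl rfl (mapM_id _) _ _
  mapSq_vId _ := hC.heq rfl (mapE_id _) (mapE_id _) rfl _ _
  mapSq_hComp _ _ := hC.heq (mapM_comp _ _) rfl rfl (mapM_comp _ _) _ _
  mapSq_vComp _ _ := hC.heq rfl (mapE_comp _ _) (mapE_comp _ _) rfl _ _

end DoubleFunctor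

/-! ### Staircases of length zero and one -/

namespace GCGW

variable {C : DoubleCategory.{u}} (G : GCGW C)

theorem thin {C : DoubleCategory.{u}} (G : GCGW C) : C.Thin := G.sq_subsingleton

theorem S_thin {C : DoubleCategory.{u}} (G : GCGW C) (n : ℕ) : (G.S n).Thin := by
  intro F₁ F₂ F₃ F₄ μ η η' μ'
  constructor
  intro α β
  funext x
  exact (G.sq_subsingleton _ _ _ _).elim _ _

theorem subsingleton_mHom {C : DoubleCategory.{u}} (G : GCGW C) {A : C.Obj} (hA : A = G.empty)
    (B : C.Obj) : Subsingleton (MHom A B) := by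
  subst hA
  exact ⟨fun _ _ => G.emptyM.hom_ext _ _⟩

theorem subsingleton_eHom {C : DoubleCategory.{u}} (G : GCGW C) {A : C.Obj} (hA : A = G.empty)
    (B : C.Obj) : Subsingleton (EHom A B) := by
  subst hA
  exact ⟨fun _ _ => G.emptyE.hom_ext _ _⟩

theorem diagram_diag {C : DoubleCategory.{u}} (G : GCGW C) {n : ℕ} (F : (G.S n).Obj)
    {x : StairObj n} (hx : ¬ x.1.1 < x.1.2) : (S.diagram G F).obj x = G.empty := by
  obtain ⟨⟨i, j⟩, hij⟩ := x
  obtain rfl : i = j := le_antisymm hij (not_lt.1 hx)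
  exact F.2.1 i

theorem S_zero_subsingleton_mHom {C : DoubleCategory.{u}} (G : GCGW C) (F F' : (G.S 0).Obj) :
    Subsingleton (MHom F F') := by
  constructor
  intro μ μ'
  refine MTrans.ext (funext fun x => ?_)
  exact (G.subsingleton_mHom (G.diagram_diag F
    (by rw [Subsingleton.elim (α := Fin 1) x.1.1 x.1.2]; exact lt_irrefl _)) _).elim _ _

theorem S_zero_subsingleton_eHom {C : DoubleCategory.{u}} (G : GCGW C) (F F' : (G.S 0).Obj) :
    Subsingleton (EHom F F') := by
  constructor
  intro μ μ'
  refine ETrans.ext (funext fun x => ?_)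
  exact (G.subsingleton_eHom (G.diagram_diag F
    (by rw [Subsingleton.elim (α := Fin 1) x.1.1 x.1.2]; exact lt_irrefl _)) _).elim _ _

/-- Every arrow of the shape either is the identity of the position `(0, 1)` or starts on the
diagonal, where the object is initial; thinness takes care of the squares. -/
theorem eq_stairOne {C : DoubleCategory.{u}} (G : GCGW C) (F : (G.S 1).Obj) :
    F = G.stairOne ((S.diagram G F).obj (Stair.mk 0 1 (Fin.zero_le _))) := by
  have hx : ∀ x : StairObj 1, x.1.1 < x.1.2 → x = Stair.mk 0 1 (Fin.zero_le _) := by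
    intro x h
    refine Subtype.ext (Prod.ext ?_ ?_)
    all_goals
      apply Fin.ext
      have := x.1.2.2
      rw [Fin.lt_def] at h
      simp only [Stair.mk, Fin.val_zero, Fin.val_one]
      omega
  have hobj : ∀ x, (S.diagram G F).obj x =
      (S.diagram G (G.stairOne ((S.diagram G F).obj (Stair.mk 0 1 (Fin.zero_le _))))).obj x := by
    intro x
    by_cases h : x.1.1 < x.1.2
    · rw [hx x h, stairOne_obj]
    · rw [G.diagram_diag _ h, G.diagram_diag _ h]
  refine Subtype.ext (DoubleFunctor.ext_of_thin G.thin hobj ?_ ?_)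
  · intro x y f
    by_cases h : x.1.1 < x.1.2
    · obtain rfl : x = y := (hx x h).trans (hx y (stair_lt_of_m f h)).symm
      obtain rfl : f = 𝟙 _ := rfl
      erw [DoubleFunctor.mapM_id, DoubleFunctor.mapM_id]
      exact congr_arg_heq (fun A : C.Obj => 𝟙 (toM A)) (hobj x)
    · have := G.subsingleton_mHom (G.diagram_diag F h) ((S.diagram G F).obj y)
      exact Subsingleton.helim (congr (congrArg (@MHom C) (hobj x)) (hobj y)) _ _
  · intro x y f
    by_cases h : x.1.1 < x.1.2
    · obtain rfl : x = y := (hx x h).trans (hx y (stair_lt_of_e f h)).symm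
      obtain rfl : f = 𝟙 _ := rfl
      erw [DoubleFunctor.mapE_id, DoubleFunctor.mapE_id]
      exact congr_arg_heq (fun A : C.Obj => 𝟙 (toE A)) (hobj x)
    · have := G.subsingleton_eHom (G.diagram_diag F h) ((S.diagram G F).obj y)
      exact Subsingleton.helim (congr (congrArg (@EHom C) (hobj x)) (hobj y)) _ _

end GCGW

/-! ### The diagonal simplicial set is reduced -/

namespace ECGW

variable {C : DoubleCategory.{u}} (W : ECGW C)

theorem nerveW_zero_subsingleton (p q : ℕ) : Subsingleton (W.NerveW 0 p q) := by
  constructor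
  intro H H'
  have := W.S_zero_subsingleton
  have hobj : ∀ x, H.1.obj x = H'.1.obj x := fun x => Subsingleton.elim _ _
  refine Subtype.ext (DoubleFunctor.ext_of_thin (W.S_thin 0) hobj ?_ ?_)
  · intro x y f
    have := W.S_zero_subsingleton_mHom (H.1.obj x) (H.1.obj y)
    exact Subsingleton.helim (congr (congrArg (@MHom _) (hobj x)) (hobj y)) _ _
  · intro x y f
    have := W.S_zero_subsingleton_eHom (H.1.obj x) (H.1.obj y)
    exact Subsingleton.helim (congr (congrArg (@EHom _) (hobj x)) (hobj y)) _ _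

instance : Subsingleton (W.diagNerve.obj (op ⦋0⦌)) := W.nerveW_zero_subsingleton 0 0

/-- The class in `K_0` of an edge of the diagonal simplicial set. -/
noncomputable def nerveClass (H : W.NerveW 1 1 1) : W.K₀ := edgeClass (X := W.diagNerve) W.vertex H

theorem loopClass_eq (A : C.Obj) :
    W.loopClass A = W.nerveClass (W.constNerve (W.stairOne A) 1 1) := rfl

theorem nerveClass_triangle (σ : W.NerveW 2 2 2) :
    W.nerveClass (NerveW.map W (SimplexCategory.δ (n := 1) 1).toOrderHom
        (SimplexCategory.δ (n := 1) 1).toOrderHom (SimplexCategory.δ (n := 1) 1).toOrderHom σ) =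
      W.nerveClass (NerveW.map W (SimplexCategory.δ (n := 1) 0).toOrderHom
        (SimplexCategory.δ (n := 1) 0).toOrderHom (SimplexCategory.δ (n := 1) 0).toOrderHom σ) *
      W.nerveClass (NerveW.map W (SimplexCategory.δ (n := 1) 2).toOrderHom
        (SimplexCategory.δ (n := 1) 2).toOrderHom (SimplexCategory.δ (n := 1) 2).toOrderHom σ) :=
  edgeClass_triangle (X := W.diagNerve) W.vertex σ

/-- The double nerve of `S_0` has a single simplex in each bidegree, so an edge degenerate in the
staircase direction alone is already a degenerate edge of the diagonal. -/
theorem nerveClass_res (H : W.NerveW 0 1 1) (θ : ⦋1⦌ ⟶ ⦋0⦌) :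
    W.nerveClass (NerveW.map W θ.toOrderHom OrderHom.id OrderHom.id H) = 1 := by
  have := W.nerveW_zero_subsingleton 1 1
  rw [Subsingleton.elim H (W.constNerve W.stairZero 1 1)]
  exact edgeClass_degenerate (X := W.diagNerve) W.vertex W.vertex θ

end ECGW

namespace ECGW

variable {C : DoubleCategory.{u}} (W : ECGW C)

/-! ### Edges of the diagonal simplicial set -/

/-- The staircase direction may be degenerated by `θ` independently of the degeneration of the nerve
directions by `η`; this yields 2-simplices that are not degenerations of `H` in the diagonal. -/
theorem nerveClass_triangle_map (H : W.NerveW 1 1 1) (θ η : Fin 3 →o Fin 2) :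
    W.nerveClass (NerveW.map W (θ.comp (SimplexCategory.δ (n := 1) 1).toOrderHom)
        (η.comp (SimplexCategory.δ (n := 1) 1).toOrderHom)
        (η.comp (SimplexCategory.δ (n := 1) 1).toOrderHom) H) =
      W.nerveClass (NerveW.map W (θ.comp (SimplexCategory.δ (n := 1) 0).toOrderHom)
        (η.comp (SimplexCategory.δ (n := 1) 0).toOrderHom)
        (η.comp (SimplexCategory.δ (n := 1) 0).toOrderHom) H) *
      W.nerveClass (NerveW.map W (θ.comp (SimplexCategory.δ (n := 1) 2).toOrderHom)
        (η.comp (SimplexCategory.δ (n := 1) 2).toOrderHom)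
        (η.comp (SimplexCategory.δ (n := 1) 2).toOrderHom) H) :=
  W.nerveClass_triangle (NerveW.map W (n' := 2) (p' := 2) (q' := 2) θ η η H)

theorem nerveClass_map_id (H : W.NerveW 1 1 1) :
    NerveW.map W OrderHom.id OrderHom.id OrderHom.id H = H := rfl

theorem nerveClass_map_const_left (H : W.NerveW 1 1 1) (i : Fin 2) :
    W.nerveClass (NerveW.map W (OrderHom.const (Fin 2) i) OrderHom.id OrderHom.id H) = 1 :=
  W.nerveClass_res (NerveW.map W (n' := 0) (OrderHom.const (Fin 1) i) OrderHom.id OrderHom.id H)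
    (SimplexCategory.σ (n := 0) 0)

theorem map_const_right (H : W.NerveW 1 1 1) (i : Fin 2) :
    NerveW.map W OrderHom.id (OrderHom.const (Fin 2) i) (OrderHom.const (Fin 2) i) H =
      W.constNerve (H.1.obj (i, i)) 1 1 := by
  refine Subtype.ext (DoubleFunctor.ext_of_thin (W.S_thin 1) (fun _ => rfl) ?_ ?_)
  · intro x y f
    exact heq_of_eq (H.1.mapM_id (i, i))
  · intro x y f
    exact heq_of_eq (H.1.mapE_id (i, i))

theorem σ_zero_comp_δ : ((SimplexCategory.σ (n := 1) 0).toOrderHom.comp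
      (SimplexCategory.δ (n := 1) 0).toOrderHom = OrderHom.id ∧
    (SimplexCategory.σ (n := 1) 0).toOrderHom.comp
      (SimplexCategory.δ (n := 1) 1).toOrderHom = OrderHom.id) ∧
    (SimplexCategory.σ (n := 1) 0).toOrderHom.comp
      (SimplexCategory.δ (n := 1) 2).toOrderHom = OrderHom.const (Fin 2) (0 : Fin 2) := by
  refine ⟨⟨?_, ?_⟩, ?_⟩ <;> ext i <;> fin_cases i <;> rfl

theorem σ_one_comp_δ : ((SimplexCategory.σ (n := 1) 1).toOrderHom.comp
      (SimplexCategory.δ (n := 1) 1).toOrderHom = OrderHom.id ∧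
    (SimplexCategory.σ (n := 1) 1).toOrderHom.comp
      (SimplexCategory.δ (n := 1) 2).toOrderHom = OrderHom.id) ∧
    (SimplexCategory.σ (n := 1) 1).toOrderHom.comp
      (SimplexCategory.δ (n := 1) 0).toOrderHom = OrderHom.const (Fin 2) (1 : Fin 2) := by
  refine ⟨⟨?_, ?_⟩, ?_⟩ <;> ext i <;> fin_cases i <;> rfl

/-- One half of the square with sides in the staircase and nerve directions is a 2-simplex. Its long
side is `H`; one short side is constant in the staircase direction, hence trivial, and the other is
the constant edge on the last corner. The other half of the square gives `nerveClass_eq_first`. -/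
theorem nerveClass_eq_last (H : W.NerveW 1 1 1) :
    W.nerveClass H = W.nerveClass (W.constNerve (H.1.obj ((1 : Fin 2), (1 : Fin 2))) 1 1) := by
  obtain ⟨⟨h₀, h₁⟩, h₂⟩ := σ_zero_comp_δ
  obtain ⟨⟨k₁, k₂⟩, k₀⟩ := σ_one_comp_δ
  have h := W.nerveClass_triangle_map H (SimplexCategory.σ (n := 1) 0).toOrderHom
    (SimplexCategory.σ (n := 1) 1).toOrderHom
  rwa [h₀, h₁, h₂, k₀, k₁, k₂, nerveClass_map_id, nerveClass_map_const_left, map_const_right,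
    mul_one] at h

theorem nerveClass_eq_first (H : W.NerveW 1 1 1) :
    W.nerveClass H = W.nerveClass (W.constNerve (H.1.obj ((0 : Fin 2), (0 : Fin 2))) 1 1) := by
  obtain ⟨⟨h₀, h₁⟩, h₂⟩ := σ_zero_comp_δ
  obtain ⟨⟨k₁, k₂⟩, k₀⟩ := σ_one_comp_δ
  have h := W.nerveClass_triangle_map H (SimplexCategory.σ (n := 1) 1).toOrderHom
    (SimplexCategory.σ (n := 1) 0).toOrderHom
  rwa [h₀, h₁, h₂, k₀, k₁, k₂, nerveClass_map_id, nerveClass_map_const_left, map_const_right,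
    one_mul] at h

/-- The class of an edge is the class of the loop of an object. -/
theorem nerveClass_eq_loopClass (H : W.NerveW 1 1 1) : ∃ A, W.nerveClass H = W.loopClass A := by
  rw [nerveClass_eq_first, W.eq_stairOne (H.1.obj ((0 : Fin 2), (0 : Fin 2)))]
  exact ⟨_, rfl⟩

end ECGW

/-! ### Edges from m-equivalences of staircases -/

namespace DoubleFunctor

variable {D : DoubleCategory.{u}}

/-- A chain of m-morphisms in a thin double category as a matrix of squares with identities as
e-morphisms. -/
noncomputable def ofChain (hD : D.Thin) {p : ℕ} (q : ℕ) (K : Fin (p + 1) ⥤ D.M) :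
    DoubleFunctor (Grid p q) D :=
  ofThin hD (fun x => (K.obj x.1).as) (fun f => K.map (homOfLE f.down.1))
    (fun g => eqToHom (congrArg (fun i => toE (K.obj i).as) g.down.1))
    (fun x => K.map_id _) (fun f f' => K.map_comp _ _) (fun x => rfl)
    (fun g g' => (eqToHom_trans _ _).symm) (by
      rintro ⟨x₁, x₂⟩ ⟨y₁, y₂⟩ ⟨x₁', x₂'⟩ ⟨y₁', y₂'⟩ ⟨f⟩ ⟨g⟩ ⟨g'⟩ ⟨f'⟩ -
      obtain rfl : x₁ = x₁' := g.1
      obtain rfl : y₁ = y₁' := g'.1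
      exact ⟨D.vId _⟩)

end DoubleFunctor

namespace ECGW

variable {C : DoubleCategory.{u}} (W : ECGW C)

theorem seEquiv_eqToHom {n : ℕ} {F F' : (W.S n).Obj} (h : toE F = toE F') :
    W.SEEquiv (eqToHom h : EHom F F') := by
  cases h
  exact fun _ => W.eEquiv_id _

/-- With identities in the e-direction, `μ` is an edge with first corner `F` and last corner `F'`,
and its class is that of either corner. -/
theorem nerveClass_eq_of_smEquiv {F F' : (W.S 1).Obj} (μ : MHom F F') (hμ : W.SMEquiv μ) :
    W.nerveClass (W.constNerve F 1 1) = W.nerveClass (W.constNerve F' 1 1) := by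
  let K : Fin 2 ⥤ (W.S 1).M := ComposableArrows.mk₁ (X₀ := toM F) (X₁ := toM F') μ
  let H : W.NerveW 1 1 1 := ⟨DoubleFunctor.ofChain (W.S_thin 1) 1 K, by
    rintro ⟨i, x⟩ ⟨j, y⟩ ⟨f, -⟩
    change i ≤ j at f
    have h : ∀ (i j : Fin 2) (f : i ≤ j), W.SMEquiv (F := (K.obj i).as) (F' := (K.obj j).as)
        (K.map (homOfLE f)) := by
      intro i j f
      fin_cases i <;> fin_cases j
      · exact fun _ => W.mEquiv_id _
      · exact hμ
      · exact absurd f (by decide)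
      · exact fun _ => W.mEquiv_id _
    exact h i j f, fun {x y} g => W.seEquiv_eqToHom
      (congrArg (fun i => toE (K.obj i).as) g.down.1)⟩
  exact (W.nerveClass_eq_first H).symm.trans (W.nerveClass_eq_last H)

end ECGW

namespace GCGW

variable {C : DoubleCategory.{u}} (G : GCGW C)

/-! ### Squares from good squares and objects with trivial cokernel -/

/-- The functor `k` is full, and it leaves the map between codomains unchanged. -/
theorem exists_sq_of_goodSq {C : DoubleCategory.{u}} (G : GCGW C) {A B A' B' : C.Obj}
    (g : EHom A B) (g' : EHom A' B') (u : MHom (G.ker g) (G.ker g')) (f' : MHom B B')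
    (h : G.k.GoodSq (G.kerι g) u f' (G.kerι g')) : ∃ f : MHom A A', Nonempty (C.Sq f g g' f') := by
  obtain ⟨w, h⟩ := h
  have := G.k_equiv
  obtain ⟨φ, hφ⟩ := G.k.functor.map_surjective (X := SqArr.mk g) (Y := SqArr.mk g')
    ⟨Arrow.homMk u f' w, h⟩
  have hb : φ.bot = f' := congrArg (fun t => t.hom.right) hφ
  exact ⟨φ.top, hb ▸ ⟨φ.sq⟩⟩

theorem isIso_of_isInitial {C : DoubleCategory.{u}} {A B : C.Obj}
    (hA : IsInitial (toM A)) (hB : IsInitial (toM B)) (f : MHom A B) : IsIso f :=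
  ⟨hB.to _, hA.hom_ext _ _, hB.hom_ext _ _⟩

theorem kerCok_cokι {C : DoubleCategory.{u}} (G : GCGW C) {A B : C.Obj} (f : MHom A B) :
    G.KerCok f (G.cokι f) := G.dist_coker f

theorem kerCok_kerι {C : DoubleCategory.{u}} (G : GCGW C) {A B : C.Obj} (g : EHom A B) :
    G.KerCok (G.kerι g) g := G.dist_ker g

/-- The staircase consisting of initial objects. -/
def zeroStair (n : ℕ) : (G.S n).Obj :=
  ⟨DoubleFunctor.const _ _ G.empty, fun _ => rfl, fun {x y x' y'} f g g' f' α => by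
    have h : G.k.map (C.hId (𝟙 (toE G.empty))) = 𝟙 _ := G.k.map_hId _
    have : IsIso (G.k.map (C.hId (𝟙 (toE G.empty)))) := by rw [h]; infer_instance
    exact this⟩

end GCGW

/-! ### Acyclic objects have trivial loops -/

namespace ECGW

variable {C : DoubleCategory.{u}} (W : ECGW C)

/-- In the transposed square `f` is the map between domains, so axiom (G) applies and axiom (GS)
transposes back. -/
theorem goodSq_of_isIso {C : DoubleCategory.{u}} (W : ECGW C) {A B A' B' : C.Obj} (f : MHom A B)
    (g : MHom A A') (h : MHom B B') (f' : MHom A' B') (w : g ≫ f' = f ≫ h) [IsIso f] :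
    W.k.GoodSq f g h f' :=
  (W.gs_m f g h f').2 ⟨w.symm, W.good_m_of_isIso _ ‹IsIso f›⟩

/-- The kernel of the identity of ∅ is initial and its kernel arrow is invertible. The square of
kernels over ∅ → B is then good and lifts along `k`; initiality determines the top side of the lift.
-/
theorem exists_sq_empty {C : DoubleCategory.{u}} (W : ECGW C) {A B : C.Obj} (g : EHom A B) :
    Nonempty (C.Sq (W.emptyM.to (toM A)) (𝟙 (toE W.empty)) g (W.emptyM.to (toM B))) := by
  have := W.isIso_to_ker_id W.empty
  let hi : IsInitial (toM (W.ker (𝟙 (toE W.empty)))) :=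
    W.emptyM.ofIso (asIso (W.emptyM.to (toM (W.ker (𝟙 (toE W.empty))))))
  have := GCGW.isIso_of_isInitial hi W.emptyM (W.kerι (𝟙 (toE W.empty)))
  obtain ⟨f, ⟨s⟩⟩ := W.exists_sq_of_goodSq (𝟙 (toE W.empty)) g (hi.to _) (W.emptyM.to (toM B))
    (W.goodSq_of_isIso _ _ _ _ (hi.hom_ext _ _))
  obtain rfl : f = W.emptyM.to _ := W.emptyM.hom_ext _ _
  exact ⟨s⟩

/-- The m-morphism from the zero staircase. -/
noncomputable def fromZeroStair {n : ℕ} (F : (W.S n).Obj) : MHom (W.zeroStair n) F :=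
  (⟨fun x => W.emptyM.to _,
    fun {x y} f => by
      exact W.goodSq_of_isIso (𝟙 (toM W.empty)) _ _ _ (W.emptyM.hom_ext _ _),
    fun g => W.exists_sq_empty _⟩ : W.MTrans _ _)

theorem mEquiv_fromEmpty {A : C.Obj} (hA : W.Acyclic A) : W.MEquiv (W.emptyM.to (toM A)) :=
  W.acyclic_cok _ _ (W.kerCok_cokι _) (W.acyclic_of_isInitial _ ⟨W.emptyM⟩) hA

/-- The loop of an acyclic object is trivial. -/
theorem loopClass_of_acyclic {A : C.Obj} (hA : W.Acyclic A) : W.loopClass A = 1 := by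
  have h := W.nerveClass_eq_of_smEquiv (W.fromZeroStair (W.stairOne A)) (fun x => by
    refine W.mEquiv_fromEmpty ?_
    change W.Acyclic (W.stairOneObj A x)
    unfold GCGW.stairOneObj
    split_ifs
    · exact hA
    · exact W.acyclic_of_isInitial _ ⟨W.emptyM⟩)
  rw [loopClass_eq, ← h]
  -- The zero staircase of length one is restricted from the zero staircase of length zero.
  exact W.nerveClass_res (W.constNerve (W.zeroStair 0) 1 1) (SimplexCategory.σ (n := 0) 0)

end ECGW

namespace GCGW

variable {C : DoubleCategory.{u}} (G : GCGW C)

/-! ### Staircases from kernel-cokernel pairs -/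

/-- A staircase is determined by the m-morphisms to its last column and the e-morphisms to its
first row. -/
theorem exists_staircase {C : DoubleCategory.{u}} (G : GCGW C) {n : ℕ}
    (T : Fin (n + 1) → Fin (n + 1) → C.Obj) (hT : ∀ i, T i i = G.empty)
    (a : ∀ i j, MHom (T i j) (T i (Fin.last n))) (e : ∀ i j, EHom (T i j) (T 0 j))
    (hM : ∀ i j j', j ≤ j' → ∃ f : MHom (T i j) (T i j'), f ≫ a i j' = a i j)
    (hE : ∀ i i' j, i' ≤ i → i ≤ j → ∃ g : EHom (T i j) (T i' j), g ≫ e i' j = e i j)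
    (hsq : ∀ {i i' j j'}, i' < i → i ≤ j → j < j' → ∀ (f : MHom (T i j) (T i j'))
      (g : EHom (T i j) (T i' j)) (g' : EHom (T i j') (T i' j')) (f' : MHom (T i' j) (T i' j')),
      f ≫ a i j' = a i j → g ≫ e i' j = e i j → g' ≫ e i' j' = e i j' → f' ≫ a i' j' = a i' j →
      G.Distinguished f g g' f') :
    ∃ F : (G.S n).Obj, ∀ x, (S.diagram G F).obj x = T x.1.1 x.1.2 := by
  -- The rows of `x` and `y` are only propositionally equal, hence the `eqToHom`. The maps to the
  -- last column are monic, so these equations determine the chosen arrows and force functoriality.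
  have hM' : ∀ {x y : StairObj n} (f : MHom (C := Stair n) x y),
      ∃ m : MHom (T x.1.1 x.1.2) (T y.1.1 y.1.2), m ≫ a y.1.1 y.1.2 = a x.1.1 x.1.2 ≫
        eqToHom (congrArg (fun i => toM (T i (Fin.last n))) f.down.1) := by
    rintro ⟨⟨i, j⟩, h⟩ ⟨⟨i', j'⟩, h'⟩ ⟨f⟩
    obtain rfl : i = i' := f.1
    obtain ⟨m, hm⟩ := hM i j j' f.2
    exact ⟨m, hm.trans (Category.comp_id _).symm⟩
  have hE' : ∀ {x y : StairObj n} (g : EHom (C := Stair n) x y),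
      ∃ m : EHom (T x.1.1 x.1.2) (T y.1.1 y.1.2), m ≫ e y.1.1 y.1.2 = e x.1.1 x.1.2 ≫
        eqToHom (congrArg (fun j => toE (T 0 j)) g.down.2) := by
    rintro ⟨⟨i, j⟩, h⟩ ⟨⟨i', j'⟩, h'⟩ ⟨g⟩
    obtain rfl : j = j' := g.2
    obtain ⟨m, hm⟩ := hE i i' j g.1 h
    exact ⟨m, hm.trans (Category.comp_id _).symm⟩
  choose m hm using @hM'
  choose ε hε using @hE'
  have hd : ∀ {x y x' y' : StairObj n} (f : MHom (C := Stair n) x y) (g : EHom (C := Stair n) x x')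
      (g' : EHom (C := Stair n) y y') (f' : MHom (C := Stair n) x' y'),
      G.Distinguished (m f) (ε g) (ε g') (m f') := by
    rintro ⟨⟨i, j⟩, h₁⟩ ⟨⟨i₂, j'⟩, h₂⟩ ⟨⟨i', j₂⟩, h₃⟩ ⟨⟨i₃, j₃⟩, h₄⟩ f g g' f'
    obtain rfl : i = i₂ := f.down.1
    obtain rfl : i' = i₃ := f'.down.1
    obtain rfl : j = j₂ := g.down.2
    obtain rfl : j' = j₃ := g'.down.2
    have hf := (hm f).trans (Category.comp_id _)
    have hf' := (hm f').trans (Category.comp_id _)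
    have hg := (hε g).trans (Category.comp_id _)
    have hg' := (hε g').trans (Category.comp_id _)
    have := G.mono_m (a i j')
    have := G.mono_m (a i' j')
    have := G.mono_e (e i' j)
    have := G.mono_e (e i' j')
    -- If the two rows or the two columns coincide, the square is an identity square, distinguished
    -- for free; only strict inequalities use `hsq`.
    rcases lt_or_eq_of_le (show i' ≤ i from g.down.1) with hi | rfl
    · rcases lt_or_eq_of_le (show j ≤ j' from f.down.2) with hj | rfl
      · exact hsq hi h₁ hj _ _ _ _ hf hg hg' hf'
      · have e₁ : m f = 𝟙 _ := by
          rw [← cancel_mono (a i j)]; exact hf.trans (Category.id_comp _).symm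
        have e₂ : m f' = 𝟙 _ := by
          rw [← cancel_mono (a i' j)]; exact hf'.trans (Category.id_comp _).symm
        have e₃ : ε g = ε g' := congrArg ε (by cases g; cases g'; rfl)
        rw [e₁, e₂, e₃]
        exact G.distinguished_hId _
    · have e₁ : ε g = 𝟙 _ := by
        rw [← cancel_mono (e i' j)]; exact hg.trans (Category.id_comp _).symm
      have e₂ : ε g' = 𝟙 _ := by
        rw [← cancel_mono (e i' j')]; exact hg'.trans (Category.id_comp _).symm
      have e₃ : m f = m f' := congrArg m (by cases f; cases f'; rfl)
      rw [e₁, e₂, e₃]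
      exact G.distinguished_vId _
  have hm₁ : ∀ x : StairObj n, m (𝟙 (toM (C := Stair n) x)) = 𝟙 _ := by
    intro x
    have := G.mono_m (a x.1.1 x.1.2)
    rw [← cancel_mono (a x.1.1 x.1.2)]
    exact ((hm _).trans (Category.comp_id _)).trans (Category.id_comp _).symm
  have hm₂ : ∀ {x y z : StairObj n} (f : MHom (C := Stair n) x y) (f' : MHom (C := Stair n) y z),
      m (f ≫ f') = m f ≫ m f' := by
    intro x y z f f'
    have := G.mono_m (a z.1.1 z.1.2)
    rw [← cancel_mono (a z.1.1 z.1.2), hm, Category.assoc, hm, reassoc_of% hm f, eqToHom_trans]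
  have hε₁ : ∀ x : StairObj n, ε (𝟙 (toE (C := Stair n) x)) = 𝟙 _ := by
    intro x
    have := G.mono_e (e x.1.1 x.1.2)
    rw [← cancel_mono (e x.1.1 x.1.2)]
    exact ((hε _).trans (Category.comp_id _)).trans (Category.id_comp _).symm
  have hε₂ : ∀ {x y z : StairObj n} (g : EHom (C := Stair n) x y) (g' : EHom (C := Stair n) y z),
      ε (g ≫ g') = ε g ≫ ε g' := by
    intro x y z g g'
    have := G.mono_e (e z.1.1 z.1.2)
    rw [← cancel_mono (e z.1.1 z.1.2), hε, Category.assoc, hε, reassoc_of% hε g, eqToHom_trans]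
  refine ⟨⟨DoubleFunctor.ofThin (D := Stair n) G.thin (fun x => T x.1.1 x.1.2) m ε hm₁ hm₂ hε₁ hε₂
    (fun {x y x' y' f g g' f'} _ => (hd f g g' f').nonempty), hT, ?_⟩, fun _ => rfl⟩
  intro x y x' y' f g g' f' α
  obtain ⟨β, hβ⟩ := hd f g g' f'
  rw [(G.sq_subsingleton _ _ _ _).elim (DoubleFunctor.mapSq _ α) β]
  exact hβ

/-- The objects of the staircase of length two on a kernel-cokernel pair. -/
def stairTwoObj (A B Q : C.Obj) : Fin 3 → Fin 3 → C.Obj :=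
  ![![G.empty, A, B], ![G.empty, G.empty, Q], ![G.empty, G.empty, G.empty]]

/-- The m-morphisms to the last column. -/
def stairTwoM {A B : C.Obj} (Q : C.Obj) (f : MHom A B) : ∀ i j : Fin 3,
    MHom (G.stairTwoObj A B Q i j) (G.stairTwoObj A B Q i 2) :=
  Fin.cons (Fin.cons (G.emptyM.to (toM B)) (Fin.cons f (Fin.cons (𝟙 (toM B)) finZeroElim)))
    (Fin.cons (Fin.cons (G.emptyM.to (toM Q)) (Fin.cons (G.emptyM.to (toM Q))
      (Fin.cons (𝟙 (toM Q)) finZeroElim)))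
    (Fin.cons (Fin.cons (𝟙 (toM G.empty)) (Fin.cons (𝟙 (toM G.empty))
      (Fin.cons (𝟙 (toM G.empty)) finZeroElim))) finZeroElim))

/-- The e-morphisms to the first row. -/
def stairTwoE (A : C.Obj) {B Q : C.Obj} (g : EHom Q B) : ∀ i j : Fin 3,
    EHom (G.stairTwoObj A B Q i j) (G.stairTwoObj A B Q 0 j) :=
  Fin.cons (Fin.cons (𝟙 (toE G.empty)) (Fin.cons (𝟙 (toE A)) (Fin.cons (𝟙 (toE B)) finZeroElim)))
    (Fin.cons (Fin.cons (𝟙 (toE G.empty)) (Fin.cons (G.emptyE.to (toE A))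
      (Fin.cons g finZeroElim)))
    (Fin.cons (Fin.cons (𝟙 (toE G.empty)) (Fin.cons (G.emptyE.to (toE A))
      (Fin.cons (G.emptyE.to (toE B)) finZeroElim))) finZeroElim))

theorem exists_stairTwo {C : DoubleCategory.{u}} (G : GCGW C) {A B Q : C.Obj} (f : MHom A B)
    (g : EHom Q B) (h : G.KerCok f g) :
    ∃ F : (G.S 2).Obj, ∀ x, (S.diagram G F).obj x = G.stairTwoObj A B Q x.1.1 x.1.2 := by
  refine G.exists_staircase (G.stairTwoObj A B Q) (fun i => by fin_cases i <;> rfl)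
    (G.stairTwoM Q f) (G.stairTwoE A g) ?_ ?_ ?_
  · intro i j j' hj
    fin_cases i <;> fin_cases j <;> fin_cases j' <;>
      first
      | exact ⟨G.emptyM.to _, G.emptyM.hom_ext _ _⟩
      | exact ⟨𝟙 _, Category.id_comp _⟩
      | exact ⟨f, Category.comp_id _⟩
      | exact absurd hj (by decide)
  · intro i i' j hi hij
    fin_cases i <;> fin_cases i' <;> fin_cases j <;>
      first
      | exact ⟨G.emptyE.to _, G.emptyE.hom_ext _ _⟩
      | exact ⟨𝟙 _, Category.id_comp _⟩
      | exact ⟨g, Category.comp_id _⟩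
      | exact absurd hi (by decide)
  · intro i i' j j' hi hij hj m ε ε' m' hm hε hε' hm'
    -- Among indices at most `2`, the inequalities `i' < i ≤ j < j'` leave only `(0, 1, 1, 2)`, the
    -- square of the given kernel-cokernel pair.
    obtain rfl : i' = 0 := by
      ext; have := Fin.lt_def.1 hi; have := Fin.lt_def.1 hj; have := Fin.le_def.1 hij
      have := j'.2; simp only [Fin.val_zero]; omega
    obtain rfl : i = 1 := by
      ext; have := Fin.lt_def.1 hi; have := Fin.lt_def.1 hj; have := Fin.le_def.1 hij
      have := j'.2; simp only [Fin.val_zero, Fin.val_one] at *; omega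
    obtain rfl : j = 1 := by
      ext; have := Fin.lt_def.1 hi; have := Fin.lt_def.1 hj; have := Fin.le_def.1 hij
      have := j'.2; simp only [Fin.val_zero, Fin.val_one] at *; omega
    obtain rfl : j' = 2 := by
      ext; have := Fin.lt_def.1 hi; have := Fin.lt_def.1 hj; have := Fin.le_def.1 hij
      have := j'.2; simp only [Fin.val_zero, Fin.val_one, Fin.val_two] at *; omega
    obtain rfl : ε' = g := (Category.comp_id _).symm.trans hε'
    obtain rfl : m' = f := (Category.comp_id _).symm.trans hm'
    obtain rfl : m = G.emptyM.to _ := G.emptyM.hom_ext _ _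
    obtain rfl : ε = G.emptyE.to _ := G.emptyE.hom_ext _ _
    exact h

end GCGW

/-! ### Relations between loop classes and the isomorphism -/

namespace ECGW

variable {C : DoubleCategory.{u}} (W : ECGW C)

theorem nerveClass_res_two (F : (W.S 2).Obj) (i j : Fin 3) (hij : i ≤ j)
    (θ : Fin 2 →o Fin 3) (h₀ : θ 0 = i) (h₁ : θ 1 = j) :
    W.nerveClass (NerveW.map W θ θ θ (W.constNerve F 2 2)) =
      W.loopClass ((GCGW.S.diagram W.toGCGW F).obj (Stair.mk i j hij)) := by
  subst h₀ h₁
  have h : NerveW.map W θ θ θ (W.constNerve F 2 2) =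
      W.constNerve ((GCGW.S.res W.toGCGW θ).obj F) 1 1 := rfl
  rw [h, W.eq_stairOne ((GCGW.S.res W.toGCGW θ).obj F)]
  rfl

/-- A kernel-cokernel pair gives a relation between loops. -/
theorem loopClass_of_kerCok {A B Q : C.Obj} {f : MHom A B} {g : EHom Q B} (h : W.KerCok f g) :
    W.loopClass B = W.loopClass Q * W.loopClass A := by
  obtain ⟨F, hF⟩ := W.exists_stairTwo f g h
  have h := W.nerveClass_triangle (W.constNerve F 2 2)
  rw [W.nerveClass_res_two F 0 2 (by decide) _ rfl rfl,
    W.nerveClass_res_two F 1 2 (by decide) _ rfl rfl,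
    W.nerveClass_res_two F 0 1 (by decide) _ rfl rfl, hF, hF, hF] at h
  exact h

/-- The cokernel pair expresses the class of `B` as that of the cokernel, which is trivial, times
that of `A`. -/
theorem loopClass_of_mEquiv {A B : C.Obj} (f : MHom A B) (hf : W.MEquiv f) :
    W.loopClass A = W.loopClass B := by
  rw [W.loopClass_of_kerCok (W.kerCok_cokι f), W.loopClass_of_acyclic hf, one_mul]

theorem loopClass_of_eEquiv {A B : C.Obj} (g : EHom A B) (hg : W.EEquiv g) :
    W.loopClass A = W.loopClass B := by
  rw [W.loopClass_of_kerCok (W.kerCok_kerι g), W.loopClass_of_acyclic hg, mul_one]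

theorem loopClass_of_isIso {A B : C.Obj} (f : MHom A B) [IsIso f] :
    W.loopClass A = W.loopClass B := by
  have := W.isIso_to_cok f
  exact W.loopClass_of_mEquiv f
    (W.acyclic_of_isInitial _ ⟨W.emptyM.ofIso (asIso (W.emptyM.to (toM (W.cok f))))⟩)

theorem loopClass_empty : W.loopClass W.empty = 1 :=
  W.loopClass_of_acyclic (W.acyclic_of_isInitial _ ⟨W.emptyM⟩)

theorem loopClass_cok_fromEmpty (A : C.Obj) :
    W.loopClass (W.cok (W.emptyM.to (toM A))) = W.loopClass A := by
  rw [W.loopClass_of_kerCok (W.kerCok_cokι (W.emptyM.to (toM A))), loopClass_empty, mul_one]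

/-- The ⋆-pushout `D` over ∅ contains both objects, and by axiom (⋆) the cokernel of each inclusion
has the class of the other object. The two decompositions of `D` give the two orders of the product.
-/
theorem loopClass_comm (A B : C.Obj) :
    W.loopClass A * W.loopClass B = W.loopClass B * W.loopClass A := by
  obtain ⟨D, inl, inr, -, ⟨v, -, hv⟩, ⟨v', -, hv'⟩⟩ :=
    W.star_m (W.emptyM.to (toM A)) (W.emptyM.to (toM B)) (W.po _ _)
  have h := W.loopClass_of_kerCok (W.kerCok_cokι inr)
  have h' := W.loopClass_of_kerCok (W.kerCok_cokι inl)
  rw [← W.loopClass_of_isIso v, loopClass_cok_fromEmpty] at h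
  rw [← W.loopClass_of_isIso v', loopClass_cok_fromEmpty] at h'
  exact h.symm.trans h'

theorem mem_of_loopClass_mem {H : Subgroup W.K₀} (hH : ∀ A, W.loopClass A ∈ H) (x : W.K₀) :
    x ∈ H :=
  mem_of_edgeClass_mem (X := W.diagNerve) W.vertex (fun e => by
    obtain ⟨A, hA⟩ := W.nerveClass_eq_loopClass e
    have h : W.nerveClass e ∈ H := hA ▸ hH A
    exact h) x

/-- An element commuting with all generators commutes with everything. This is applied to a
generator first, and then to an arbitrary element. -/
theorem K₀_comm (x y : W.K₀) : x * y = y * x := by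
  have key : ∀ z : W.K₀, (∀ A, W.loopClass A * z = z * W.loopClass A) → ∀ x, x * z = z * x :=
    fun z hz x => Subgroup.mem_centralizer_singleton_iff.1
      (W.mem_of_loopClass_mem (fun A => Subgroup.mem_centralizer_singleton_iff.2 (hz A)) x)
  exact key y (fun A => (key _ (fun B => W.loopClass_comm B A) y).symm) x

/-- The classes of `Q` and `D` are those of `A` and `B` times those of the kernels of `g` and `g'`;
these kernels are isomorphic, by the definition of distinguished. -/
theorem loopClass_of_distinguished {A B Q D : C.Obj} {f : MHom A B} {g : EHom A Q}
    {g' : EHom B D} {f' : MHom Q D} (h : W.Distinguished f g g' f') :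
    W.loopClass A * W.loopClass D = W.loopClass B * W.loopClass Q := by
  obtain ⟨α, hα⟩ := h
  rw [W.loopClass_of_kerCok (W.kerCok_kerι g), W.loopClass_of_kerCok (W.kerCok_kerι g'),
    show W.loopClass (W.ker g) = W.loopClass (W.ker g') from @loopClass_of_isIso _ W _ _ (W.k.map α) hα,
    ← mul_assoc, ← mul_assoc, W.K₀_comm (W.loopClass A) (W.loopClass B)]

/-! ### The comparison homomorphisms -/

theorem cls_empty : W.cls W.empty = 0 :=
  (QuotientAddGroup.eq_zero_iff _).2 (AddSubgroup.subset_closure (Or.inl (Or.inl (Or.inl rfl))))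

theorem cls_of_distinguished {A B Q D : C.Obj} {f : MHom A B} {g : EHom A Q}
    {g' : EHom B D} {f' : MHom Q D} (h : W.Distinguished f g g' f') :
    W.cls A + W.cls D = W.cls B + W.cls Q := by
  rw [← sub_eq_zero]
  exact (QuotientAddGroup.eq_zero_iff _).2 (AddSubgroup.subset_closure
    (Or.inl (Or.inl (Or.inr ⟨A, B, Q, D, f, g, g', f', h, rfl⟩))))

theorem cls_of_mEquiv {A B : C.Obj} (f : MHom A B) (hf : W.MEquiv f) : W.cls A = W.cls B := by
  rw [← sub_eq_zero]
  exact (QuotientAddGroup.eq_zero_iff _).2 (AddSubgroup.subset_closure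
    (Or.inl (Or.inr ⟨A, B, f, hf, rfl⟩)))

theorem cls_of_eEquiv {A B : C.Obj} (g : EHom A B) (hg : W.EEquiv g) : W.cls A = W.cls B := by
  rw [← sub_eq_zero]
  exact (QuotientAddGroup.eq_zero_iff _).2 (AddSubgroup.subset_closure (Or.inr ⟨A, B, g, hg, rfl⟩))

theorem exists_presentedHom : ∃ φ : Multiplicative W.Presented →* W.K₀,
    ∀ A, φ (Multiplicative.ofAdd (W.cls A)) = W.loopClass A := by
  let : CommGroup W.K₀ := { (inferInstance : Group W.K₀) with mul_comm := W.K₀_comm }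
  let φ₀ : FreeAbelianGroup C.Obj →+ Additive W.K₀ :=
    FreeAbelianGroup.lift fun A => Additive.ofMul (W.loopClass A)
  have hφ₀ : ∀ A, φ₀ (FreeAbelianGroup.of A) = Additive.ofMul (W.loopClass A) :=
    fun A => FreeAbelianGroup.lift_apply_of _ _
  have hr : AddSubgroup.closure W.relations ≤ φ₀.ker := by
    rw [AddSubgroup.closure_le]
    rintro _ (((rfl | ⟨A, B, Q, D, f, g, g', f', h, rfl⟩) | ⟨A, B, f, hf, rfl⟩) |
      ⟨A, B, g, hg, rfl⟩)
    · exact (hφ₀ _).trans W.loopClass_empty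
    · rw [SetLike.mem_coe, AddMonoidHom.mem_ker, map_sub, map_add, map_add, hφ₀, hφ₀, hφ₀, hφ₀,
        sub_eq_zero]
      exact W.loopClass_of_distinguished h
    · rw [SetLike.mem_coe, AddMonoidHom.mem_ker, map_sub, hφ₀, hφ₀, sub_eq_zero]
      exact W.loopClass_of_mEquiv f hf
    · rw [SetLike.mem_coe, AddMonoidHom.mem_ker, map_sub, hφ₀, hφ₀, sub_eq_zero]
      exact W.loopClass_of_eEquiv g hg
  let φ : W.Presented →+ Additive W.K₀ := QuotientAddGroup.lift _ φ₀ hr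
  exact ⟨AddMonoidHom.toMultiplicativeLeft φ, fun A => hφ₀ A⟩

/-- The distinguished square of the staircase with initial corner at `(i, i)` is additivity along
the first row. -/
theorem cls_stair {n : ℕ} (F : (W.S n).Obj) {i j : Fin (n + 1)} (hij : i ≤ j) :
    W.cls ((GCGW.S.diagram W.toGCGW F).obj (Stair.mk 0 j (Fin.zero_le j))) =
      W.cls ((GCGW.S.diagram W.toGCGW F).obj (Stair.mk 0 i (Fin.zero_le i))) +
        W.cls ((GCGW.S.diagram W.toGCGW F).obj (Stair.mk i j hij)) := by
  let f : MHom (C := Stair n) (Stair.mk i i le_rfl) (Stair.mk i j hij) := ⟨rfl, hij⟩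
  let g : EHom (C := Stair n) (Stair.mk i i le_rfl) (Stair.mk 0 i (Fin.zero_le i)) :=
    ⟨Fin.zero_le i, rfl⟩
  let g' : EHom (C := Stair n) (Stair.mk i j hij) (Stair.mk 0 j (Fin.zero_le j)) :=
    ⟨Fin.zero_le i, rfl⟩
  let f' : MHom (C := Stair n) (Stair.mk 0 i (Fin.zero_le i)) (Stair.mk 0 j (Fin.zero_le j)) :=
    ⟨rfl, hij⟩
  let α : (Stair n).Sq f g g' f' := ()
  have h := W.cls_of_distinguished ⟨(GCGW.S.diagram W.toGCGW F).mapSq α, F.2.2 α⟩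
  rw [W.diagram_diag F (x := Stair.mk i i le_rfl) (lt_irrefl _), cls_empty, zero_add] at h
  rw [h, add_comm]

/-- Any grid point is reached from the first corner by an m-equivalence followed by an
e-equivalence. -/
theorem cls_grid {n p q : ℕ} (H : W.NerveW n p q) (x : (Grid p q).Obj) (s : (Stair n).Obj) :
    W.cls ((GCGW.S.diagram W.toGCGW (H.1.obj x)).obj s) =
      W.cls ((GCGW.S.diagram W.toGCGW (H.1.obj ((0 : Fin (p + 1)), (0 : Fin (q + 1))))).obj s) := by
  let f : MHom (C := Grid p q) ((0 : Fin (p + 1)), (0 : Fin (q + 1))) (x.1, (0 : Fin (q + 1))) :=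
    ⟨Fin.zero_le _, rfl⟩
  let g : EHom (C := Grid p q) (x.1, (0 : Fin (q + 1))) x := ⟨rfl, Fin.zero_le _⟩
  exact ((W.cls_of_mEquiv _ (H.2.1 f s)).trans (W.cls_of_eEquiv _ (H.2.2 g s))).symm

theorem exists_K₀Hom : ∃ ψ : W.K₀ →* Multiplicative W.Presented,
    ∀ A, ψ (W.loopClass A) = Multiplicative.ofAdd (W.cls A) := by
  let q : ∀ {n : ℕ}, W.diagNerve.obj (op ⦋n⦌) → Fin (n + 1) → Multiplicative W.Presented :=
    fun {n} H i => Multiplicative.ofAdd (W.cls ((GCGW.S.diagram W.toGCGW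
      (DoubleFunctor.obj (Subtype.val (p := _) (show W.NerveW n n n from H))
        ((0 : Fin (n + 1)), (0 : Fin (n + 1))))).obj (Stair.mk 0 i (Fin.zero_le i))))
  obtain ⟨ψ, hψ⟩ := exists_hom_of_cocycle (X := W.diagNerve) W.vertex q (by
    intro m n H θ
    -- Restriction along `θ` moves the first row to row `θ 0` and the corner to `(θ 0, θ 0)`. The
    -- corner does not affect classes, and additivity shows that the new row is the old one
    -- translated by the inverse of its value at `θ 0`.
    refine ⟨(q H (θ 0))⁻¹, fun i => ?_⟩
    rw [eq_inv_mul_iff_mul_eq]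
    have hi : θ 0 ≤ θ i := θ.toOrderHom.monotone (Fin.zero_le i)
    have h := W.cls_stair (DoubleFunctor.obj (Subtype.val (p := _) (show W.NerveW n n n from H))
        ((0 : Fin (n + 1)), (0 : Fin (n + 1)))) hi
    have h' := W.cls_grid (show W.NerveW n n n from H) (θ 0, θ 0) (Stair.mk (θ 0) (θ i) hi)
    rw [← h'] at h
    exact congrArg Multiplicative.ofAdd h.symm)
  refine ⟨ψ, fun A => ?_⟩
  have h := hψ (W.edge (W.stairOne A))
  have h₀ : q (W.edge (W.stairOne A)) 0 = 1 := by
    have := W.diagram_diag (W.stairOne A) (x := Stair.mk 0 0 le_rfl) (lt_irrefl _)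
    exact congrArg Multiplicative.ofAdd ((congrArg W.cls this).trans W.cls_empty)
  have h₁ : q (W.edge (W.stairOne A)) 1 = Multiplicative.ofAdd (W.cls A) :=
    congrArg (fun B => Multiplicative.ofAdd (W.cls B)) (W.stairOne_obj A)
  rw [h₀, h₁, inv_one, one_mul] at h
  exact h

end ECGW

theorem mainTheorem10 {C : DoubleCategory.{u}} (W : ECGW C) :
    ∃ φ : Multiplicative W.Presented ≃* W.K₀,
      ∀ A : C.Obj, φ (Multiplicative.ofAdd (W.cls A)) = W.loopClass A := by
  obtain ⟨φ, hφ⟩ := W.exists_presentedHom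
  obtain ⟨ψ, hψ⟩ := W.exists_K₀Hom
  -- Both sides are homomorphisms on a quotient of a free abelian group, so comparing them on the
  -- classes of objects suffices.
  have hinj : ψ.comp φ = MonoidHom.id _ := by
    apply MonoidHom.toAdditive.injective
    apply QuotientAddGroup.addMonoidHom_ext
    apply FreeAbelianGroup.lift_ext
    intro A
    exact (congrArg ψ (hφ A)).trans (hψ A)
  have hsurj : ∀ x, x ∈ φ.range := W.mem_of_loopClass_mem fun A => ⟨_, hφ A⟩
  exact ⟨MulEquiv.ofBijective φ
    ⟨Function.LeftInverse.injective (DFunLike.congr_fun hinj), hsurj⟩, hφ⟩
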